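/- Let $T>0$, let $d$ be a positive integer, and let $\mathcal C_T=\mathcal C([0,T],\mathbf R^d)$ carry the sup norm $\|\cdot\|_{\infty,T}$ of the Euclidean norm. Notation. Let $\mathcal H_T$ be the Hilbert space of all $h(t)=\int_0^t\dot h(s)\,ds$ with $\dot h\in L^2:=L^2([0,T],ds;\mathbf R^d)$, normed by $\|h\|_{\mathcal H_T}=\|\dot h\|_{L^2}$ and identified with its dual; let $\mathfrak e:\mathcal H_T\to\mathcal C_T$ be the inclusion, $\mathfrak e^*:\mathcal C_T^*\to\mathcal H_T$ its adjoint, and $\mu$ the law on $\mathcal C_T$ of a standard $d$-dimensional Brownian motion on $[0,T]$ started at $0$. The Wiener integral $\delta:\mathcal H_T\to L^2(\mu)$ is the isometric extension of $\mathfrak e^*(\eta)\mapsto\langle\eta,\cdot\rangle$. For a cylindrical function $F=f(\delta h_1,\dots,\delta h_k)$, with $f$ in the Schwartz space on $\mathbf R^k$ and $h_i\in\mathcal H_T$, put $\nabla F=\sum_i\partial_if(\delta h_1,\dots,\delta h_k)\,h_i$ and $\nabla^{(2)}F=\sum_{i,j}\partial_i\partial_jf(\delta h_1,\dots,\delta h_k)\,h_i\otimes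 h_j$. The space $\mathbb D_{2,2}(\mathbf R)$, with the operators $\nabla$ and $\nabla^{(2)}$, is obtained by closing the cylindrical functions in $L^2(\mu)\times L^2(\mu;\mathcal H_T)\times L^2(\mu;\mathcal H_T\otimes\mathcal H_T)$ along $F\mapsto(F,\nabla F,\nabla^{(2)}F)$. For a real number $c$ let $\Upsilon_T(c)$ be the set of all $F:\mathcal C_T\to\mathbf R$ in $\mathbb D_{2,2}(\mathbf R)$ such that $\nabla^{(2)}F$ has a version which at every point of $\mathcal C_T$ is a bounded bilinear form on $L^2$ (its values on $\mathcal H_T\times\mathcal H_T\subset L^2\times L^2$ being $\langle\nabla^{(2)}F(x),h\otimes k\rangle_{\mathcal H_T\otimes\mathcal H_T}$ for $\mu$-almost every $x$), and which satisfies $$\bigl|\langle\nabla^{(2)}F(x)-\nabla^{(2)}F(x+g),\,h\otimes k\rangle\bigr|\le c\,\|g\|_{\infty,T}\,\|h\|_{L^2}\,\|k\|_{L^2}$$ for all $x\in\mathcal C_T$, $g\in\mathcal H_T$, $h,k\in L^2$. Put $\Upsilon_T=\bigcup_{c}\Upsilon_T(c)$. Theorem. Let $A$ be a real $d\times d$ matrix.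 For every $y_0\in\mathbf R^d$ and $f\in\mathcal C_T$ the equation $$y(t)=y_0+\int_0^tA\,y(s)\,ds+f(t),\qquad t\in[0,T],$$ has exactly one solution $y=S_{y_0}(f)\in\mathcal C_T$ (if $f(0)=0$, then $y_0=y(0)$), and $f\mapsto S_{y_0}(f)$ is Lipschitz continuous from $\mathcal C_T$ to $\mathcal C_T$, with a constant that does not depend on $y_0$. Moreover, let $\Theta_A=S=S_0$ be the (linear) solution map for $y_0=0$. If $F\in\Upsilon_T$, then $F\circ S\in\Upsilon_T$; more precisely, there is a constant $K\ge0$, depending only on $A$, $d$ and $T$, such that $F\in\Upsilon_T(c)$ implies $F\circ S\in\Upsilon_T(Kc)$ for every $c$. -/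

import Mathlib

open MeasureTheory ProbabilityTheory Filter Topology
open scoped NNReal ENNReal TensorProduct InnerProductSpace

noncomputable section

/-- `C_T(ℝ^d)`: continuous functions `[0,T] → ℝ^d` with the sup norm of the Euclidean norm. -/
abbrev PathSpace (T : ℝ) (d : ℕ) : Type :=
  C(Set.Icc (0 : ℝ) T, EuclideanSpace ℝ (Fin d))

instance PathSpace.instMeasurableSpace (T : ℝ) (d : ℕ) : MeasurableSpace (PathSpace T d) :=
  borel _

instance PathSpace.instBorelSpace (T : ℝ) (d : ℕ) : BorelSpace (PathSpace T d) := ⟨rfl⟩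

/-- Lebesgue measure `ds` on `[0,T]`. -/
def timeMeasure (T : ℝ) : Measure (Set.Icc (0 : ℝ) T) :=
  (volume : Measure ℝ).comap Subtype.val

instance timeMeasure.instIsFiniteMeasure (T : ℝ) : IsFiniteMeasure (timeMeasure T) := by
  constructor
  rw [timeMeasure, comap_subtype_coe_apply measurableSet_Icc, Set.image_univ, Subtype.range_coe]
  exact measure_Icc_lt_top

/-- `L²([0,T], ds; ℝ^d)`. -/
abbrev L2Path (T : ℝ) (d : ℕ) : Type :=
  Lp (EuclideanSpace ℝ (Fin d)) 2 (timeMeasure T)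

/-- The Cameron--Martin space `H_T` of the functions `h(t) = ∫₀ᵗ ḣ(s) ds`, `ḣ ∈ L²`, with
`‖h‖_H = ‖ḣ‖_{L²}`. An element `h` is represented by its (unique) density `ḣ`; the function `h`
itself is `cmEmbed T d h`. -/
abbrev CMSpace (T : ℝ) (d : ℕ) : Type := L2Path T d

lemma L2Path.integrable {T : ℝ} {d : ℕ} (h : L2Path T d) :
    Integrable (h : Set.Icc (0 : ℝ) T → EuclideanSpace ℝ (Fin d)) (timeMeasure T) :=
  (Lp.memLp h).integrable (by norm_num)

lemma L2Path.continuous_primitive {T : ℝ} {d : ℕ} (h : L2Path T d) :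
    Continuous fun t : Set.Icc (0 : ℝ) T => ∫ s in Set.Iic t, h s ∂timeMeasure T := by
  have hat : ∀ t : Set.Icc (0 : ℝ) T, (timeMeasure T) {t} = 0 := by
    intro t
    rw [timeMeasure, comap_subtype_coe_apply measurableSet_Icc, Set.image_singleton]
    exact Real.volume_singleton
  simp_rw [← integral_indicator (measurableSet_Iic)]
  rw [continuous_iff_continuousAt]
  intro t₀
  refine continuousAt_of_dominated (bound := fun s => ‖h s‖) ?_ ?_ h.integrable.norm ?_
  · exact Eventually.of_forall fun t =>
      (h.integrable.indicator measurableSet_Iic).aestronglyMeasurable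
  · exact Eventually.of_forall fun t => Eventually.of_forall fun s =>
      norm_indicator_le_norm_self _ _
  · have : ∀ᵐ s ∂timeMeasure T, s ≠ t₀ := by
      rw [ae_iff]; simpa using hat t₀
    filter_upwards [this] with s hs
    rcases lt_or_gt_of_ne hs with hlt | hgt
    · refine (continuousAt_const (y := h s)).congr ?_
      filter_upwards [Ioi_mem_nhds hlt] with t ht
      rw [Set.indicator_of_mem (show s ∈ Set.Iic t from Set.mem_Iic.2 (le_of_lt ht))]
    · refine (continuousAt_const (y := (0 : EuclideanSpace ℝ (Fin d)))).congr ?_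
      filter_upwards [Iio_mem_nhds hgt] with t ht
      rw [Set.indicator_of_notMem (show s ∉ Set.Iic t from fun h' => not_le_of_gt ht (Set.mem_Iic.1 h'))]

/-- The canonical embedding `𝔢 : H_T → C_T`, `h ↦ (t ↦ ∫₀ᵗ ḣ(s) ds)`. -/
def cmEmbed (T : ℝ) (d : ℕ) : CMSpace T d →L[ℝ] PathSpace T d :=
  LinearMap.mkContinuous
    { toFun := fun h => ⟨fun t => ∫ s in Set.Iic t, h s ∂timeMeasure T, h.continuous_primitive⟩
      map_add' := by
        intro f g
        ext1 t
        simp only [ContinuousMap.coe_mk, ContinuousMap.add_apply]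
        rw [← integral_add f.integrable.integrableOn g.integrable.integrableOn]
        exact integral_congr_ae (ae_restrict_of_ae (Lp.coeFn_add f g))
      map_smul' := by
        intro c f
        ext1 t
        simp only [ContinuousMap.coe_mk, ContinuousMap.smul_apply, RingHom.id_apply]
        rw [← integral_smul]
        exact integral_congr_ae (ae_restrict_of_ae (Lp.coeFn_smul c f)) }
    (((timeMeasure T) Set.univ ^ (1 / 2 : ℝ)).toReal) <| by
    intro h
    refine (ContinuousMap.norm_le _ (by positivity)).2 fun t => ?_
    have h1 : ‖(∫ s in Set.Iic t, h s ∂timeMeasure T)‖ ≤ ∫ s, ‖h s‖ ∂timeMeasure T :=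
      (norm_integral_le_integral_norm _).trans
        (setIntegral_le_integral h.integrable.norm (Eventually.of_forall fun s => norm_nonneg _))
    refine h1.trans ?_
    have h2 : eLpNorm h 1 (timeMeasure T) ≤ eLpNorm h 2 (timeMeasure T) *
        (timeMeasure T) Set.univ ^ (1 / 2 : ℝ) := by
      refine (eLpNorm_le_eLpNorm_mul_rpow_measure_univ (p := 1) (q := 2) (by norm_num)
        (Lp.aestronglyMeasurable h)).trans_eq ?_
      norm_num
    rw [integral_norm_eq_lintegral_enorm (Lp.aestronglyMeasurable h),
      ← eLpNorm_one_eq_lintegral_enorm, mul_comm, Lp.norm_def, ← ENNReal.toReal_mul]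
    refine ENNReal.toReal_mono (ENNReal.mul_ne_top (Lp.eLpNorm_ne_top h) ?_) h2
    exact ENNReal.rpow_ne_top_of_nonneg (by norm_num) (measure_ne_top _ _)

/-- The adjoint `𝔢* : C_T* → H_T* ≃ H_T`, where `H_T` is identified with its dual. -/
def cmAdjoint (T : ℝ) (d : ℕ) (η : PathSpace T d →L[ℝ] ℝ) : CMSpace T d :=
  (InnerProductSpace.toDual ℝ (CMSpace T d)).symm (η.comp (cmEmbed T d))

/-- The element of `H_T`, seen as a (class of) square integrable function on `[0,T]`. -/
def cmToL2 (T : ℝ) (d : ℕ) (h : CMSpace T d) : L2Path T d :=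
  ContinuousMap.toLp 2 (timeMeasure T) ℝ (cmEmbed T d h)

/-- `μ` is the law on `C_T(ℝ^d)` of a standard `d`-dimensional Brownian motion. -/
structure IsWienerMeasure {T : ℝ} {d : ℕ} (μ : Measure (PathSpace T d)) : Prop where
  isProbabilityMeasure : IsProbabilityMeasure μ
  start_zero : ∀ᵐ x ∂μ, ∀ t : Set.Icc (0 : ℝ) T, (t : ℝ) = 0 → x t = 0
  indep_increments : HasIndepIncrements (fun t (x : PathSpace T d) => x t) μ
  law_increments : ∀ s t : Set.Icc (0 : ℝ) T, s ≤ t →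
    μ.map (fun x : PathSpace T d => x t - x s) =
      multivariateGaussian 0 (((t : ℝ) - (s : ℝ)) • (1 : Matrix (Fin d) (Fin d) ℝ))

/-- `φ` is (a version of) the Wiener integral `δh`, the isometric extension to `H_T` of
`𝔢*(η) ↦ ⟨η, ·⟩`: if `𝔢*(ηₙ) → h` in `H_T`, then `ηₙ → δh` in `L²(μ)`. -/
def IsWienerIntegral {T : ℝ} {d : ℕ} (μ : Measure (PathSpace T d)) (h : CMSpace T d)
    (φ : PathSpace T d → ℝ) : Prop :=
  MemLp φ 2 μ ∧ ∃ η : ℕ → (PathSpace T d →L[ℝ] ℝ),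
    Tendsto (fun n => cmAdjoint T d (η n)) atTop (𝓝 h) ∧
    Tendsto (fun n => eLpNorm (fun x => η n x - φ x) 2 μ) atTop (𝓝 0)

/-- The Hilbert space tensor product `H_T ⊗ H_T`. -/
abbrev CMTensor (T : ℝ) (d : ℕ) : Type :=
  UniformSpace.Completion (CMSpace T d ⊗[ℝ] CMSpace T d)

/-- The elementary tensor `h ⊗ k` in `H_T ⊗ H_T`. -/
def cmTmul {T : ℝ} {d : ℕ} (h k : CMSpace T d) : CMTensor T d :=
  ((h ⊗ₜ[ℝ] k : CMSpace T d ⊗[ℝ] CMSpace T d) : CMTensor T d)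

/-- A real cylindrical function `F(y) = f(δh₁(y), …, δh_k(y))`, `f` a Schwartz function on `ℝ^k`
and `h₁, …, h_k ∈ H_T`; `δh i` is a version of the Wiener integral of `h i`. -/
structure Cylindrical {T : ℝ} {d : ℕ} (μ : Measure (PathSpace T d)) where
  k : ℕ
  f : SchwartzMap (Fin k → ℝ) ℝ
  h : Fin k → CMSpace T d
  δh : Fin k → PathSpace T d → ℝ
  isWienerIntegral : ∀ i, IsWienerIntegral μ (h i) (δh i)

namespace Cylindrical

variable {T : ℝ} {d : ℕ} {μ : Measure (PathSpace T d)}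

/-- The vector `(δh₁(y), …, δh_k(y))`. -/
def vec (Φ : Cylindrical μ) (y : PathSpace T d) : Fin Φ.k → ℝ := fun i => Φ.δh i y

/-- The partial derivative `∂ᵢ f`. -/
def partialDeriv (Φ : Cylindrical μ) (i : Fin Φ.k) (v : Fin Φ.k → ℝ) : ℝ :=
  fderiv ℝ (fun w => Φ.f w) v (Pi.single i 1)

/-- The second partial derivative `∂ⱼ ∂ᵢ f`. -/
def partialDeriv₂ (Φ : Cylindrical μ) (i j : Fin Φ.k) (v : Fin Φ.k → ℝ) : ℝ :=
  fderiv ℝ (fun w => Φ.partialDeriv i w) v (Pi.single j 1)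

/-- The function `F` itself. -/
def toFun (Φ : Cylindrical μ) (y : PathSpace T d) : ℝ := Φ.f (Φ.vec y)

/-- `∇F = ∑ᵢ ∂ᵢ f(δh₁, …, δh_k) hᵢ`. -/
def grad (Φ : Cylindrical μ) (y : PathSpace T d) : CMSpace T d :=
  ∑ i, Φ.partialDeriv i (Φ.vec y) • Φ.h i

/-- `∇⁽²⁾F = ∑ᵢⱼ ∂ᵢ∂ⱼ f(δh₁, …, δh_k) hᵢ ⊗ hⱼ`. -/
def grad₂ (Φ : Cylindrical μ) (y : PathSpace T d) : CMTensor T d :=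
  ∑ i, ∑ j, Φ.partialDeriv₂ i j (Φ.vec y) • cmTmul (Φ.h i) (Φ.h j)

end Cylindrical

/-- `F ∈ 𝔻_{2,2}(ℝ)` with `∇F = G₁` and `∇⁽²⁾F = G₂`: `(F, G₁, G₂)` is a limit of cylindrical
functions and their gradients in `L²(μ) × L²(μ; H_T) × L²(μ; H_T ⊗ H_T)`. -/
def HasGrossSobolevGradients {T : ℝ} {d : ℕ} (μ : Measure (PathSpace T d))
    (F : PathSpace T d → ℝ) (G₁ : PathSpace T d → CMSpace T d)
    (G₂ : PathSpace T d → CMTensor T d) : Prop :=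
  MemLp F 2 μ ∧ MemLp G₁ 2 μ ∧ MemLp G₂ 2 μ ∧ ∃ Φ : ℕ → Cylindrical μ,
    Tendsto (fun n => eLpNorm (fun x => (Φ n).toFun x - F x) 2 μ) atTop (𝓝 0) ∧
    Tendsto (fun n => eLpNorm (fun x => (Φ n).grad x - G₁ x) 2 μ) atTop (𝓝 0) ∧
    Tendsto (fun n => eLpNorm (fun x => (Φ n).grad₂ x - G₂ x) 2 μ) atTop (𝓝 0)

/-- `F ∈ 𝔻_{2,2}(ℝ)`, and `∇⁽²⁾F` has a version that takes its values in the bounded bilinear forms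
on `L²([0,T])` and is `H_T`-Lipschitz with constant `c`:
`|⟨∇⁽²⁾F(x) - ∇⁽²⁾F(x+g), h ⊗ k⟩| ≤ c ‖g‖_{C_T} ‖h‖_{L²} ‖k‖_{L²}`
for all `x ∈ C_T`, `g ∈ H_T` and `h, k ∈ L²`. -/
def UpsilonWith {T : ℝ} {d : ℕ} (μ : Measure (PathSpace T d)) (c : ℝ)
    (F : PathSpace T d → ℝ) : Prop :=
  ∃ (G₁ : PathSpace T d → CMSpace T d) (G₂ : PathSpace T d → CMTensor T d)
    (D : PathSpace T d → L2Path T d →L[ℝ] L2Path T d →L[ℝ] ℝ),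
    HasGrossSobolevGradients μ F G₁ G₂ ∧
    (∀ᵐ x ∂μ, ∀ h k : CMSpace T d,
      D x (cmToL2 T d h) (cmToL2 T d k) = ⟪G₂ x, cmTmul h k⟫_ℝ) ∧
    ∀ (x : PathSpace T d) (g : CMSpace T d) (h k : L2Path T d),
      |D x h k - D (x + cmEmbed T d g) h k| ≤ c * ‖cmEmbed T d g‖ * ‖h‖ * ‖k‖

/-- The class `Υ_T`. -/
def Upsilon {T : ℝ} {d : ℕ} (μ : Measure (PathSpace T d)) : Set (PathSpace T d → ℝ) :=
  {F | ∃ c : ℝ, UpsilonWith μ c F}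

/-- `y` solves `y(t) = y₀ + ∫₀ᵗ A y(s) ds + f(t)` for `t ∈ [0,T]`. -/
def IsSolution {T : ℝ} {d : ℕ} (A : Matrix (Fin d) (Fin d) ℝ) (y₀ : EuclideanSpace ℝ (Fin d))
    (f y : PathSpace T d) : Prop :=
  ∀ t : Set.Icc (0 : ℝ) T,
    y t = y₀ + (∫ s in Set.Iic t, Matrix.toEuclideanLin A (y s) ∂timeMeasure T) + f t

end

noncomputable section

/-! ### The linear equation and its solution operators -/

/-! Let V be the Volterra operator f ↦ ∫₀ᵗ A f(s) ds on paths. The equation reads (1 − V) y = y₀ +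
f, and the norms of the powers of V decay factorially, so 1 − V is invertible. The solution map is
therefore f ↦ S(y₀ + f) with the bounded operator S = (1 − V)⁻¹ (`solC`), which settles existence,
uniqueness and Lipschitz continuity. Since V factors as 𝔢 ∘ A ∘ J, with J the inclusion of paths
into L², S has companions on H_T (`solH`) and on L² (`solL2`), intertwined with S by 𝔢 and J. If D
is the Lipschitz version of ∇⁽²⁾F, then D(Sx), precomposed in both slots with the companion on L²,
is the version for F ∘ S, with Lipschitz constant ‖S‖ ‖`solL2`‖² c.

The real work is to show that F ∘ S lies in 𝔻_{2,2}, with gradients S_H*∇F(Sx) and (S_H* ⊗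
S_H*)∇⁽²⁾F(Sx). There are two obstacles. First, F and its gradients are classes modulo null sets, so
the law of Sx must be absolutely continuous with respect to μ. This is
`quasiMeasurePreserving_solC`: a discrete Girsanov formula holds for Euler schemes, their densities
are uniformly integrable on balls, and the schemes converge to Sx path by path. Second, absolute
continuity alone does not transport L² convergence, as the density of the law of Sx need not be
bounded. Here the Υ condition helps: a Lipschitz second gradient has linear growth in the sup norm,
so ∇F has quadratic growth about its mean, and F minus the Wiener integral of that mean has cubic
growth; the sup norm has all moments under μ. Growth bounds for the form on L² control the norm in
H_T ⊗ H_T because the inclusion of H_T in L² is Hilbert–Schmidt (`norm_cmTensor_le`).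

These growth statements are proved for finite-dimensional regularisations. `Frame.avg` averages F
over the Mehler rotation a y + b x of the coordinates in a finite orthonormal frame, a² + b² = 1, b
≠ 0. For fixed coordinates of y the rotated path has a law with bounded density, so averaging turns
L² convergence into locally uniform convergence, and the average of a Sobolev function is a
classical C² function (`Frame.contDiff_avg`). Along finer and finer grids the averages converge back
in L² (`IsWienerMeasure.tendsto_gridAvg`), with growth bounds uniform in the grid
(`IsWienerMeasure.exists_uniform_bounds`). The coordinates of Sx are again Gaussian functionals, so
the averages composed with S are in 𝔻_{2,2} with explicit gradients (`hasGross_avg_comp_solC`).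
Dominated convergence (`tendsto_eLpNorm_comp`) and closedness of the gradients then give
`HasGrossSobolevGradients.comp_solC`. The linear part of F is not dominated by the sup norm, but it
consists of continuous functionals composed with S, which converge in L² by the Wiener isometry. -/

lemma setIntegral_Iic_timeMeasure {E : Type*} [NormedAddCommGroup E] [NormedSpace ℝ E] {T : ℝ}
    (t : Set.Icc (0 : ℝ) T) (φ : ℝ → E) :
    ∫ s in Set.Iic t, φ (s : ℝ) ∂timeMeasure T = ∫ s in (0 : ℝ)..t, φ s := by
  rw [intervalIntegral.integral_of_le t.2.1, ← integral_Icc_eq_integral_Ioc,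
    ← integral_indicator measurableSet_Iic, ← integral_indicator measurableSet_Icc]
  have h1 : (Set.Iic t).indicator (fun s : Set.Icc (0 : ℝ) T => φ (s : ℝ)) =
      fun s : Set.Icc (0 : ℝ) T => (Set.Icc (0 : ℝ) t).indicator φ (s : ℝ) := by
    ext s
    by_cases hs : s ≤ t
    · rw [Set.indicator_of_mem (Set.mem_Iic.2 hs), Set.indicator_of_mem]
      exact ⟨s.2.1, hs⟩
    · rw [Set.indicator_of_notMem (by simpa using hs), Set.indicator_of_notMem]
      exact fun h => hs h.2
  rw [h1, timeMeasure, integral_subtype_comap measurableSet_Icc,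
    ← integral_indicator measurableSet_Icc, Set.indicator_indicator]
  rw [Set.inter_eq_right.2 (Set.Icc_subset_Icc_right t.2.2)]

variable {T : ℝ} {d : ℕ}

/-- The matrix `A` as a bounded operator on `ℝ^d`. -/
def matrixCLM (A : Matrix (Fin d) (Fin d) ℝ) :
    EuclideanSpace ℝ (Fin d) →L[ℝ] EuclideanSpace ℝ (Fin d) :=
  LinearMap.toContinuousLinearMap (Matrix.toEuclideanLin A)

lemma matrixCLM_apply (A : Matrix (Fin d) (Fin d) ℝ) (v : EuclideanSpace ℝ (Fin d)) :
    matrixCLM A v = Matrix.toEuclideanLin A v := rfl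

lemma matrixCLM_smul (r : ℝ) (A : Matrix (Fin d) (Fin d) ℝ) :
    matrixCLM (r • A) = r • matrixCLM A := by
  ext1 v; simp [matrixCLM_apply]

/-- The matrix `A` acting pointwise on `L²`. -/
def matrixL2 (T : ℝ) (A : Matrix (Fin d) (Fin d) ℝ) : L2Path T d →L[ℝ] L2Path T d :=
  (matrixCLM A).compLpL 2 (timeMeasure T)

/-- Continuous paths as elements of `L²`. -/
def pathToL2 (T : ℝ) (d : ℕ) : PathSpace T d →L[ℝ] L2Path T d :=
  ContinuousMap.toLp 2 (timeMeasure T) ℝ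

lemma cmToL2_eq (h : CMSpace T d) : cmToL2 T d h = pathToL2 T d (cmEmbed T d h) := rfl

lemma cmEmbed_apply (h : CMSpace T d) (t : Set.Icc (0 : ℝ) T) :
    cmEmbed T d h t = ∫ s in Set.Iic t, h s ∂timeMeasure T := rfl

/-- The Volterra operator `f ↦ ∫₀ᵗ A f(s) ds` on path space. -/
def volterra (T : ℝ) (A : Matrix (Fin d) (Fin d) ℝ) : PathSpace T d →L[ℝ] PathSpace T d :=
  cmEmbed T d ∘L matrixL2 T A ∘L pathToL2 T d

lemma volterra_apply (A : Matrix (Fin d) (Fin d) ℝ) (f : PathSpace T d) (t : Set.Icc (0 : ℝ) T) :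
    volterra T A f t = ∫ s in Set.Iic t, matrixCLM A (f s) ∂timeMeasure T := by
  refine integral_congr_ae (ae_restrict_of_ae ?_)
  have h1 := (matrixCLM A).coeFn_compLpL (p := 2) (μ := timeMeasure T) (pathToL2 T d f)
  have h2 := ContinuousMap.coeFn_toLp (p := 2) (𝕜 := ℝ) (timeMeasure T) f
  filter_upwards [h1, h2] with s hs1 hs2
  exact hs1.trans (congrArg _ hs2)

/-- Each further application of V integrates the bound (as)ⁿ/n! from 0 to t, which produces the next
term of the exponential series. -/
lemma norm_volterra_pow_apply_le (A : Matrix (Fin d) (Fin d) ℝ) (n : ℕ) (f : PathSpace T d)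
    (t : Set.Icc (0 : ℝ) T) :
    ‖(volterra T A ^ n) f t‖ ≤ (‖matrixCLM A‖ * t) ^ n / n.factorial * ‖f‖ := by
  induction n generalizing t with
  | zero => simpa using f.norm_coe_le_norm t
  | succ n ih =>
    rw [pow_succ', mul_apply_eq_comp, volterra_apply]
    set a := ‖matrixCLM A‖
    have h1 : ‖∫ s in Set.Iic t, matrixCLM A ((volterra T A ^ n) f s) ∂timeMeasure T‖ ≤
        ∫ s in Set.Iic t, a * ((a * (s : ℝ)) ^ n / n.factorial * ‖f‖) ∂timeMeasure T := by
      refine norm_integral_le_of_norm_le ?_ (Eventually.of_forall fun s => ?_)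
      · exact (by fun_prop : Continuous _).continuousOn.integrableOn_compact
          isClosed_Iic.isCompact
      · exact ((matrixCLM A).le_opNorm _).trans (by gcongr; exact ih s)
    refine h1.trans_eq ?_
    rw [setIntegral_Iic_timeMeasure t (fun s => a * ((a * s) ^ n / n.factorial * ‖f‖))]
    simp_rw [mul_pow]
    rw [show (fun s : ℝ => a * (a ^ n * s ^ n / n.factorial * ‖f‖)) =
      fun s => (a ^ (n + 1) / n.factorial * ‖f‖) * s ^ n by ext s; ring,
      intervalIntegral.integral_const_mul, integral_pow, Nat.factorial_succ]
    push_cast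
    have : (n : ℝ) + 1 ≠ 0 := by positivity
    have : (n.factorial : ℝ) ≠ 0 := by positivity
    field_simp
    simp

/-- V itself may have large norm, but some power Vⁿ has norm below 1. Then 1 − Vⁿ is a unit, and it
is the product of the commuting factors 1 − V and ∑ Vⁱ, so 1 − V is a unit as well. -/
lemma isUnit_one_sub_volterra (T : ℝ) (A : Matrix (Fin d) (Fin d) ℝ) :
    IsUnit (1 - volterra T A) := by
  obtain ⟨n, hn⟩ := ((FloorSemiring.tendsto_pow_div_factorial_atTop
    (‖matrixCLM A‖ * |T|)).eventually (gt_mem_nhds (zero_lt_one' ℝ))).exists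
  have h1 : ‖volterra T A ^ n‖ < 1 := by
    refine (ContinuousLinearMap.opNorm_le_bound _ (by positivity) fun f => ?_).trans_lt hn
    refine (ContinuousMap.norm_le _ (by positivity)).2 fun t => ?_
    refine (norm_volterra_pow_apply_le A n f t).trans ?_
    have h0 := t.2.1
    have h2 : (t : ℝ) ≤ |T| := t.2.2.trans (le_abs_self T)
    gcongr
  have h2 := isUnit_one_sub_of_norm_lt_one
    (R := PathSpace T d →L[ℝ] PathSpace T d) h1
  have h3 := mul_neg_geom_sum (volterra T A) n
  have h4 := geom_sum_mul_neg (volterra T A) n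
  rw [← h3] at h2
  have hc : Commute (1 - volterra T A) (∑ i ∈ Finset.range n, volterra T A ^ i) := h3.trans h4.symm
  exact (hc.isUnit_mul_iff.1 h2).1

/-- The solution operator on path space. -/
def solC (T : ℝ) (A : Matrix (Fin d) (Fin d) ℝ) : PathSpace T d →L[ℝ] PathSpace T d :=
  ((isUnit_one_sub_volterra T A).unit⁻¹ : (PathSpace T d →L[ℝ] PathSpace T d)ˣ)

lemma solC_sub_volterra (A : Matrix (Fin d) (Fin d) ℝ) (f : PathSpace T d) :
    solC T A f - volterra T A (solC T A f) = f := by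
  have h : (1 - volterra T A) * solC T A = 1 := (isUnit_one_sub_volterra T A).mul_val_inv
  exact DFunLike.congr_fun h f

lemma solC_of_sub_volterra (A : Matrix (Fin d) (Fin d) ℝ) (f : PathSpace T d) :
    solC T A (f - volterra T A f) = f := by
  have h : solC T A * (1 - volterra T A) = 1 := (isUnit_one_sub_volterra T A).val_inv_mul
  exact DFunLike.congr_fun h f

/-- The solution operator on the Cameron--Martin space. -/
def solH (T : ℝ) (A : Matrix (Fin d) (Fin d) ℝ) : CMSpace T d →L[ℝ] CMSpace T d :=
  ContinuousLinearMap.id ℝ _ + matrixL2 T A ∘L pathToL2 T d ∘L solC T A ∘L cmEmbed T d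

/-- The solution operator on `L²`. -/
def solL2 (T : ℝ) (A : Matrix (Fin d) (Fin d) ℝ) : L2Path T d →L[ℝ] L2Path T d :=
  ContinuousLinearMap.id ℝ _ + pathToL2 T d ∘L solC T A ∘L cmEmbed T d ∘L matrixL2 T A

/-- This is the identity S = 1 + V S restricted to the range of 𝔢, with the leftmost 𝔢 of V = 𝔢 A J
pulled out. So S maps Cameron–Martin directions to Cameron–Martin directions. -/
lemma cmEmbed_solH (A : Matrix (Fin d) (Fin d) ℝ) (h : CMSpace T d) :
    cmEmbed T d (solH T A h) = solC T A (cmEmbed T d h) := by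
  have h1 := solC_sub_volterra A (cmEmbed T d h)
  have h2 : cmEmbed T d (solH T A h) =
      cmEmbed T d h + volterra T A (solC T A (cmEmbed T d h)) := by
    simp [solH, volterra]
  rw [h2]
  nth_rw 1 [← h1]
  abel

/-- This is the other resolvent identity, S = 1 + S V, with the rightmost J of V = 𝔢 A J pulled out.
It extends S boundedly from paths to L², where the second gradient acts as a bilinear form. -/
lemma solL2_pathToL2 (A : Matrix (Fin d) (Fin d) ℝ) (f : PathSpace T d) :
    solL2 T A (pathToL2 T d f) = pathToL2 T d (solC T A f) := by
  have h1 := solC_of_sub_volterra A f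
  rw [map_sub, sub_eq_iff_eq_add] at h1
  rw [h1, map_add]
  rfl

lemma cmToL2_solH (A : Matrix (Fin d) (Fin d) ℝ) (h : CMSpace T d) :
    cmToL2 T d (solH T A h) = solL2 T A (cmToL2 T d h) := by
  rw [cmToL2_eq, cmToL2_eq, solL2_pathToL2, cmEmbed_solH]

lemma isSolution_iff (A : Matrix (Fin d) (Fin d) ℝ) (y₀ : EuclideanSpace ℝ (Fin d))
    (f y : PathSpace T d) :
    IsSolution A y₀ f y ↔ y = solC T A (ContinuousMap.const _ y₀ + f) := by
  have h : IsSolution A y₀ f y ↔ y - volterra T A y = ContinuousMap.const _ y₀ + f := by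
    rw [ContinuousMap.ext_iff]
    refine forall_congr' fun t => ?_
    simp only [ContinuousMap.sub_apply, ContinuousMap.add_apply, ContinuousMap.const_apply,
      volterra_apply, matrixCLM_apply]
    rw [sub_eq_iff_eq_add]
    constructor <;> intro h <;> rw [h] <;> abel
  rw [h]
  constructor
  · intro h
    rw [← h, solC_of_sub_volterra]
  · intro h
    rw [h, solC_sub_volterra]

/-! ### The adjoint embedding, and its behaviour under composition with the solution operator. -/

lemma cmAdjoint_inner (η : PathSpace T d →L[ℝ] ℝ) (h : CMSpace T d) :
    ⟪cmAdjoint T d η, h⟫_ℝ = η (cmEmbed T d h) := by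
  rw [cmAdjoint, InnerProductSpace.toDual_symm_apply]; rfl

/-- The dual form of the intertwining of S and `solH` by 𝔢. It is the source of the adjoint of
`solH` in the chain rule: a continuous functional of Sx is the Wiener integral of a vector
transformed by this adjoint. -/
lemma cmAdjoint_comp_solC (A : Matrix (Fin d) (Fin d) ℝ) (η : PathSpace T d →L[ℝ] ℝ) :
    cmAdjoint T d (η ∘L solC T A) = (solH T A).adjoint (cmAdjoint T d η) := by
  refine ext_inner_right ℝ fun h => ?_
  rw [ContinuousLinearMap.adjoint_inner_left, cmAdjoint_inner, cmAdjoint_inner, cmEmbed_solH]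
  rfl

/-- `𝔢*` as a linear map. -/
lemma cmAdjoint_add (η η' : PathSpace T d →L[ℝ] ℝ) :
    cmAdjoint T d (η + η') = cmAdjoint T d η + cmAdjoint T d η' := by
  refine ext_inner_right ℝ fun h => ?_
  simp [inner_add_left, cmAdjoint_inner]

lemma cmAdjoint_smul (r : ℝ) (η : PathSpace T d →L[ℝ] ℝ) :
    cmAdjoint T d (r • η) = r • cmAdjoint T d η := by
  refine ext_inner_right ℝ fun h => ?_
  rw [real_inner_smul_left]
  simp [cmAdjoint_inner]

lemma cmAdjoint_sub (η η' : PathSpace T d →L[ℝ] ℝ) :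
    cmAdjoint T d (η - η') = cmAdjoint T d η - cmAdjoint T d η' := by
  refine ext_inner_right ℝ fun h => ?_
  simp [inner_sub_left, cmAdjoint_inner]

end

noncomputable section

/-! ### The standard Gaussian measure on `ℝ^N` -/

/-- The standard Gaussian measure on `ℝ^N`. -/
def stdGauss (N : ℕ) : Measure (Fin N → ℝ) := Measure.pi fun _ => gaussianReal 0 1

instance stdGauss.instIsProbabilityMeasure (N : ℕ) : IsProbabilityMeasure (stdGauss N) := by
  unfold stdGauss; infer_instance

/-- The density of the standard Gaussian measure. -/
def stdGaussPDF {N : ℕ} (w : Fin N → ℝ) : ℝ := ∏ i, gaussianPDFReal 0 1 (w i)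

lemma stdGaussPDF_nonneg {N : ℕ} (w : Fin N → ℝ) : 0 ≤ stdGaussPDF w :=
  Finset.prod_nonneg fun _ _ => gaussianPDFReal_nonneg _ _ _

lemma measurable_stdGaussPDF {N : ℕ} : Measurable (stdGaussPDF (N := N)) :=
  Finset.measurable_prod _ fun i _ =>
    (measurable_gaussianPDFReal 0 1).comp (measurable_pi_apply i)

lemma stdGauss_eq_withDensity (N : ℕ) :
    stdGauss N = volume.withDensity fun w => ENNReal.ofReal (stdGaussPDF w) := by
  rw [stdGauss]
  refine Measure.pi_eq fun s hs => ?_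
  rw [withDensity_apply _ (MeasurableSet.univ_pi hs),
    ← lintegral_indicator (MeasurableSet.univ_pi hs)]
  have hint : ∀ i, Integrable ((s i).indicator (gaussianPDFReal 0 1)) volume := fun i =>
    (integrable_gaussianPDFReal 0 1).indicator (hs i)
  have h1 : ((Set.univ.pi s).indicator fun w : Fin N → ℝ => ENNReal.ofReal (stdGaussPDF w)) =
      fun w => ENNReal.ofReal (∏ i, (s i).indicator (gaussianPDFReal 0 1) (w i)) := by
    ext w
    by_cases hw : w ∈ Set.univ.pi s
    · rw [Set.indicator_of_mem hw, stdGaussPDF]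
      congr 1
      exact Finset.prod_congr rfl fun i _ => (Set.indicator_of_mem (hw i trivial) _).symm
    · rw [Set.indicator_of_notMem hw]
      obtain ⟨i, hi⟩ : ∃ i, w i ∉ s i := by simpa [Set.mem_pi] using hw
      rw [Finset.prod_eq_zero (Finset.mem_univ i) (Set.indicator_of_notMem hi _),
        ENNReal.ofReal_zero]
  have hnn : ∀ i x, 0 ≤ (s i).indicator (gaussianPDFReal 0 1) x := fun i x =>
    Set.indicator_nonneg (fun _ _ => gaussianPDFReal_nonneg _ _ _) x
  rw [h1, ← ofReal_integral_eq_lintegral_ofReal, integral_fintype_prod_volume_eq_prod,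
    ENNReal.ofReal_prod_of_nonneg fun i _ => integral_nonneg (hnn i)]
  · refine Finset.prod_congr rfl fun i _ => ?_
    rw [integral_indicator (hs i), gaussianReal_apply_eq_integral 0 one_ne_zero]
  · exact Integrable.fintype_prod_dep hint
  · exact Eventually.of_forall fun w => Finset.prod_nonneg fun i _ => hnn i _

lemma lintegral_stdGauss {N : ℕ} {H : (Fin N → ℝ) → ℝ≥0∞} (hH : Measurable H) :
    ∫⁻ w, H w ∂stdGauss N = ∫⁻ w, ENNReal.ofReal (stdGaussPDF w) * H w := by
  rw [stdGauss_eq_withDensity,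
    lintegral_withDensity_eq_lintegral_mul _ measurable_stdGaussPDF.ennreal_ofReal hH]
  rfl

/-- The Gaussian shift formula. -/
lemma lintegral_stdGauss_shift {N : ℕ} {H : (Fin N → ℝ) → ℝ≥0∞} (hH : Measurable H)
    (m : Fin N → ℝ) :
    ∫⁻ w, H w * ENNReal.ofReal (Real.exp (∑ i, m i * w i - (∑ i, m i ^ 2) / 2)) ∂stdGauss N =
      ∫⁻ w, H (w + m) ∂stdGauss N := by
  rw [lintegral_stdGauss (by fun_prop), lintegral_stdGauss (by fun_prop),
    ← lintegral_add_right_eq_self _ m]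
  refine lintegral_congr fun w => ?_
  rw [mul_left_comm, mul_comm, ← ENNReal.ofReal_mul (stdGaussPDF_nonneg _)]
  congr 2
  rw [Finset.sum_div, ← Finset.sum_sub_distrib, Real.exp_sum, stdGaussPDF, stdGaussPDF,
    ← Finset.prod_mul_distrib]
  refine Finset.prod_congr rfl fun i _ => ?_
  simp only [gaussianPDFReal, Pi.add_apply, mul_assoc, ← Real.exp_add]
  congr 2
  simp
  ring

/-- A rescaled and shifted standard Gaussian is dominated by a multiple of the standard Gaussian. -/
lemma lintegral_stdGauss_affine_le {N : ℕ} {H : (Fin N → ℝ) → ℝ≥0∞} (hH : Measurable H)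
    {a b : ℝ} (hb : b ≠ 0) (hab : a ^ 2 + b ^ 2 = 1) (v : Fin N → ℝ) :
    ∫⁻ w, H (a • v + b • w) ∂stdGauss N ≤
      ENNReal.ofReal (|(b ^ N)⁻¹| * Real.exp ((∑ i, v i ^ 2) / 2)) * ∫⁻ w, H w ∂stdGauss N := by
  rw [lintegral_stdGauss (by fun_prop), lintegral_stdGauss hH]
  set Q : (Fin N → ℝ) → ℝ≥0∞ := fun w => ENNReal.ofReal (stdGaussPDF w) * H w with hQ
  have hQm : Measurable Q := measurable_stdGaussPDF.ennreal_ofReal.mul hH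
  have h1 : ∀ w : Fin N → ℝ, ENNReal.ofReal (stdGaussPDF w) * H (a • v + b • w) ≤
      ENNReal.ofReal (Real.exp ((∑ i, v i ^ 2) / 2)) * Q (a • v + b • w) := by
    intro w
    rw [hQ, ← mul_assoc, ← ENNReal.ofReal_mul (Real.exp_pos _).le]
    gcongr
    rw [Finset.sum_div, Real.exp_sum, stdGaussPDF, stdGaussPDF, ← Finset.prod_mul_distrib]
    refine Finset.prod_le_prod (fun i _ => gaussianPDFReal_nonneg _ _ _) fun i _ => ?_
    simp only [gaussianPDFReal, Pi.add_apply, Pi.smul_apply, smul_eq_mul]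
    rw [mul_left_comm, ← Real.exp_add]
    gcongr
    simp only [sub_zero, NNReal.coe_one, mul_one]
    -- Because a² + b² = 1, v² + w² − (av + bw)² = (aw − bv)² ≥ 0; hence e^{−w²/2} ≤ e^{v²/2}
    -- e^{−(av+bw)²/2}.
    nlinarith [sq_nonneg (a * w i - b * v i), hab, sq_nonneg (w i), sq_nonneg (v i)]
  refine (lintegral_mono h1).trans_eq ?_
  rw [lintegral_const_mul _ (by fun_prop)]
  -- The factor |b^N|⁻¹ is the Jacobian of w ↦ bw; the shift by av leaves Lebesgue measure
  -- invariant.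
  have h2 : ∫⁻ w, Q (a • v + b • w) = ENNReal.ofReal |(b ^ N)⁻¹| * ∫⁻ w, Q w := by
    have h3 := Measure.map_addHaar_smul (volume : Measure (Fin N → ℝ)) hb
    have hQm' : Measurable fun u => Q (a • v + u) := by fun_prop
    have h4 : ∫⁻ w : Fin N → ℝ, Q (a • v + b • w) =
        ∫⁻ u, Q (a • v + u) ∂(Measure.map (b • ·) (volume : Measure (Fin N → ℝ))) :=
      (lintegral_map hQm' (measurable_const_smul b)).symm
    rw [h4, h3, lintegral_smul_measure, lintegral_add_left_eq_self]
    simp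
  rw [h2, ← mul_assoc, ← ENNReal.ofReal_mul (Real.exp_pos _).le, mul_comm (Real.exp _)]

lemma charFunDual_stdGauss {N : ℕ} (L : StrongDual ℝ (Fin N → ℝ)) :
    charFunDual (stdGauss N) L = Complex.exp (-(∑ i, (L (Pi.single i 1)) ^ 2 : ℝ) / 2) := by
  rw [stdGauss, charFunDual_pi]
  have h : ∀ i, charFunDual (gaussianReal 0 1) (L.comp (ContinuousLinearMap.single ℝ (fun _ => ℝ) i))
      = Complex.exp (-((L (Pi.single i 1)) ^ 2 : ℝ) / 2) := by
    intro i
    have h1 := charFun_gaussianReal (μ := 0) (v := 1) (L (Pi.single i 1))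
    rw [charFun_apply_real] at h1
    rw [charFunDual_apply]
    convert h1 using 1
    · refine integral_congr_ae (Eventually.of_forall fun x => ?_)
      have h2 : (Pi.single i x : Fin N → ℝ) = x • Pi.single i 1 := by
        rw [← Pi.single_smul]; simp
      simp [h2]
      ring_nf
    · congr 1
      simp
      ring
  rw [Finset.prod_congr rfl fun i _ => h i, ← Complex.exp_sum]
  congr 1
  push_cast
  rw [neg_div, Finset.sum_div, ← Finset.sum_neg_distrib]
  simp [neg_div]

end

noncomputable section

/-! ### Finite orthonormal frames of the Cameron--Martin space -/

/-- A finite orthonormal family in the Cameron--Martin space, given by functionals on path space. -/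
structure Frame (T : ℝ) (d N : ℕ) where
  e : Fin N → CMSpace T d
  η : Fin N → PathSpace T d →L[ℝ] ℝ
  orthonormal : Orthonormal ℝ e
  adjoint : ∀ l, cmAdjoint T d (η l) = e l

namespace Frame

variable {T : ℝ} {d N : ℕ} (B : Frame T d N)

/-- The coordinates of a path. -/
def coord : PathSpace T d →L[ℝ] (Fin N → ℝ) := ContinuousLinearMap.pi B.η

/-- The element of the Cameron--Martin space with given coordinates. -/
def lift : (Fin N → ℝ) →L[ℝ] CMSpace T d :=
  ∑ l, (ContinuousLinearMap.proj (R := ℝ) (φ := fun _ : Fin N => ℝ) l).smulRight (B.e l)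

/-- The path with given coordinates. -/
def path : (Fin N → ℝ) →L[ℝ] PathSpace T d := cmEmbed T d ∘L B.lift

/-- The projection of a path. -/
def proj : PathSpace T d →L[ℝ] PathSpace T d := B.path ∘L B.coord

/-- The orthogonal projection in the Cameron--Martin space. -/
def projH : CMSpace T d →L[ℝ] CMSpace T d := B.lift ∘L B.coord ∘L cmEmbed T d

lemma coord_apply (x : PathSpace T d) (l : Fin N) : B.coord x l = B.η l x := rfl

lemma lift_apply (v : Fin N → ℝ) : B.lift v = ∑ l, v l • B.e l := by simp [lift]

lemma path_apply (v : Fin N → ℝ) : B.path v = cmEmbed T d (B.lift v) := rfl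

lemma proj_apply (x : PathSpace T d) : B.proj x = B.path (B.coord x) := rfl

lemma coord_cmEmbed (h : CMSpace T d) (l : Fin N) : B.coord (cmEmbed T d h) l = ⟪B.e l, h⟫_ℝ := by
  rw [coord_apply, ← cmAdjoint_inner, B.adjoint]

lemma inner_lift (h : CMSpace T d) (v : Fin N → ℝ) :
    ⟪h, B.lift v⟫_ℝ = ∑ l, v l * ⟪h, B.e l⟫_ℝ := by
  simp [lift_apply, inner_sum, real_inner_smul_right]

@[simp] lemma coord_path (v : Fin N → ℝ) : B.coord (B.path v) = v := by
  ext l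
  rw [path_apply, coord_cmEmbed, lift_apply]
  exact B.orthonormal.inner_right_fintype v l

lemma norm_lift_sq (v : Fin N → ℝ) : ‖B.lift v‖ ^ 2 = ∑ l, v l ^ 2 := by
  rw [← real_inner_self_eq_norm_sq, inner_lift]
  refine Finset.sum_congr rfl fun l _ => ?_
  rw [real_inner_comm, ← coord_cmEmbed, ← path_apply, coord_path, sq]

@[simp] lemma proj_path (v : Fin N → ℝ) : B.proj (B.path v) = B.path v := by
  rw [proj_apply, coord_path]

@[simp] lemma coord_proj (x : PathSpace T d) : B.coord (B.proj x) = B.coord x := by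
  rw [proj_apply, coord_path]

lemma projH_apply (h : CMSpace T d) : B.projH h = ∑ l, ⟪B.e l, h⟫_ℝ • B.e l := by
  change B.lift (B.coord (cmEmbed T d h)) = _
  rw [lift_apply]
  simp [coord_cmEmbed]

lemma inner_projH (h k : CMSpace T d) : ⟪B.projH h, k⟫_ℝ = ⟪h, B.projH k⟫_ℝ := by
  rw [projH_apply, projH_apply, sum_inner, inner_sum]
  refine Finset.sum_congr rfl fun l _ => ?_
  rw [real_inner_smul_left, real_inner_smul_right, real_inner_comm h, mul_comm]

@[simp] lemma projH_lift (v : Fin N → ℝ) : B.projH (B.lift v) = B.lift v := by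
  change B.lift (B.coord (B.path v)) = _
  rw [coord_path]

@[simp] lemma projH_projH (h : CMSpace T d) : B.projH (B.projH h) = B.projH h :=
  B.projH_lift _

lemma inner_projH_self (h : CMSpace T d) : ⟪B.projH h, h⟫_ℝ = ‖B.projH h‖ ^ 2 := by
  rw [← real_inner_self_eq_norm_sq, inner_projH, inner_projH, projH_projH]

lemma norm_projH_le (h : CMSpace T d) : ‖B.projH h‖ ≤ ‖h‖ := by
  have h1 := B.inner_projH_self h
  have h2 := real_inner_le_norm (B.projH h) h
  rw [h1, sq] at h2
  by_contra! hc
  have : 0 < ‖B.projH h‖ := (norm_nonneg _).trans_lt hc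
  nlinarith

lemma cmAdjoint_comp_proj (η : PathSpace T d →L[ℝ] ℝ) :
    cmAdjoint T d (η ∘L B.proj) = B.projH (cmAdjoint T d η) := by
  refine ext_inner_right ℝ fun h => ?_
  rw [cmAdjoint_inner, inner_projH, cmAdjoint_inner]
  rfl

/-- `x ↦ ⟨h, π x⟩`, a version of the Wiener integral of the projection of `h`. -/
def pairing (h : CMSpace T d) : PathSpace T d →L[ℝ] ℝ := innerSL ℝ h ∘L B.lift ∘L B.coord

lemma cmAdjoint_pairing (h : CMSpace T d) : cmAdjoint T d (B.pairing h) = B.projH h := by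
  refine ext_inner_right ℝ fun k => ?_
  rw [cmAdjoint_inner, inner_projH]
  rfl

end Frame

/-! ### The frames of increments over intervals -/

variable {T : ℝ} {d : ℕ}

lemma timeMeasure_real_Ioc {s t : Set.Icc (0 : ℝ) T} (h : s ≤ t) :
    (timeMeasure T).real (Set.Ioc s t) = t - s := by
  rw [measureReal_def, timeMeasure, comap_subtype_coe_apply measurableSet_Icc]
  have : (Subtype.val '' Set.Ioc s t : Set ℝ) = Set.Ioc (s : ℝ) t := by
    ext u
    constructor
    · rintro ⟨u, hu, rfl⟩
      exact hu
    · exact fun hu => ⟨⟨u, s.2.1.trans hu.1.le, hu.2.trans t.2.2⟩, hu, rfl⟩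
  rw [this, Real.volume_Ioc, ENNReal.toReal_ofReal (sub_nonneg.2 h)]

/-- The element of `L²` with density `1_{(s,t]}` in the `j`-th coordinate. -/
def rampH (s t : Set.Icc (0 : ℝ) T) (j : Fin d) : CMSpace T d :=
  indicatorConstLp 2 (measurableSet_Ioc (a := s) (b := t)) (measure_ne_top (timeMeasure T) _)
    (EuclideanSpace.single j 1)

/-- The `j`-th coordinate of the increment over `(s,t]`. -/
def incrFun (s t : Set.Icc (0 : ℝ) T) (j : Fin d) : PathSpace T d →L[ℝ] ℝ :=
  EuclideanSpace.proj j ∘L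
    (ContinuousMap.evalCLM ℝ t - ContinuousMap.evalCLM ℝ s)

lemma incrFun_apply (s t : Set.Icc (0 : ℝ) T) (j : Fin d) (x : PathSpace T d) :
    incrFun s t j x = x t j - x s j := rfl

lemma cmEmbed_sub {s t : Set.Icc (0 : ℝ) T} (hst : s ≤ t) (h : CMSpace T d) :
    cmEmbed T d h t - cmEmbed T d h s = ∫ u in Set.Ioc s t, h u ∂timeMeasure T := by
  have hd : Set.Ioc s t = Set.Iic t \ Set.Iic s := by
    ext u
    simp [and_comm]
  rw [cmEmbed_apply, cmEmbed_apply, hd,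
    setIntegral_sdiff measurableSet_Iic h.integrable.integrableOn (Set.Iic_subset_Iic.2 hst)]

lemma cmAdjoint_incrFun {s t : Set.Icc (0 : ℝ) T} (hst : s ≤ t) (j : Fin d) :
    cmAdjoint T d (incrFun s t j) = rampH s t j := by
  refine ext_inner_right ℝ fun h => ?_
  rw [cmAdjoint_inner, incrFun_apply, rampH, L2.inner_indicatorConstLp_eq_inner_setIntegral,
    ← cmEmbed_sub hst]
  simp [EuclideanSpace.inner_single_left]

lemma inner_rampH (s t s' t' : Set.Icc (0 : ℝ) T) (j j' : Fin d) :
    ⟪rampH s t j, rampH s' t' j'⟫_ℝ =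
      if j = j' then (timeMeasure T).real (Set.Ioc s t ∩ Set.Ioc s' t') else 0 := by
  rw [rampH, rampH, L2.inner_indicatorConstLp_indicatorConstLp,
    EuclideanSpace.inner_single_left]
  split_ifs with h <;> simp [h]

lemma cmEmbed_rampH (s t : Set.Icc (0 : ℝ) T) (j : Fin d) (u : Set.Icc (0 : ℝ) T) :
    cmEmbed T d (rampH s t j) u =
      (timeMeasure T).real (Set.Ioc s t ∩ Set.Iic u) • EuclideanSpace.single j (1 : ℝ) := by
  rw [cmEmbed_apply, rampH, setIntegral_indicatorConstLp measurableSet_Iic]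

/-- The frame of the increments over one interval. -/
def intervalFrame (s t : Set.Icc (0 : ℝ) T) (hst : s < t) : Frame T d d where
  e j := (√((t : ℝ) - s))⁻¹ • rampH s t j
  η j := (√((t : ℝ) - s))⁻¹ • incrFun s t j
  orthonormal := by
    have h0 : 0 < (t : ℝ) - s := sub_pos.2 hst
    rw [orthonormal_iff_ite]
    intro j j'
    rw [real_inner_smul_left, real_inner_smul_right, inner_rampH, Set.inter_self,
      timeMeasure_real_Ioc hst.le]
    split_ifs
    · rw [← mul_assoc, ← mul_inv, Real.mul_self_sqrt h0.le, inv_mul_cancel₀ h0.ne']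
    · simp
  adjoint j := by rw [cmAdjoint_smul, cmAdjoint_incrFun hst.le]

/-- The points of the uniform grid. -/
def gridPt (T : ℝ) (hT : 0 < T) (n i : ℕ) : Set.Icc (0 : ℝ) T :=
  Set.projIcc 0 T hT.le (i * T / n)

lemma gridPt_mono (hT : 0 < T) (n : ℕ) : Monotone (gridPt T hT n) := by
  intro i j hij
  refine Set.monotone_projIcc _ ?_
  gcongr

lemma coe_gridPt (hT : 0 < T) {n i : ℕ} (hn : 0 < n) (hi : i ≤ n) :
    (gridPt T hT n i : ℝ) = i * T / n := by
  have hn' : (0 : ℝ) < n := by exact_mod_cast hn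
  rw [gridPt, Set.projIcc_of_mem]
  refine ⟨by positivity, ?_⟩
  rw [div_le_iff₀ hn', mul_comm]
  gcongr

lemma gridPt_zero (hT : 0 < T) (n : ℕ) : (gridPt T hT n 0 : ℝ) = 0 := by
  simp [gridPt, Set.projIcc]

lemma gridPt_sub (hT : 0 < T) {n i : ℕ} (hi : i < n) :
    (gridPt T hT n (i + 1) : ℝ) - gridPt T hT n i = T / n := by
  rw [coe_gridPt hT (by omega) hi, coe_gridPt hT (by omega) hi.le]
  push_cast
  ring

lemma gridPt_lt (hT : 0 < T) {n i : ℕ} (hi : i < n) : gridPt T hT n i < gridPt T hT n (i + 1) := by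
  have h := gridPt_sub hT hi
  have hn' : (0 : ℝ) < n := by exact_mod_cast (by omega : 0 < n)
  have : 0 < T / n := by positivity
  exact Subtype.coe_lt_coe.1 (by linarith)

lemma grid_disjoint (hT : 0 < T) (n : ℕ) {i j : ℕ} (hij : i ≠ j) :
    Set.Ioc (gridPt T hT n i) (gridPt T hT n (i + 1)) ∩
      Set.Ioc (gridPt T hT n j) (gridPt T hT n (j + 1)) = ∅ :=
  Set.disjoint_iff_inter_eq_empty.1 ((gridPt_mono hT n).pairwise_disjoint_on_Ioc_succ hij)

/-- The frame of all increments over the uniform grid. -/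
def gridFrame (d : ℕ) (hT : 0 < T) (n : ℕ) : Frame T d (n * d) where
  e l := (√(T / n))⁻¹ • rampH (gridPt T hT n (finProdFinEquiv.symm l).1)
    (gridPt T hT n ((finProdFinEquiv.symm l).1 + 1)) (finProdFinEquiv.symm l).2
  η l := (√(T / n))⁻¹ • incrFun (gridPt T hT n (finProdFinEquiv.symm l).1)
    (gridPt T hT n ((finProdFinEquiv.symm l).1 + 1)) (finProdFinEquiv.symm l).2
  orthonormal := by
    rw [orthonormal_iff_ite]
    intro l l'
    rw [real_inner_smul_left, real_inner_smul_right, inner_rampH]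
    obtain ⟨⟨i, j⟩, rfl⟩ := finProdFinEquiv.surjective l
    obtain ⟨⟨i', j'⟩, rfl⟩ := finProdFinEquiv.surjective l'
    simp only [Equiv.symm_apply_apply, EmbeddingLike.apply_eq_iff_eq, Prod.mk.injEq]
    have hn : (0 : ℝ) < n := by exact_mod_cast (Nat.zero_le _).trans_lt i.2
    have h0 : 0 < T / n := by positivity
    by_cases hi : i = i'
    · subst hi
      by_cases hj : j = j'
      · subst hj
        simp only [if_true, Set.inter_self, and_self]
        rw [timeMeasure_real_Ioc (gridPt_lt hT i.2).le, gridPt_sub hT i.2,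
          ← mul_assoc, ← mul_inv, Real.mul_self_sqrt h0.le, inv_mul_cancel₀ h0.ne']
      · simp [hj]
    · rw [grid_disjoint hT n fun h => hi (Fin.ext h)]
      simp [hi]
  adjoint l := by
    rw [cmAdjoint_smul, cmAdjoint_incrFun (gridPt_mono hT n (Nat.le_succ _))]

end

noncomputable section

/-! ### Convergence of the projections onto the grid frames -/

variable {T : ℝ} {d : ℕ}

/-- The time spent in the `i`-th grid interval up to time `u`. -/
def gridTime (hT : 0 < T) (n i : ℕ) (u : Set.Icc (0 : ℝ) T) : ℝ :=
  (timeMeasure T).real (Set.Ioc (gridPt T hT n i) (gridPt T hT n (i + 1)) ∩ Set.Iic u)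

lemma gridTime_nonneg (hT : 0 < T) (n i : ℕ) (u : Set.Icc (0 : ℝ) T) : 0 ≤ gridTime hT n i u :=
  measureReal_nonneg

lemma gridTime_le (hT : 0 < T) {n i : ℕ} (hi : i < n) (u : Set.Icc (0 : ℝ) T) :
    gridTime hT n i u ≤ T / n := by
  rw [← gridPt_sub hT hi, ← timeMeasure_real_Ioc (gridPt_lt hT hi).le]
  exact measureReal_mono Set.inter_subset_left

lemma gridTime_of_le (hT : 0 < T) {n i : ℕ} {u : Set.Icc (0 : ℝ) T} (hu : u ≤ gridPt T hT n i) :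
    gridTime hT n i u = 0 := by
  have : Set.Ioc (gridPt T hT n i) (gridPt T hT n (i + 1)) ∩ Set.Iic u = ∅ := by
    ext s
    simp only [Set.mem_inter_iff, Set.mem_Ioc, Set.mem_Iic, Set.mem_empty_iff_false, iff_false]
    exact fun h => absurd (h.2.trans hu) (not_le.2 h.1.1)
  rw [gridTime, this, measureReal_empty]

lemma gridTime_of_ge (hT : 0 < T) {n i : ℕ} (hi : i < n) {u : Set.Icc (0 : ℝ) T}
    (hu : gridPt T hT n (i + 1) ≤ u) : gridTime hT n i u = T / n := by
  have : Set.Ioc (gridPt T hT n i) (gridPt T hT n (i + 1)) ∩ Set.Iic u =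
      Set.Ioc (gridPt T hT n i) (gridPt T hT n (i + 1)) :=
    Set.inter_eq_left.2 fun s hs => hs.2.trans hu
  rw [gridTime, this, timeMeasure_real_Ioc (gridPt_lt hT hi).le, gridPt_sub hT hi]

lemma sum_gridFrame {M : Type*} [AddCommMonoid M] (n : ℕ) (f : Fin n → Fin d → M) :
    ∑ l : Fin (n * d), f (finProdFinEquiv.symm l).1 (finProdFinEquiv.symm l).2 =
      ∑ i, ∑ j, f i j := by
  rw [← Fintype.sum_prod_type']
  exact finProdFinEquiv.symm.sum_comp fun p : Fin n × Fin d => f p.1 p.2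

lemma euclidean_sum_single (v : EuclideanSpace ℝ (Fin d)) :
    ∑ j, v j • EuclideanSpace.single j (1 : ℝ) = v := by
  ext j
  simp [Finset.sum_apply, Pi.single_apply]

/-- The projection onto the grid frame is piecewise linear interpolation of x − x(0) at the grid
points: the two normalisations (T/n)^{−1/2} combine to the slope factor (T/n)⁻¹. -/
lemma gridFrame_proj_apply (hT : 0 < T) (n : ℕ) (x : PathSpace T d) (u : Set.Icc (0 : ℝ) T) :
    (gridFrame d hT n).proj x u = ∑ i : Fin n, (gridTime hT n i u / (T / n)) •
      (x (gridPt T hT n (i + 1)) - x (gridPt T hT n i)) := by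
  have h1 : (gridFrame d hT n).proj x u = ∑ l : Fin (n * d),
      ((√(T / n))⁻¹ • incrFun (gridPt T hT n (finProdFinEquiv.symm l).1)
        (gridPt T hT n ((finProdFinEquiv.symm l).1 + 1)) (finProdFinEquiv.symm l).2) x •
      (√(T / n))⁻¹ • gridTime hT n (finProdFinEquiv.symm l).1 u •
        EuclideanSpace.single (finProdFinEquiv.symm l).2 (1 : ℝ) := by
    rw [Frame.proj_apply, Frame.path_apply, Frame.lift_apply, map_sum, ContinuousMap.sum_apply]
    refine Finset.sum_congr rfl fun l _ => ?_
    rw [map_smul, ContinuousMap.smul_apply, Frame.coord_apply]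
    simp only [gridFrame]
    rw [map_smul, ContinuousMap.smul_apply, cmEmbed_rampH]
    rfl
  rw [h1, sum_gridFrame n fun i j => ((√(T / n))⁻¹ • incrFun (gridPt T hT n i)
        (gridPt T hT n (i + 1)) j) x • (√(T / n))⁻¹ • gridTime hT n i u •
        EuclideanSpace.single j (1 : ℝ)]
  refine Finset.sum_congr rfl fun i _ => ?_
  rw [← euclidean_sum_single (x (gridPt T hT n (i + 1)) - x (gridPt T hT n i)), Finset.smul_sum]
  refine Finset.sum_congr rfl fun j _ => ?_
  simp only [smul_apply, incrFun_apply, smul_smul, PiLp.sub_apply, smul_eq_mul]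
  congr 1
  have h0 : 0 ≤ T / n := by positivity
  have h2 : (√(T / n))⁻¹ * (√(T / n))⁻¹ = (T / n)⁻¹ := by
    rw [← mul_inv, Real.mul_self_sqrt h0]
  rw [div_eq_mul_inv _ (T / n), ← h2]
  ring

lemma exists_gridPt (hT : 0 < T) {n : ℕ} (hn : 0 < n) (u : Set.Icc (0 : ℝ) T) :
    ∃ k < n, gridPt T hT n k ≤ u ∧ u ≤ gridPt T hT n (k + 1) := by
  classical
  set k := Nat.findGreatest (fun i => gridPt T hT n i ≤ u) (n - 1) with hk
  have h0 : gridPt T hT n 0 ≤ u := by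
    rw [← Subtype.coe_le_coe, gridPt_zero]
    exact u.2.1
  have hkn : k ≤ n - 1 := Nat.findGreatest_le _
  refine ⟨k, by omega, Nat.findGreatest_spec (P := fun i => gridPt T hT n i ≤ u) (Nat.zero_le _) h0,
    ?_⟩
  rcases hkn.eq_or_lt with h | h
  · rw [← Subtype.coe_le_coe, coe_gridPt hT hn (by omega), show k + 1 = n by omega]
    have hn' : (n : ℝ) ≠ 0 := by positivity
    rw [mul_div_assoc, mul_div_cancel₀ _ hn']
    exact u.2.2
  · exact (not_le.1 (Nat.findGreatest_is_greatest (P := fun i => gridPt T hT n i ≤ u)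
      (Nat.lt_succ_self k) (by omega))).le

/-- Cells before the one containing u contribute full increments, which telescope; later cells
contribute nothing. The weight θ does not depend on x. Both the uniform bound and the convergence of
the projections are read off from this form. -/
lemma exists_gridFrame_proj_eq (hT : 0 < T) {n : ℕ} (hn : 0 < n) (u : Set.Icc (0 : ℝ) T) :
    ∃ k < n, ∃ θ ∈ Set.Icc (0 : ℝ) 1, gridPt T hT n k ≤ u ∧ u ≤ gridPt T hT n (k + 1) ∧
      ∀ x : PathSpace T d, (gridFrame d hT n).proj x u =
        x (gridPt T hT n k) - x (gridPt T hT n 0) +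
          θ • (x (gridPt T hT n (k + 1)) - x (gridPt T hT n k)) := by
  obtain ⟨k, hkn, hk1, hk2⟩ := exists_gridPt hT hn u
  have hn' : (0 : ℝ) < n := by exact_mod_cast hn
  have hΔ : 0 < T / n := by positivity
  refine ⟨k, hkn, gridTime hT n k u / (T / n), ⟨div_nonneg (gridTime_nonneg _ _ _ _) hΔ.le,
    (div_le_one hΔ).2 (gridTime_le hT hkn u)⟩, hk1, hk2, fun x => ?_⟩
  rw [gridFrame_proj_apply, Finset.sum_fin_eq_sum_range]
  have h1 : ∀ i ∈ Finset.range n, (if h : i < n then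
      (gridTime hT n (⟨i, h⟩ : Fin n) u / (T / n)) •
      (x (gridPt T hT n ((⟨i, h⟩ : Fin n) + 1)) - x (gridPt T hT n (⟨i, h⟩ : Fin n))) else 0) =
      (gridTime hT n i u / (T / n)) • (x (gridPt T hT n (i + 1)) - x (gridPt T hT n i)) := by
    intro i hi
    rw [dif_pos (Finset.mem_range.1 hi)]
  rw [Finset.sum_congr rfl h1]
  have h2 := Finset.sum_subset (Finset.range_mono (show k + 1 ≤ n from hkn))
    (f := fun i => (gridTime hT n i u / (T / n)) •
      (x (gridPt T hT n (i + 1)) - x (gridPt T hT n i))) (fun i _ hi => by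
      have hki : k + 1 ≤ i := by simpa using hi
      rw [gridTime_of_le hT (hk2.trans (gridPt_mono hT n hki)), zero_div, zero_smul])
  rw [← h2, Finset.sum_range_succ]
  congr 1
  rw [← Finset.sum_range_sub (fun i => x (gridPt T hT n i))]
  refine Finset.sum_congr rfl fun i hi => ?_
  have hik := Finset.mem_range.1 hi
  rw [gridTime_of_ge hT (by omega) ((gridPt_mono hT n hik).trans hk1), div_self hΔ.ne', one_smul]

/-- The value at u is one increment plus θ ≤ 1 times another, each at most 2‖x‖. The constant 4 does
not depend on the grid, which keeps the later moment constants uniform. -/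
lemma norm_gridFrame_proj_le (hT : 0 < T) {n : ℕ} (hn : 0 < n) (x : PathSpace T d) :
    ‖(gridFrame d hT n).proj x‖ ≤ 4 * ‖x‖ := by
  refine (ContinuousMap.norm_le _ (by positivity)).2 fun u => ?_
  obtain ⟨k, -, θ, hθ, -, -, h⟩ := exists_gridFrame_proj_eq (d := d) hT hn u
  rw [h x]
  have h1 := x.norm_coe_le_norm (gridPt T hT n k)
  have h2 := x.norm_coe_le_norm (gridPt T hT n 0)
  have h3 := x.norm_coe_le_norm (gridPt T hT n (k + 1))
  have h4 := norm_sub_le (x (gridPt T hT n k)) (x (gridPt T hT n 0))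
  have h5 := norm_sub_le (x (gridPt T hT n (k + 1))) (x (gridPt T hT n k))
  have h6 := norm_add_le (x (gridPt T hT n k) - x (gridPt T hT n 0))
    (θ • (x (gridPt T hT n (k + 1)) - x (gridPt T hT n k)))
  rw [norm_smul, Real.norm_of_nonneg hθ.1] at h6
  have h7 := mul_le_mul_of_nonneg_right hθ.2
    (norm_nonneg (x (gridPt T hT n (k + 1)) - x (gridPt T hT n k)))
  linarith

/-- Uniform continuity of a path along the mesh of the grids. -/
lemma exists_mesh (hT : 0 < T) (x : PathSpace T d) {ε : ℝ} (hε : 0 < ε) :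
    ∀ᶠ n : ℕ in atTop, ∀ k < n, ∀ u, gridPt T hT n k ≤ u → u ≤ gridPt T hT n (k + 1) →
      ∀ v, gridPt T hT n k ≤ v → v ≤ gridPt T hT n (k + 1) → ‖x u - x v‖ < ε := by
  obtain ⟨δ, hδ, h⟩ := Metric.uniformContinuous_iff.1
    (CompactSpace.uniformContinuous_of_continuous x.continuous) ε hε
  have h1 : Tendsto (fun n : ℕ => T / n) atTop (𝓝 0) := tendsto_const_div_atTop_nhds_zero_nat T
  filter_upwards [h1.eventually (gt_mem_nhds hδ)] with n hn k hk u hu1 hu2 v hv1 hv2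
  rw [← dist_eq_norm]
  apply h
  rw [Subtype.dist_eq, Real.dist_eq]
  refine lt_of_le_of_lt ?_ hn
  rw [← gridPt_sub hT hk, abs_le]
  rw [← Subtype.coe_le_coe] at hu1 hu2 hv1 hv2
  constructor <;> linarith

/-- Uniform continuity makes the interpolation error small on every cell. The starting value is lost
under projection, hence the condition at time 0, for which `gridPt T hT 0 0` is just a name. -/
lemma tendsto_gridFrame_proj (hT : 0 < T) (x : PathSpace T d) (hx : x (gridPt T hT 0 0) = 0) :
    Tendsto (fun n => (gridFrame d hT n).proj x) atTop (𝓝 x) := by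
  rw [Metric.tendsto_atTop']
  intro ε hε
  obtain ⟨n₀, hn₀⟩ := eventually_atTop.1 (exists_mesh hT x (half_pos (half_pos hε)))
  refine ⟨n₀, fun n hn => ?_⟩
  rw [dist_eq_norm]
  refine lt_of_le_of_lt ((ContinuousMap.norm_le _ (half_pos hε).le).2 fun u => ?_) (half_lt_self hε)
  obtain ⟨k, hk, θ, hθ, hk1, hk2, h⟩ := exists_gridFrame_proj_eq (d := d) hT (n := n) (by omega) u
  have hk3 := gridPt_mono hT n (Nat.le_succ k)
  have h1 := hn₀ n hn.le k hk (gridPt T hT n k) le_rfl hk3 u hk1 hk2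
  have h2 := hn₀ n hn.le k hk (gridPt T hT n (k + 1)) hk3 le_rfl (gridPt T hT n k) le_rfl hk3
  have h0 : gridPt T hT n 0 = gridPt T hT 0 0 :=
    Subtype.ext ((gridPt_zero hT n).trans (gridPt_zero hT 0).symm)
  rw [ContinuousMap.sub_apply, h x, h0, hx, sub_zero, add_sub_right_comm]
  have h6 := norm_add_le (x (gridPt T hT n k) - x u)
    (θ • (x (gridPt T hT n (k + 1)) - x (gridPt T hT n k)))
  rw [norm_smul, Real.norm_of_nonneg hθ.1] at h6
  have h7 := mul_le_mul_of_nonneg_right hθ.2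
    (norm_nonneg (x (gridPt T hT n (k + 1)) - x (gridPt T hT n k)))
  linarith

lemma timeMeasure_singleton (t : Set.Icc (0 : ℝ) T) : timeMeasure T {t} = 0 := by
  rw [timeMeasure, comap_subtype_coe_apply measurableSet_Icc, Set.image_singleton]
  exact Real.volume_singleton

lemma cmEmbed_gridPt_zero (hT : 0 < T) (n : ℕ) (h : CMSpace T d) :
    cmEmbed T d h (gridPt T hT n 0) = 0 := by
  have h1 : Set.Iic (gridPt T hT n 0) = {gridPt T hT n 0} := by
    ext s
    simp only [Set.mem_Iic, Set.mem_singleton_iff]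
    refine ⟨fun hs => le_antisymm hs ?_, fun hs => hs.le⟩
    rw [← Subtype.coe_le_coe, gridPt_zero]
    exact s.2.1
  rw [cmEmbed_apply, h1, setIntegral_measure_zero _ (timeMeasure_singleton _)]

/-- If all integrals of h over the sets `Iic t` vanish, then by the π-λ theorem so do the integrals
over all Borel sets. -/
lemma cmEmbed_injective (T : ℝ) (d : ℕ) : Function.Injective (cmEmbed T d) := by
  rw [injective_iff_map_eq_zero]
  intro h hh
  have h0 : ∀ t : Set.Icc (0 : ℝ) T, ∫ s in Set.Iic t, h s ∂timeMeasure T = 0 := fun t => by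
    rw [← cmEmbed_apply, hh]; rfl
  have hall : ∀ s : Set (Set.Icc (0 : ℝ) T), MeasurableSet s →
      ∫ u in s, h u ∂timeMeasure T = 0 := by
    have huniv : ∫ u, h u ∂timeMeasure T = 0 := by
      rcases le_or_gt 0 T with hT | hT
      · have := h0 ⟨T, hT, le_rfl⟩
        have h1 : Set.Iic (⟨T, hT, le_rfl⟩ : Set.Icc (0 : ℝ) T) = Set.univ := by
          ext s; exact ⟨fun _ => trivial, fun _ => s.2.2⟩
        rwa [h1, setIntegral_univ] at this
      · have : IsEmpty (Set.Icc (0 : ℝ) T) := by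
          rw [Set.isEmpty_coe_sort]; exact Set.Icc_eq_empty (not_le.2 hT)
        rw [integral_of_isEmpty]
    refine MeasurableSpace.induction_on_inter
      (h_eq := (BorelSpace.measurable_eq).trans (borel_eq_generateFrom_Iic _)) isPiSystem_Iic ?_ ?_ ?_ ?_
    · simp
    · rintro _ ⟨t, rfl⟩
      exact h0 t
    · intro s hs h1
      have h2 := integral_add_compl hs h.integrable
      rw [h1, zero_add] at h2
      rw [h2, huniv]
    · intro f hd hm h1
      rw [integral_iUnion hm hd h.integrable.integrableOn]
      simp [h1]
  rw [Lp.eq_zero_iff_ae_eq_zero]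
  exact h.integrable.ae_eq_zero_of_forall_setIntegral_eq_zero fun s hs _ => hall s hs

/-- A vector orthogonal to the range of 𝔢* is sent by 𝔢 to a path killed by every functional, that
is, to 0, and 𝔢 is injective. -/
lemma dense_range_cmAdjoint (T : ℝ) (d : ℕ) : DenseRange (cmAdjoint T d) := by
  let V : Submodule ℝ (CMSpace T d) :=
    { carrier := Set.range (cmAdjoint T d)
      add_mem' := by
        rintro _ _ ⟨η, rfl⟩ ⟨η', rfl⟩
        exact ⟨η + η', cmAdjoint_add η η'⟩
      zero_mem' := ⟨0, by simpa using cmAdjoint_smul (0 : ℝ) (0 : PathSpace T d →L[ℝ] ℝ)⟩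
      smul_mem' := by
        rintro c _ ⟨η, rfl⟩
        exact ⟨c • η, cmAdjoint_smul c η⟩ }
  have hV : V.topologicalClosure = ⊤ := by
    rw [Submodule.topologicalClosure_eq_top_iff, Submodule.eq_bot_iff]
    intro h hh
    refine cmEmbed_injective T d ?_
    rw [map_zero]
    refine SeparatingDual.eq_zero_of_forall_dual_eq_zero (R := ℝ) fun η => ?_
    rw [← cmAdjoint_inner]
    exact hh _ ⟨η, rfl⟩
  exact (Submodule.dense_iff_topologicalClosure_eq_top (s := V)).2 hV

/-- Uniform convergence of the projected paths gives convergence of inner products against the dense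
range of 𝔢*. Hence ⟨P h, h⟩ → ‖h‖², and ‖P h − h‖² = ‖h‖² − ⟨P h, h⟩ for an orthogonal projection
upgrades this to norm convergence. -/
lemma tendsto_gridFrame_projH (hT : 0 < T) (h : CMSpace T d) :
    Tendsto (fun n => (gridFrame d hT n).projH h) atTop (𝓝 h) := by
  have hweak : ∀ η : PathSpace T d →L[ℝ] ℝ,
      Tendsto (fun n => ⟪(gridFrame d hT n).projH h, cmAdjoint T d η⟫_ℝ) atTop
        (𝓝 ⟪h, cmAdjoint T d η⟫_ℝ) := by
    intro η
    simp_rw [real_inner_comm (cmAdjoint T d η), cmAdjoint_inner]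
    have h1 := tendsto_gridFrame_proj hT (cmEmbed T d h) (cmEmbed_gridPt_zero hT 0 h)
    exact (η.continuous.tendsto _).comp h1
  have hinner : Tendsto (fun n => ⟪(gridFrame d hT n).projH h, h⟫_ℝ) atTop (𝓝 ⟪h, h⟫_ℝ) := by
    rw [Metric.tendsto_atTop]
    intro ε hε
    obtain ⟨η, hη⟩ := (dense_range_cmAdjoint T d).exists_dist_lt h
      (show 0 < ε / (2 * (‖h‖ + 1)) / 2 by positivity)
    obtain ⟨n₀, hn₀⟩ := Metric.tendsto_atTop.1 (hweak η) (ε / 2) (half_pos hε)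
    refine ⟨n₀, fun n hn => ?_⟩
    have h1 := hn₀ n hn
    rw [Real.dist_eq] at h1 ⊢
    set P := (gridFrame d hT n).projH h
    set g := cmAdjoint T d η
    have h2 : ⟪P, h⟫_ℝ - ⟪h, h⟫_ℝ = (⟪P, g⟫_ℝ - ⟪h, g⟫_ℝ) + ⟪P - h, h - g⟫_ℝ := by
      simp only [inner_sub_left, inner_sub_right]; ring
    have h3 : |⟪P - h, h - g⟫_ℝ| ≤ (2 * ‖h‖) * (ε / (2 * (‖h‖ + 1)) / 2) := by
      refine (abs_real_inner_le_norm _ _).trans ?_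
      rw [dist_eq_norm] at hη
      have h4 := (norm_sub_le P h).trans
        (add_le_add_left ((gridFrame d hT n).norm_projH_le h) ‖h‖)
      gcongr
      linarith
    have h5 : (2 * ‖h‖) * (ε / (2 * (‖h‖ + 1)) / 2) < ε / 2 := by
      have : 0 ≤ ‖h‖ := norm_nonneg h
      field_simp
      nlinarith
    rw [h2]
    exact (abs_add_le _ _).trans_lt (by linarith)
  rw [tendsto_iff_norm_sub_tendsto_zero]
  have h1 : ∀ n, ‖(gridFrame d hT n).projH h - h‖ =
      √(⟪h, h⟫_ℝ - ⟪(gridFrame d hT n).projH h, h⟫_ℝ) := by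
    intro n
    rw [← Real.sqrt_sq (norm_nonneg _), norm_sub_sq_real, Frame.inner_projH_self,
      real_inner_self_eq_norm_sq]
    congr 1
    ring
  simp_rw [h1]
  have h2 := (tendsto_const_nhds (x := ⟪h, h⟫_ℝ)).sub hinner
  rw [sub_self] at h2
  have h3 := (Real.continuous_sqrt.tendsto 0).comp h2
  rwa [Real.sqrt_zero] at h3

end

noncomputable section

/-! ### Gaussian properties of Wiener measure -/

variable {T : ℝ} {d : ℕ} {μ : Measure (PathSpace T d)}

lemma Frame.norm_projH_sq {N : ℕ} (B : Frame T d N) (h : CMSpace T d) :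
    ‖B.projH h‖ ^ 2 = ∑ l, ⟪B.e l, h⟫_ℝ ^ 2 := by
  change ‖B.lift (B.coord (cmEmbed T d h))‖ ^ 2 = _
  rw [B.norm_lift_sq]
  simp [B.coord_cmEmbed]

namespace IsWienerMeasure

lemma charFun_increment (hμ : IsWienerMeasure μ) {s t : Set.Icc (0 : ℝ) T} (hst : s ≤ t)
    (c : EuclideanSpace ℝ (Fin d)) :
    ∫ x : PathSpace T d, Complex.exp ((⟪x t - x s, c⟫_ℝ : ℝ) * Complex.I) ∂μ =
      Complex.exp (-(((t : ℝ) - s) * ‖c‖ ^ 2 : ℝ) / 2) := by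
  have h1 : charFun (μ.map fun x : PathSpace T d => x t - x s) c =
      ∫ x : PathSpace T d, Complex.exp ((⟪x t - x s, c⟫_ℝ : ℝ) * Complex.I) ∂μ := by
    have hm : Continuous fun x : PathSpace T d => x t - x s := by fun_prop
    rw [charFun_apply, integral_map hm.measurable.aemeasurable]
    exact (by fun_prop : Continuous _).aestronglyMeasurable
  rw [← h1, hμ.law_increments s t hst, charFun_multivariateGaussian
    (Matrix.PosSemidef.one.smul (sub_nonneg.2 (Subtype.coe_le_coe.2 hst)))]
  congr 1
  rw [Matrix.smul_mulVec, Matrix.one_mulVec, dotProduct_smul]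
  have h2 : c.ofLp ⬝ᵥ c.ofLp = ‖c‖ ^ 2 := by
    rw [EuclideanSpace.norm_sq_eq, dotProduct]
    exact Finset.sum_congr rfl fun i _ => by rw [Real.norm_eq_abs, sq_abs, sq]
  rw [h2]
  simp [neg_div]

/-- After projection, η sees the path only through the grid increments. These are independent
Gaussian vectors, so the expectation factors, and the variances add up to the squared norm of the
projection of 𝔢*(η). -/
lemma charFunDual_comp_gridFrame (hμ : IsWienerMeasure μ) (hT : 0 < T) (n : ℕ)
    (η : PathSpace T d →L[ℝ] ℝ) :
    ∫ x, Complex.exp ((η ((gridFrame d hT n).proj x) : ℝ) * Complex.I) ∂μ =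
      Complex.exp (-(‖(gridFrame d hT n).projH (cmAdjoint T d η)‖ ^ 2 : ℝ) / 2) := by
  set B := gridFrame d hT n with hB
  set Δ := T / n with hΔ
  set b : Fin n → Fin d → ℝ := fun i j => ⟪B.e (finProdFinEquiv (i, j)), cmAdjoint T d η⟫_ℝ with hb
  let c : Fin n → EuclideanSpace ℝ (Fin d) := fun i => WithLp.toLp 2 fun j => (√Δ)⁻¹ * b i j
  have h1 : ∀ x, η (B.proj x) = ∑ i : Fin n,
      ⟪x (gridPt T hT n (i + 1)) - x (gridPt T hT n i), c i⟫_ℝ := by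
    intro x
    have h2 : η (B.proj x) = ∑ l, B.η l x * ⟪B.e l, cmAdjoint T d η⟫_ℝ := by
      rw [B.proj_apply, B.path_apply, ← cmAdjoint_inner, B.inner_lift]
      exact Finset.sum_congr rfl fun l _ => by rw [B.coord_apply, real_inner_comm]
    have h3 : ∀ l, B.η l x * ⟪B.e l, cmAdjoint T d η⟫_ℝ =
        (fun (i : Fin n) j => (√Δ)⁻¹ * (x (gridPt T hT n (i + 1)) j - x (gridPt T hT n i) j) * b i j)
          (finProdFinEquiv.symm l).1 (finProdFinEquiv.symm l).2 := by
      intro l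
      simp only [hb, Prod.mk.eta, Equiv.apply_symm_apply]
      rfl
    rw [h2, Finset.sum_congr rfl fun l _ => h3 l, sum_gridFrame n
      fun (i : Fin n) j => (√Δ)⁻¹ * (x (gridPt T hT n (i + 1)) j - x (gridPt T hT n i) j) * b i j]
    refine Finset.sum_congr rfl fun i _ => ?_
    rw [PiLp.inner_apply]
    refine Finset.sum_congr rfl fun j _ => ?_
    simp [c]
    ring
  have h4 : ∀ x, Complex.exp ((η (B.proj x) : ℝ) * Complex.I) = ∏ i : Fin n,
      Complex.exp ((⟪x (gridPt T hT n (i + 1)) - x (gridPt T hT n i), c i⟫_ℝ : ℝ) * Complex.I) := by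
    intro x
    rw [h1, ← Complex.exp_sum]
    push_cast
    rw [Finset.sum_mul]
  simp_rw [h4]
  have hind : iIndepFun (fun (i : Fin n) (x : PathSpace T d) =>
      x (gridPt T hT n (i + 1)) - x (gridPt T hT n i)) μ :=
    (hμ.indep_increments.nat (gridPt_mono hT n)).precomp Fin.val_injective
  rw [hind.integral_fun_prod_comp (f := fun i y => Complex.exp ((⟪y, c i⟫_ℝ : ℝ) * Complex.I))
    (fun i => (by fun_prop : Continuous _).measurable.aemeasurable)
    (fun i => (by fun_prop : Continuous _).aestronglyMeasurable)]
  rw [Finset.prod_congr rfl fun i _ =>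
    hμ.charFun_increment (gridPt_lt hT i.2).le (c i), ← Complex.exp_sum]
  congr 1
  rw [← Finset.sum_div]
  congr 1
  rw [Finset.sum_neg_distrib, B.norm_projH_sq]
  have h5 : ∀ l, ⟪B.e l, cmAdjoint T d η⟫_ℝ ^ 2 =
      (fun i j => b i j ^ 2) (finProdFinEquiv.symm l).1 (finProdFinEquiv.symm l).2 := by
    intro l
    simp only [hb, Prod.mk.eta, Equiv.apply_symm_apply]
  rw [Finset.sum_congr rfl fun l _ => h5 l, sum_gridFrame n fun i j => b i j ^ 2]
  rw [← Complex.ofReal_sum]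
  congr 2
  refine Finset.sum_congr rfl fun i _ => ?_
  rw [gridPt_sub hT i.2, EuclideanSpace.norm_sq_eq, Finset.mul_sum]
  refine Finset.sum_congr rfl fun j _ => ?_
  have hn : (0 : ℝ) < n := by exact_mod_cast (Nat.zero_le _).trans_lt i.2
  have hΔ0 : 0 < Δ := by positivity
  simp only [c, norm_mul, norm_inv, Real.norm_eq_abs, mul_pow, inv_pow, sq_abs]
  rw [Real.sq_sqrt hΔ0.le, ← mul_assoc, ← hΔ, mul_inv_cancel₀ hΔ0.ne', one_mul]

/-- The characteristic functional of Wiener measure. -/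
lemma charFunDual_eq (hμ : IsWienerMeasure μ) (hT : 0 < T) (η : PathSpace T d →L[ℝ] ℝ) :
    charFunDual μ η = Complex.exp (-(‖cmAdjoint T d η‖ ^ 2 : ℝ) / 2) := by
  have := hμ.isProbabilityMeasure
  -- Both sides of the grid formula pass to the limit: the left by dominated convergence, since
  -- almost every path starts at 0 and so is the limit of its projections; the right because the
  -- projections of 𝔢*(η) converge in H_T.
  have h1 : Tendsto (fun n => ∫ x, Complex.exp ((η ((gridFrame d hT n).proj x) : ℝ) * Complex.I) ∂μ)
      atTop (𝓝 (charFunDual μ η)) := by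
    rw [charFunDual_apply]
    refine tendsto_integral_of_dominated_convergence (fun _ => 1) (fun n => ?_)
      (integrable_const _) (fun n => ?_) ?_
    · exact (by fun_prop : Continuous _).aestronglyMeasurable
    · refine Eventually.of_forall fun x => ?_
      rw [Complex.norm_exp_ofReal_mul_I]
    · filter_upwards [hμ.start_zero] with x hx
      have h2 := tendsto_gridFrame_proj hT x (hx _ (gridPt_zero hT 0))
      have h3 : Continuous fun y : PathSpace T d => Complex.exp ((η y : ℝ) * Complex.I) := by
        fun_prop
      exact (h3.tendsto x).comp h2
  simp_rw [hμ.charFunDual_comp_gridFrame hT] at h1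
  refine tendsto_nhds_unique h1 ?_
  have h2 := (tendsto_gridFrame_projH hT (cmAdjoint T d η)).norm.pow 2
  have h3 : Continuous fun r : ℝ => Complex.exp (-(r : ℝ) / 2) := by fun_prop
  exact (h3.tendsto _).comp h2

lemma map_dual (hμ : IsWienerMeasure μ) (hT : 0 < T) (η : PathSpace T d →L[ℝ] ℝ) :
    μ.map η = gaussianReal 0 (‖cmAdjoint T d η‖₊ ^ 2) := by
  have := hμ.isProbabilityMeasure
  have : IsProbabilityMeasure (μ.map η) :=
    Measure.isProbabilityMeasure_map η.continuous.measurable.aemeasurable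
  refine Measure.ext_of_charFun ?_
  ext u
  rw [charFun_map_eq_charFunDual_smul, hμ.charFunDual_eq hT, charFun_gaussianReal, cmAdjoint_smul,
    norm_smul]
  congr 1
  push_cast
  rw [mul_pow, Real.norm_eq_abs, ← Complex.ofReal_pow, ← Complex.ofReal_pow, sq_abs]
  push_cast
  simp
  ring

/-- Gaussianity on the Banach space of paths yields finite moments of every order for the sup norm;
powers of 1 + ‖x‖ then serve as dominating functions throughout. -/
lemma isGaussian (hμ : IsWienerMeasure μ) (hT : 0 < T) : IsGaussian μ :=
  isGaussian_of_map_eq_gaussianReal fun η => ⟨0, _, hμ.map_dual hT η⟩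

lemma memLp_dual (hμ : IsWienerMeasure μ) (hT : 0 < T) (η : PathSpace T d →L[ℝ] ℝ) :
    MemLp η 2 μ := by
  have := hμ.isGaussian hT
  exact IsGaussian.memLp_dual μ η 2 (by norm_num)

lemma integral_dual (hμ : IsWienerMeasure μ) (hT : 0 < T) (η : PathSpace T d →L[ℝ] ℝ) :
    ∫ x, η x ∂μ = 0 := by
  have h := integral_id_gaussianReal (μ := 0) (v := ‖cmAdjoint T d η‖₊ ^ 2)
  rw [← hμ.map_dual hT η, integral_map η.continuous.measurable.aemeasurable
    (by fun_prop)] at h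
  exact h

lemma eLpNorm_dual (hμ : IsWienerMeasure μ) (hT : 0 < T) (η : PathSpace T d →L[ℝ] ℝ) :
    eLpNorm η 2 μ = ENNReal.ofReal ‖cmAdjoint T d η‖ := by
  have h1 : ∫ x, (η x) ^ 2 ∂μ = ‖cmAdjoint T d η‖ ^ 2 := by
    have h := variance_fun_id_gaussianReal (μ := 0) (v := ‖cmAdjoint T d η‖₊ ^ 2)
    rw [variance_of_integral_eq_zero (by fun_prop) integral_id_gaussianReal,
      ← hμ.map_dual hT η, integral_map η.continuous.measurable.aemeasurable (by fun_prop)] at h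
    exact h.trans (by simp)
  rw [(hμ.memLp_dual hT η).eLpNorm_eq_integral_rpow_norm (by norm_num) (by norm_num)]
  simp only [ENNReal.toReal_ofNat, Real.rpow_two, Real.norm_eq_abs, sq_abs]
  rw [h1, ← Real.rpow_natCast, ← Real.rpow_mul (norm_nonneg _)]
  norm_num

lemma memLp_norm (hμ : IsWienerMeasure μ) (hT : 0 < T) (p : ℝ≥0∞) (hp : p ≠ ∞) :
    MemLp (fun x : PathSpace T d => ‖x‖) p μ := by
  have := hμ.isGaussian hT
  exact (IsGaussian.memLp_id μ p hp).norm

lemma memLp_one_add_norm_pow (hμ : IsWienerMeasure μ) (hT : 0 < T) (k : ℕ) (p : ℝ≥0∞)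
    (hp : p ≠ ∞) : MemLp (fun x : PathSpace T d => (1 + ‖x‖) ^ k) p μ := by
  have := hμ.isProbabilityMeasure
  rcases Nat.eq_zero_or_pos k with rfl | hk
  · simpa using memLp_const (1 : ℝ)
  · have h0 : MemLp (fun _ : PathSpace T d => (1 : ℝ)) (p * k) μ := memLp_const 1
    have h1 : MemLp (fun x : PathSpace T d => 1 + ‖x‖) (p * k) μ :=
      h0.add (hμ.memLp_norm hT _ (ENNReal.mul_ne_top hp (ENNReal.natCast_ne_top k)))
    have h2 := h1.norm_rpow_div (q := (k : ℝ≥0∞))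
    rw [ENNReal.mul_div_cancel_right (by exact_mod_cast hk.ne') (ENNReal.natCast_ne_top k)] at h2
    refine h2.congr_norm ?_ (Eventually.of_forall fun x => ?_)
    · exact (by fun_prop : Continuous fun x : PathSpace T d => (1 + ‖x‖) ^ k).aestronglyMeasurable
    · simp

lemma integrable_one_add_norm_pow (hμ : IsWienerMeasure μ) (hT : 0 < T) (k : ℕ) :
    Integrable (fun x : PathSpace T d => (1 + ‖x‖) ^ k) μ :=
  memLp_one_iff_integrable.1 (hμ.memLp_one_add_norm_pow hT k 1 (by norm_num))

end IsWienerMeasure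

namespace Frame

variable {N : ℕ} (B : Frame T d N)

/-- `x ↦ x - (1 - b) π x`: the paths with their component in the frame scaled by `b`. -/
def scale (b : ℝ) : PathSpace T d →L[ℝ] PathSpace T d :=
  ContinuousLinearMap.id ℝ _ - (1 - b) • B.proj

lemma scale_apply (b : ℝ) (x : PathSpace T d) : B.scale b x = x - (1 - b) • B.proj x := rfl

/-- The Mehler map `(v, x) ↦ a v + (b π x + (1 - π) x)`. -/
def mehler (a b : ℝ) (v : Fin N → ℝ) (x : PathSpace T d) : PathSpace T d :=
  B.path (a • v) + B.scale b x

lemma continuous_mehler (a b : ℝ) :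
    Continuous fun p : (Fin N → ℝ) × PathSpace T d => B.mehler a b p.1 p.2 := by
  unfold mehler; fun_prop

lemma norm_sub_smul_projH_sq (b : ℝ) (g : CMSpace T d) :
    ‖g - (1 - b) • B.projH g‖ ^ 2 = ‖g‖ ^ 2 + (b ^ 2 - 1) * ‖B.projH g‖ ^ 2 := by
  rw [norm_sub_sq_real, real_inner_smul_right, real_inner_comm, B.inner_projH_self, norm_smul,
    mul_pow, Real.norm_eq_abs, sq_abs]
  ring

/-- Compare characteristic functionals. The two independent arguments contribute the variances
a²‖Pg‖² and ‖g − (1 − b)Pg‖², with g = 𝔢*(η) and P the frame projection; by Pythagoras and a² + b² =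
1 they sum to ‖g‖². -/
lemma measurePreserving_mehler (hμ : IsWienerMeasure μ) (hT : 0 < T) {a b : ℝ}
    (hab : a ^ 2 + b ^ 2 = 1) :
    MeasurePreserving (fun p : PathSpace T d × PathSpace T d => B.mehler a b (B.coord p.1) p.2)
      (μ.prod μ) μ := by
  have := hμ.isProbabilityMeasure
  let L : PathSpace T d × PathSpace T d →L[ℝ] PathSpace T d := (a • B.proj).coprod (B.scale b)
  have hL : (fun p : PathSpace T d × PathSpace T d => B.mehler a b (B.coord p.1) p.2) = L := by
    ext1 p
    simp [mehler, L, proj_apply]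
  rw [hL]
  refine ⟨L.continuous.measurable, ?_⟩
  have : IsProbabilityMeasure ((μ.prod μ).map L) :=
    Measure.isProbabilityMeasure_map L.continuous.measurable.aemeasurable
  refine Measure.ext_of_charFunDual ?_
  ext η
  rw [charFunDual_map, charFunDual_prod, hμ.charFunDual_eq hT, hμ.charFunDual_eq hT,
    hμ.charFunDual_eq hT, ← Complex.exp_add]
  have h1 : (η.comp L).comp (ContinuousLinearMap.inl ℝ _ _) = a • (η ∘L B.proj) := by
    ext x; simp [L]
  have h2 : (η.comp L).comp (ContinuousLinearMap.inr ℝ _ _) = η - (1 - b) • (η ∘L B.proj) := by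
    ext x; simp [L, scale_apply]
  rw [h1, h2, cmAdjoint_smul, cmAdjoint_sub, cmAdjoint_smul, cmAdjoint_comp_proj,
    norm_sub_smul_projH_sq, norm_smul, mul_pow, Real.norm_eq_abs, sq_abs]
  congr 1
  have hb : b ^ 2 - 1 = -a ^ 2 := by linarith
  rw [hb]
  push_cast
  ring

lemma map_coord (hμ : IsWienerMeasure μ) (hT : 0 < T) : μ.map B.coord = stdGauss N := by
  have := hμ.isProbabilityMeasure
  have : IsProbabilityMeasure (μ.map B.coord) :=
    Measure.isProbabilityMeasure_map B.coord.continuous.measurable.aemeasurable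
  refine Measure.ext_of_charFunDual ?_
  ext L
  rw [charFunDual_map, hμ.charFunDual_eq hT, charFunDual_stdGauss]
  have h1 : cmAdjoint T d (L.comp B.coord) = B.lift fun l => L (Pi.single l 1) := by
    refine ext_inner_right ℝ fun h => ?_
    rw [cmAdjoint_inner, real_inner_comm, inner_lift]
    have h2 : B.coord (cmEmbed T d h) = ∑ l, ⟪B.e l, h⟫_ℝ • Pi.single l (1 : ℝ) := by
      ext l
      simp [coord_cmEmbed, Finset.sum_apply, Pi.single_apply]
    rw [ContinuousLinearMap.comp_apply, h2, map_sum]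
    refine Finset.sum_congr rfl fun l _ => ?_
    rw [map_smul, smul_eq_mul, mul_comm, real_inner_comm]
  rw [h1, norm_lift_sq]

/-- The coordinates in the frame are independent of the remainder. -/
lemma lintegral_decomp (hμ : IsWienerMeasure μ) (hT : 0 < T) {H : PathSpace T d → ℝ≥0∞}
    (hH : Measurable H) :
    ∫⁻ x, H x ∂μ = ∫⁻ x, ∫⁻ w, H (B.path w + B.scale 0 x) ∂stdGauss N ∂μ := by
  have := hμ.isProbabilityMeasure
  -- The extreme case a = 1, b = 0 of the rotation resamples the frame coordinates independently and
  -- keeps the remainder of x.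
  have hp := B.measurePreserving_mehler hμ hT (a := 1) (b := 0) (by norm_num)
  have hm : Measurable fun p : PathSpace T d × PathSpace T d =>
      H (B.mehler 1 0 (B.coord p.1) p.2) := hH.comp hp.measurable
  rw [← hp.lintegral_comp hH, lintegral_prod_symm' _ hm]
  refine lintegral_congr fun x => ?_
  have hm : Measurable fun w => H (B.path w + B.scale 0 x) :=
    hH.comp (by fun_prop : Continuous _).measurable
  rw [← B.map_coord hμ hT, lintegral_map hm B.coord.continuous.measurable]
  simp [mehler]

lemma scale_path_add (b : ℝ) (w : Fin N → ℝ) (x : PathSpace T d) :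
    B.scale b (B.path w + B.scale 0 x) = B.path (b • w) + B.scale 0 x := by
  have h : B.proj (B.scale 0 x) = 0 := by
    rw [scale_apply, map_sub, map_smul, proj_apply, proj_apply, coord_path]
    simp
  rw [B.scale_apply b, map_add, h, proj_path, map_smul, add_zero]
  module

/-- The law of the Mehler map at a fixed base point is dominated by a multiple of `μ`. -/
lemma lintegral_mehler_le (hμ : IsWienerMeasure μ) (hT : 0 < T) {a b : ℝ} (hb : b ≠ 0)
    (hab : a ^ 2 + b ^ 2 = 1) (v : Fin N → ℝ) {H : PathSpace T d → ℝ≥0∞} (hH : Measurable H) :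
    ∫⁻ x, H (B.mehler a b v x) ∂μ ≤
      ENNReal.ofReal (|(b ^ N)⁻¹| * Real.exp ((∑ i, v i ^ 2) / 2)) * ∫⁻ x, H x ∂μ := by
  have hm : Measurable fun x => H (B.mehler a b v x) :=
    hH.comp ((B.continuous_mehler a b).comp (by fun_prop : Continuous fun x => (v, x))).measurable
  rw [B.lintegral_decomp hμ hT hm, B.lintegral_decomp hμ hT hH,
    ← lintegral_const_mul' _ _ ENNReal.ofReal_ne_top]
  refine lintegral_mono fun x => ?_
  have h1 : ∀ w, B.mehler a b v (B.path w + B.scale 0 x) =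
      B.path (a • v + b • w) + B.scale 0 x := by
    intro w
    rw [mehler, scale_path_add, map_add, add_assoc]
  simp_rw [h1]
  have hm' : Measurable fun w => H (B.path w + B.scale 0 x) :=
    hH.comp (by fun_prop : Continuous _).measurable
  exact lintegral_stdGauss_affine_le hm' hb hab v

end Frame

end

noncomputable section

/-! ### Euler schemes and absolute continuity of the law of the solution -/

variable {T : ℝ} {d : ℕ} {μ : Measure (PathSpace T d)}

/-- One step of the Euler scheme: add the drift `A x(t_k)` on the `k`-th grid interval. -/
def eulerStep (A : Matrix (Fin d) (Fin d) ℝ) (hT : 0 < T) (n k : ℕ) (x : PathSpace T d) :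
    PathSpace T d :=
  x + cmEmbed T d (∑ j, (matrixCLM A (x (gridPt T hT n k))) j •
    rampH (gridPt T hT n k) (gridPt T hT n (k + 1)) j)

/-- The first `k` steps of the Euler scheme. -/
def eulerIter (A : Matrix (Fin d) (Fin d) ℝ) (hT : 0 < T) (n : ℕ) :
    ℕ → PathSpace T d → PathSpace T d
  | 0 => id
  | k + 1 => eulerStep A hT n k ∘ eulerIter A hT n k

/-- The Girsanov density of one Euler step. -/
def eulerDensity (A : Matrix (Fin d) (Fin d) ℝ) (hT : 0 < T) (n k : ℕ) (x : PathSpace T d) : ℝ :=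
  Real.exp (⟪matrixCLM A (x (gridPt T hT n k)), x (gridPt T hT n (k + 1)) - x (gridPt T hT n k)⟫_ℝ -
    T / n * ‖matrixCLM A (x (gridPt T hT n k))‖ ^ 2 / 2)

variable (A : Matrix (Fin d) (Fin d) ℝ) (hT : 0 < T)

lemma cmEmbed_sum_rampH (n k : ℕ) (v : EuclideanSpace ℝ (Fin d)) (u : Set.Icc (0 : ℝ) T) :
    cmEmbed T d (∑ j, v j • rampH (gridPt T hT n k) (gridPt T hT n (k + 1)) j) u =
      gridTime hT n k u • v := by
  rw [map_sum, ContinuousMap.sum_apply]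
  nth_rw 2 [← euclidean_sum_single v]
  rw [Finset.smul_sum]
  refine Finset.sum_congr rfl fun j _ => ?_
  rw [map_smul, ContinuousMap.smul_apply, cmEmbed_rampH, smul_comm]
  rfl

lemma eulerStep_apply (n k : ℕ) (x : PathSpace T d) (u : Set.Icc (0 : ℝ) T) :
    eulerStep A hT n k x u = x u + gridTime hT n k u • matrixCLM A (x (gridPt T hT n k)) := by
  rw [eulerStep, ContinuousMap.add_apply, cmEmbed_sum_rampH]

lemma eulerStep_apply_of_le (n k : ℕ) (x : PathSpace T d) {u : Set.Icc (0 : ℝ) T}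
    (hu : u ≤ gridPt T hT n k) : eulerStep A hT n k x u = x u := by
  rw [eulerStep_apply, gridTime_of_le hT hu, zero_smul, add_zero]

lemma continuous_eulerStep (n k : ℕ) : Continuous (eulerStep A hT n k) := by
  unfold eulerStep
  fun_prop

lemma continuous_eulerIter (n k : ℕ) : Continuous (eulerIter A hT n k) := by
  induction k with
  | zero => exact continuous_id
  | succ k ih => exact (continuous_eulerStep A hT n k).comp ih

lemma continuous_eulerDensity (n k : ℕ) : Continuous (eulerDensity A hT n k) := by
  unfold eulerDensity
  fun_prop

lemma eulerDensity_pos (n k : ℕ) (x : PathSpace T d) : 0 < eulerDensity A hT n k x :=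
  Real.exp_pos _

/-- The drift added in cell k depends on x only through x(t_k), which the increment over that cell
does not affect. With the rest of the path frozen, the step is a deterministic shift of a standard
Gaussian vector, and the finite-dimensional shift formula applies. -/
lemma lintegral_eulerStep (hμ : IsWienerMeasure μ) {n k : ℕ} (hk : k < n)
    {H : PathSpace T d → ℝ≥0∞} (hH : Measurable H) :
    ∫⁻ x, H x * ENNReal.ofReal (eulerDensity A hT n k x) ∂μ =
      ∫⁻ x, H (eulerStep A hT n k x) ∂μ := by
  have hn : (0 : ℝ) < n := by exact_mod_cast (Nat.zero_le _).trans_lt hk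
  have hΔ : 0 < T / n := by positivity
  have hΔs : √(T / n) ≠ 0 := (Real.sqrt_pos.2 hΔ).ne'
  let B : Frame T d d := intervalFrame (gridPt T hT n k) (gridPt T hT n (k + 1)) (gridPt_lt hT hk)
  have hm1 : Measurable fun x => H x * ENNReal.ofReal (eulerDensity A hT n k x) :=
    hH.mul (continuous_eulerDensity A hT n k).measurable.ennreal_ofReal
  have hm2 : Measurable fun x => H (eulerStep A hT n k x) :=
    hH.comp (continuous_eulerStep A hT n k).measurable
  rw [B.lintegral_decomp hμ hT hm1, B.lintegral_decomp hμ hT hm2]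
  refine lintegral_congr fun x => ?_
  set z := B.scale 0 x with hz
  set v := matrixCLM A (z (gridPt T hT n k)) with hv
  -- Over the cell the drift moves the path by (T/n)v; in coordinates normalised by √(T/n) this is
  -- the shift m.
  let m : Fin d → ℝ := fun j => √(T / n) * v j
  have hpath : ∀ w : Fin d → ℝ, B.path w =
      cmEmbed T d (∑ j, ((√(T / n))⁻¹ • (WithLp.toLp 2 w : EuclideanSpace ℝ (Fin d))) j •
        rampH (gridPt T hT n k) (gridPt T hT n (k + 1)) j) := by
    intro w
    rw [B.path_apply, B.lift_apply]
    congr 1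
    refine Finset.sum_congr rfl fun j _ => ?_
    simp only [B, intervalFrame, gridPt_sub hT hk]
    rw [smul_smul, mul_comm]
    rfl
  have hpath0 : ∀ w, B.path w (gridPt T hT n k) = 0 := by
    intro w
    rw [hpath, cmEmbed_sum_rampH, gridTime_of_le hT le_rfl, zero_smul]
  have hcoordz : B.coord z = 0 := by
    rw [hz, B.scale_apply, map_sub, map_smul, B.coord_proj]
    simp
  have hval : ∀ w, (B.path w + z) (gridPt T hT n k) = z (gridPt T hT n k) := by
    intro w
    rw [ContinuousMap.add_apply, hpath0, zero_add]
  have hinc : ∀ w, ∀ j, ((B.path w + z) (gridPt T hT n (k + 1)) - (B.path w + z) (gridPt T hT n k)) j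
      = √(T / n) * w j := by
    intro w j
    have h1 : B.coord (B.path w + z) j = w j := by
      rw [map_add, hcoordz, B.coord_path, add_zero]
    have h2 : B.coord (B.path w + z) j = (√(T / n))⁻¹ *
        ((B.path w + z) (gridPt T hT n (k + 1)) - (B.path w + z) (gridPt T hT n k)) j := by
      rw [B.coord_apply]
      simp only [B, intervalFrame, gridPt_sub hT hk]
      rfl
    rw [← h1, h2, mul_inv_cancel_left₀ hΔs]
  have hdens : ∀ w, eulerDensity A hT n k (B.path w + z) =
      Real.exp (∑ j, m j * w j - (∑ j, m j ^ 2) / 2) := by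
    intro w
    rw [eulerDensity, hval, ← hv, PiLp.inner_apply]
    congr 2
    · refine Finset.sum_congr rfl fun j _ => ?_
      have h1 := hinc w j
      rw [hval] at h1
      rw [h1, RCLike.inner_apply]
      simp only [m, conj_trivial]
      ring
    · congr 1
      rw [EuclideanSpace.norm_sq_eq, Finset.mul_sum]
      refine Finset.sum_congr rfl fun j _ => ?_
      rw [mul_pow, Real.sq_sqrt hΔ.le, Real.norm_eq_abs, sq_abs]
  have hstep : ∀ w, eulerStep A hT n k (B.path w + z) = B.path (w + m) + z := by
    intro w
    rw [eulerStep, hval, ← hv, map_add, hpath m]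
    have : ((√(T / n))⁻¹ • (WithLp.toLp 2 m : EuclideanSpace ℝ (Fin d))) = v := by
      ext j
      exact inv_mul_cancel_left₀ hΔs _
    rw [this]
    abel
  simp_rw [hdens, hstep]
  have hm' : Measurable fun w => H (B.path w + z) :=
    hH.comp (by fun_prop : Continuous _).measurable
  exact lintegral_stdGauss_shift hm' m

/-- The i-th density looks at the path up to time t_{i+1} ≤ t_k only, and step k changes nothing
before t_k. This lets the densities multiply up in the induction. -/
lemma eulerDensity_eulerStep {n i k : ℕ} (hik : i < k) (x : PathSpace T d) :
    eulerDensity A hT n i (eulerStep A hT n k x) = eulerDensity A hT n i x := by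
  rw [eulerDensity, eulerStep_apply_of_le A hT n k x (gridPt_mono hT n hik.le),
    eulerStep_apply_of_le A hT n k x (gridPt_mono hT n hik)]
  rfl

/-- The discrete Girsanov formula. -/
lemma lintegral_eulerIter (hμ : IsWienerMeasure μ) {n k : ℕ} (hk : k ≤ n)
    {H : PathSpace T d → ℝ≥0∞} (hH : Measurable H) :
    ∫⁻ x, H x * ENNReal.ofReal (∏ i ∈ Finset.range k, eulerDensity A hT n i x) ∂μ =
      ∫⁻ x, H (eulerIter A hT n k x) ∂μ := by
  induction k generalizing H with
  | zero => simp [eulerIter]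
  | succ k ih =>
    have hq : Measurable fun x => ENNReal.ofReal (∏ i ∈ Finset.range k, eulerDensity A hT n i x) :=
      (continuous_finsetProd _ fun i _ =>
        continuous_eulerDensity A hT n i).measurable.ennreal_ofReal
    have h1 : ∀ x, H x * ENNReal.ofReal (∏ i ∈ Finset.range (k + 1), eulerDensity A hT n i x) =
        (H x * ENNReal.ofReal (∏ i ∈ Finset.range k, eulerDensity A hT n i x)) *
          ENNReal.ofReal (eulerDensity A hT n k x) := by
      intro x
      rw [Finset.prod_range_succ, ENNReal.ofReal_mul
        (Finset.prod_nonneg fun i _ => (eulerDensity_pos A hT n i x).le), mul_assoc]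
    simp_rw [h1]
    rw [lintegral_eulerStep A hT hμ hk (H := fun x => H x * ENNReal.ofReal
      (∏ i ∈ Finset.range k, eulerDensity A hT n i x)) (hH.mul hq)]
    have h2 : ∀ x, ∏ i ∈ Finset.range k, eulerDensity A hT n i (eulerStep A hT n k x) =
        ∏ i ∈ Finset.range k, eulerDensity A hT n i x := fun x =>
      Finset.prod_congr rfl fun i hi =>
        eulerDensity_eulerStep A hT (Finset.mem_range.1 hi) x
    simp_rw [h2]
    exact ih (by omega) (hH.comp (continuous_eulerStep A hT n k).measurable)

/-- Squaring the density for A doubles the stochastic term, as does replacing A by 2A. The quadratic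
terms differ by (T/n)‖A x(t_i)‖² per cell, which on the ball of radius r sums to at most T(‖A‖r)².
As the density for 2A has integral 1, this is a second-moment bound on the ball, uniform in n. -/
lemma prod_eulerDensity_sq_le {n : ℕ} {r : ℝ} {x : PathSpace T d} (hx : ‖x‖ ≤ r) :
    (∏ i ∈ Finset.range n, eulerDensity A hT n i x) ^ 2 ≤
      (∏ i ∈ Finset.range n, eulerDensity ((2 : ℝ) • A) hT n i x) *
        Real.exp (T * (‖matrixCLM A‖ * r) ^ 2) := by
  rcases Nat.eq_zero_or_pos n with rfl | hn
  · simp only [Finset.range_zero, Finset.prod_empty, one_pow, one_mul]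
    exact Real.one_le_exp (by positivity)
  have hn' : (0 : ℝ) < n := by exact_mod_cast hn
  have h1 : Real.exp (T * (‖matrixCLM A‖ * r) ^ 2) =
      ∏ _i ∈ Finset.range n, Real.exp (T / n * (‖matrixCLM A‖ * r) ^ 2) := by
    rw [Finset.prod_const, Finset.card_range, ← Real.exp_nat_mul]
    congr 1
    field_simp
  rw [h1, ← Finset.prod_pow, ← Finset.prod_mul_distrib]
  refine Finset.prod_le_prod (fun i _ => sq_nonneg _) fun i _ => ?_
  simp only [eulerDensity, matrixCLM_smul]
  rw [← Real.exp_nat_mul, ← Real.exp_add]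
  refine Real.exp_le_exp.2 ?_
  set v := matrixCLM A (x (gridPt T hT n i)) with hv
  have h2 : ‖v‖ ≤ ‖matrixCLM A‖ * r :=
    ((matrixCLM A).le_opNorm _).trans (by gcongr; exact (x.norm_coe_le_norm _).trans hx)
  have h3 : ‖v‖ ^ 2 ≤ (‖matrixCLM A‖ * r) ^ 2 := by gcongr
  have h4 : T / n * ‖v‖ ^ 2 ≤ T / n * (‖matrixCLM A‖ * r) ^ 2 := by gcongr
  have h5 : ((2 : ℝ) • matrixCLM A) (x (gridPt T hT n i)) = (2 : ℝ) • v := rfl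
  rw [h5, real_inner_smul_left, norm_smul, mul_pow]
  norm_num
  linarith

/-- For a density q one has q ≤ M + q²/M. On the ball q² is at most c times the density for 2A,
whose total mass is 1, so the estimate is a quantitative uniform integrability that does not involve
n. -/
lemma measure_eulerIter_le (hμ : IsWienerMeasure μ) (n : ℕ) {r M : ℝ} (hM : 0 < M)
    {U : Set (PathSpace T d)} (hU : MeasurableSet U) (hUr : ∀ x ∈ U, ‖x‖ ≤ r) :
    μ (eulerIter A hT n n ⁻¹' U) ≤ ENNReal.ofReal M * μ U +
      ENNReal.ofReal (Real.exp (T * (‖matrixCLM A‖ * r) ^ 2) / M) := by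
  have := hμ.isProbabilityMeasure
  set c := Real.exp (T * (‖matrixCLM A‖ * r) ^ 2) with hc
  have h1 := lintegral_eulerIter A hT hμ (le_refl n) (H := U.indicator 1)
    (measurable_one.indicator hU)
  have h2 := lintegral_eulerIter ((2 : ℝ) • A) hT hμ (le_refl n) (H := fun _ => 1) measurable_const
  have h3 : ∫⁻ x, U.indicator 1 (eulerIter A hT n n x) ∂μ = μ (eulerIter A hT n n ⁻¹' U) := by
    rw [← lintegral_indicator_one (hU.preimage (continuous_eulerIter A hT n n).measurable)]
    rfl
  rw [← h3, ← h1]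
  have h4 : ∀ x, U.indicator 1 x *
      ENNReal.ofReal (∏ i ∈ Finset.range n, eulerDensity A hT n i x) ≤
      ENNReal.ofReal M * U.indicator 1 x + ENNReal.ofReal (c / M) *
        ENNReal.ofReal (∏ i ∈ Finset.range n, eulerDensity ((2 : ℝ) • A) hT n i x) := by
    intro x
    by_cases hx : x ∈ U
    · rw [Set.indicator_of_mem hx, Pi.one_apply, one_mul, mul_one,
        ← ENNReal.ofReal_mul (by positivity), ← ENNReal.ofReal_add hM.le (mul_nonneg (by positivity)
          (Finset.prod_nonneg fun i _ => (eulerDensity_pos _ hT n i x).le))]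
      refine ENNReal.ofReal_le_ofReal ?_
      have h5 := prod_eulerDensity_sq_le A hT (n := n) (hUr x hx)
      rw [← hc] at h5
      set q := ∏ i ∈ Finset.range n, eulerDensity A hT n i x
      set q2 := ∏ i ∈ Finset.range n, eulerDensity ((2 : ℝ) • A) hT n i x
      have h6 : q * M ≤ M ^ 2 + c * q2 := by nlinarith [sq_nonneg (q - M), sq_nonneg M, sq_nonneg q]
      rw [div_mul_eq_mul_div, ← sub_le_iff_le_add', le_div_iff₀ hM]
      linarith
    · rw [Set.indicator_of_notMem hx, zero_mul]
      exact zero_le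
  refine (lintegral_mono h4).trans_eq ?_
  rw [lintegral_add_left (by exact (measurable_one.indicator hU).const_mul _),
    lintegral_const_mul' _ _ ENNReal.ofReal_ne_top, lintegral_const_mul' _ _ ENNReal.ofReal_ne_top,
    lintegral_indicator_one hU]
  simp only [one_mul] at h2
  rw [h2]
  simp

/-! ### Convergence of the Euler schemes to the solution. -/

lemma eulerIter_apply_gridPt (n : ℕ) {i k : ℕ} (hik : i ≤ k) (x : PathSpace T d) :
    eulerIter A hT n k x (gridPt T hT n i) = eulerIter A hT n i x (gridPt T hT n i) := by
  induction k, hik using Nat.le_induction with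
  | base => rfl
  | succ k hik ih =>
    rw [← ih]
    exact eulerStep_apply_of_le A hT n k _ (gridPt_mono hT n hik)

lemma eulerIter_apply (n k : ℕ) (x : PathSpace T d) (u : Set.Icc (0 : ℝ) T) :
    eulerIter A hT n k x u = x u + ∑ i ∈ Finset.range k,
      gridTime hT n i u • matrixCLM A (eulerIter A hT n k x (gridPt T hT n i)) := by
  have h : eulerIter A hT n k x u = x u + ∑ i ∈ Finset.range k,
      gridTime hT n i u • matrixCLM A (eulerIter A hT n i x (gridPt T hT n i)) := by
    induction k with
    | zero => simp [eulerIter]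
    | succ k ih =>
      rw [Finset.sum_range_succ, ← add_assoc, ← ih]
      exact eulerStep_apply A hT n k _ u
  rw [h]
  congr 1
  refine Finset.sum_congr rfl fun i hi => ?_
  rw [eulerIter_apply_gridPt A hT n (Finset.mem_range.1 hi).le]

/-- Within one cell only the drift term of that cell varies: earlier terms are complete and later
ones have not started. -/
lemma norm_eulerIter_sub_le {n k : ℕ} (hk : k < n) (x : PathSpace T d) {u : Set.Icc (0 : ℝ) T}
    (hu1 : gridPt T hT n k ≤ u) (hu2 : u ≤ gridPt T hT n (k + 1)) :
    ‖eulerIter A hT n n x u - eulerIter A hT n n x (gridPt T hT n k)‖ ≤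
      ‖x u - x (gridPt T hT n k)‖ + T / n * (‖matrixCLM A‖ * ‖eulerIter A hT n n x‖) := by
  set y := eulerIter A hT n n x with hy
  have h1 := eulerIter_apply A hT n n x u
  have h2 := eulerIter_apply A hT n n x (gridPt T hT n k)
  rw [← hy] at h1 h2
  rw [h1, h2, add_sub_add_comm, ← Finset.sum_sub_distrib, Finset.sum_eq_single k]
  · refine (norm_add_le _ _).trans ?_
    rw [gridTime_of_le hT le_rfl, zero_smul, sub_zero, norm_smul,
      Real.norm_of_nonneg (gridTime_nonneg hT n k u)]
    have h4 : ‖matrixCLM A (y (gridPt T hT n k))‖ ≤ ‖matrixCLM A‖ * ‖y‖ :=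
      ((matrixCLM A).le_opNorm _).trans (by gcongr; exact y.norm_coe_le_norm _)
    gcongr
    · exact gridTime_le hT hk u
  · intro i hi hik
    rw [← sub_smul]
    rcases lt_or_gt_of_ne hik with h | h
    · have h5 := gridPt_mono hT n (show i + 1 ≤ k from h)
      have hin := Finset.mem_range.1 hi
      rw [gridTime_of_ge hT hin h5, gridTime_of_ge hT hin (h5.trans hu1), sub_self, zero_smul]
    · have h5 := gridPt_mono hT n (show k + 1 ≤ i from h)
      rw [gridTime_of_le hT (hu2.trans h5), gridTime_of_le hT (gridPt_mono hT n h.le), sub_self,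
        zero_smul]
  · intro h
    exact absurd (Finset.mem_range.2 hk) h

lemma sum_gridTime_smul (n : ℕ) (w : ℕ → EuclideanSpace ℝ (Fin d)) (u : Set.Icc (0 : ℝ) T) :
    ∑ i ∈ Finset.range n, gridTime hT n i u • w i = ∫ s in Set.Iic u, ∑ i ∈ Finset.range n,
      (Set.Ioc (gridPt T hT n i) (gridPt T hT n (i + 1))).indicator (fun _ => w i) s
        ∂timeMeasure T := by
  rw [integral_finsetSum _ fun i _ =>
    ((integrable_const (w i)).indicator measurableSet_Ioc).integrableOn]
  refine Finset.sum_congr rfl fun i _ => ?_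
  rw [setIntegral_indicator measurableSet_Ioc, setIntegral_const, Set.inter_comm]
  rfl

/-- The Euler path solves the integral equation with y(s) replaced under the integral by its value
at the left grid point, so its defect is controlled by the oscillation of y over a cell. -/
lemma norm_eulerIter_sub_volterra_le {n : ℕ} (hn : 0 < n) (x : PathSpace T d) {ε : ℝ}
    (hε : 0 ≤ ε) (hx : ∀ k < n, ∀ u, gridPt T hT n k ≤ u → u ≤ gridPt T hT n (k + 1) →
      ∀ v, gridPt T hT n k ≤ v → v ≤ gridPt T hT n (k + 1) → ‖x u - x v‖ < ε) :
    ‖eulerIter A hT n n x - volterra T A (eulerIter A hT n n x) - x‖ ≤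
      T * (‖matrixCLM A‖ * (ε + T / n * (‖matrixCLM A‖ * ‖eulerIter A hT n n x‖))) := by
  set y := eulerIter A hT n n x with hy
  set a := ‖matrixCLM A‖
  refine (ContinuousMap.norm_le _ (by positivity)).2 fun u => ?_
  have h1 := eulerIter_apply A hT n n x u
  rw [← hy, sum_gridTime_smul] at h1
  rw [ContinuousMap.sub_apply, ContinuousMap.sub_apply, volterra_apply]
  nth_rw 1 [h1]
  rw [sub_right_comm, add_sub_cancel_left, ← integral_sub]
  rotate_left
  · exact (integrable_finsetSum _ fun i _ =>
      (integrable_const _).indicator measurableSet_Ioc).integrableOn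
  · exact (by fun_prop : Continuous _).continuousOn.integrableOn_compact isClosed_Iic.isCompact
  have hvol : (timeMeasure T).real (Set.Iic u) ≤ T := by
    have h2 := setIntegral_Iic_timeMeasure u (fun _ => (1 : ℝ))
    rw [setIntegral_const, intervalIntegral.integral_const] at h2
    simp only [smul_eq_mul, mul_one, sub_zero] at h2
    rw [h2]
    exact u.2.2
  -- The half-open cells (t_k, t_{k+1}] miss only time 0, a null set.
  have h0 : ∀ᵐ s ∂(timeMeasure T).restrict (Set.Iic u), s ≠ gridPt T hT n 0 := by
    refine ae_restrict_of_ae ?_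
    rw [ae_iff]
    simpa using timeMeasure_singleton (gridPt T hT n 0)
  refine (norm_setIntegral_le_of_norm_le_const_ae (C := a * (ε + T / n * (a * ‖y‖)))
    (measure_lt_top _ _) ?_).trans ?_
  · filter_upwards [h0] with s hs
    obtain ⟨k, hk, hk1, hk2⟩ : ∃ k < n, gridPt T hT n k < s ∧ s ≤ gridPt T hT n (k + 1) := by
      obtain ⟨k, hk, hk1, hk2⟩ := exists_gridPt hT hn s
      rcases hk1.lt_or_eq with h | h
      · exact ⟨k, hk, h, hk2⟩
      · cases k with
        | zero => exact absurd h.symm hs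
        | succ k => exact ⟨k, by omega, h ▸ gridPt_lt hT (by omega), h.ge⟩
    have h2 : ∑ i ∈ Finset.range n, (Set.Ioc (gridPt T hT n i) (gridPt T hT n (i + 1))).indicator
        (fun _ => matrixCLM A (y (gridPt T hT n i))) s = matrixCLM A (y (gridPt T hT n k)) := by
      rw [Finset.sum_eq_single k, Set.indicator_of_mem (show s ∈ Set.Ioc _ _ from ⟨hk1, hk2⟩)]
      · intro i _ hik
        refine Set.indicator_of_notMem (fun hi => ?_) _
        have := grid_disjoint hT n hik
        exact (Set.ext_iff.1 this s).1 ⟨hi, hk1, hk2⟩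
      · intro h
        exact absurd (Finset.mem_range.2 hk) h
    rw [h2, ← map_sub]
    refine ((matrixCLM A).le_opNorm _).trans ?_
    rw [norm_sub_rev]
    gcongr
    refine (norm_eulerIter_sub_le A hT hk x hk1.le hk2).trans ?_
    gcongr
    exact (hx k hk s hk1.le hk2 _ le_rfl (gridPt_lt hT hk).le).le
  · rw [mul_comm T]
    gcongr


/-- Applying S to the approximate equation gives y = Sx + S(defect). The defect estimate contains
‖y‖ with a factor T/n, so for large n that term is absorbed and ‖y‖ stays bounded; then the defect
tends to 0. -/
lemma tendsto_eulerIter (x : PathSpace T d) :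
    Tendsto (fun n => eulerIter A hT n n x) atTop (𝓝 (solC T A x)) := by
  set a := ‖matrixCLM A‖ with ha
  set σ := ‖solC T A‖ with hσ
  have hΔ : Tendsto (fun n : ℕ => T / n) atTop (𝓝 0) := tendsto_const_div_atTop_nhds_zero_nat T
  have hsmall : ∀ᶠ n : ℕ in atTop, σ * (T * (a * (T / n * a))) ≤ 1 / 2 := by
    have h1 : Tendsto (fun n : ℕ => σ * (T * (a * (T / n * a)))) atTop (𝓝 0) := by
      simpa using (((hΔ.mul_const a).const_mul a).const_mul T).const_mul σ
    filter_upwards [h1.eventually (gt_mem_nhds (show (0 : ℝ) < 1 / 2 by norm_num))] with n hn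
      using hn.le
  have hy : ∀ n, eulerIter A hT n n x = solC T A x + solC T A
      (eulerIter A hT n n x - volterra T A (eulerIter A hT n n x) - x) := by
    intro n
    rw [← map_add, add_sub_cancel, solC_of_sub_volterra]
  -- With mesh oscillation below 1 the estimate reads ‖y‖ ≤ σ‖x‖ + σTa + ‖y‖/2; R comes from solving
  -- it for ‖y‖.
  set R := 2 * (σ * ‖x‖ + σ * (T * a)) with hR
  have hbound : ∀ᶠ n : ℕ in atTop, ‖eulerIter A hT n n x‖ ≤ R := by
    filter_upwards [exists_mesh hT x one_pos, hsmall, eventually_gt_atTop 0] with n hn hs hn0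
    have h1 := norm_eulerIter_sub_volterra_le A hT hn0 x zero_le_one hn
    have h2 : ‖eulerIter A hT n n x‖ ≤ σ * ‖x‖ + σ *
        (T * (a * (1 + T / n * (a * ‖eulerIter A hT n n x‖)))) := by
      nth_rw 1 [hy n]
      refine (norm_add_le _ _).trans (add_le_add ((solC T A).le_opNorm _)
        (((solC T A).le_opNorm _).trans ?_))
      gcongr
    have h3 : σ * (T * (a * (T / n * a))) * ‖eulerIter A hT n n x‖ ≤
        1 / 2 * ‖eulerIter A hT n n x‖ := by gcongr
    have h4 : σ * (T * (a * (1 + T / n * (a * ‖eulerIter A hT n n x‖)))) =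
        σ * (T * a) + σ * (T * (a * (T / n * a))) * ‖eulerIter A hT n n x‖ := by ring
    rw [hR]
    linarith
  rw [Metric.tendsto_atTop']
  intro ε hε
  set C := σ * (T * a) with hC
  have hC0 : 0 ≤ C := by positivity
  have h5 : Tendsto (fun n : ℕ => C * (T / n * (a * R))) atTop (𝓝 0) := by
    simpa using (hΔ.mul_const (a * R)).const_mul C
  obtain ⟨n₀, hn₀⟩ := eventually_atTop.1 ((exists_mesh hT x
    (show 0 < ε / (2 * (C + 1)) by positivity)).and (hbound.and
      ((h5.eventually (gt_mem_nhds (half_pos hε))).and (eventually_gt_atTop 0))))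
  refine ⟨n₀, fun n hn => ?_⟩
  obtain ⟨h1, h2, h3, hn0⟩ := hn₀ n hn.le
  rw [dist_eq_norm, hy n, add_sub_cancel_left]
  refine ((solC T A).le_opNorm _).trans_lt ?_
  have h6 := norm_eulerIter_sub_volterra_le A hT hn0 x (by positivity) h1
  calc σ * _ ≤ σ * (T * (a * (ε / (2 * (C + 1)) + T / n * (a * R)))) := by
        gcongr
        refine h6.trans ?_
        gcongr
    _ = C * (ε / (2 * (C + 1))) + C * (T / n * (a * R)) := by rw [hC]; ring
    _ < ε / 2 + ε / 2 := by
        have : C * (ε / (2 * (C + 1))) ≤ ε / 2 := by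
          rw [mul_div_assoc', div_le_div_iff₀ (by positivity) two_pos]
          nlinarith
        linarith
    _ = ε := add_halves ε

lemma measure_le_of_eventually_mem {α : Type*} [MeasurableSpace α] (ν : Measure α) {S : Set α}
    {E : ℕ → Set α} {C : ℝ≥0∞} (hE : ∀ n, ν (E n) ≤ C) (hS : ∀ x ∈ S, ∀ᶠ n in atTop, x ∈ E n) :
    ν S ≤ C := by
  have h1 : S ⊆ ⋃ n, ⋂ m ≥ n, E m := by
    intro x hx
    obtain ⟨n, hn⟩ := eventually_atTop.1 (hS x hx)
    exact Set.mem_iUnion.2 ⟨n, Set.mem_iInter₂.2 hn⟩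
  have h2 : Monotone fun n => ⋂ m ≥ n, E m := fun n n' hnn' =>
    Set.biInter_subset_biInter_left fun m hm => le_trans hnn' hm
  refine (measure_mono h1).trans ?_
  rw [h2.measure_iUnion]
  exact iSup_le fun n => (measure_mono (Set.biInter_subset_of_mem (le_refl n))).trans (hE n)

/-- The law of the solution of the linear equation driven by Brownian motion is absolutely
continuous with respect to Wiener measure. -/
lemma quasiMeasurePreserving_solC (hT : 0 < T) (hμ : IsWienerMeasure μ) :
    Measure.QuasiMeasurePreserving (solC T A) μ μ := by
  have := hμ.isProbabilityMeasure
  have hSm : Measurable (solC T A) := (solC T A).continuous.measurable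
  refine ⟨hSm, Measure.AbsolutelyContinuous.mk fun s hs hs0 => ?_⟩
  rw [Measure.map_apply hSm hs]
  -- The density estimate degrades with the radius, so the null set is first cut into bounded
  -- pieces.
  have hcov : solC T A ⁻¹' s ⊆ ⋃ r : ℕ, solC T A ⁻¹' (s ∩ Metric.ball 0 r) := by
    intro x hx
    obtain ⟨r, hr⟩ := exists_nat_gt ‖solC T A x‖
    exact Set.mem_iUnion.2 ⟨r, hx, by simpa using hr⟩
  refine measure_mono_null hcov (measure_iUnion_null fun r => ?_)
  set c := Real.exp (T * (‖matrixCLM A‖ * r) ^ 2) with hc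
  have h1 : ∀ M : ℝ, 0 < M → ∀ δ : ℝ≥0∞, 0 < δ →
      μ (solC T A ⁻¹' (s ∩ Metric.ball 0 r)) ≤ ENNReal.ofReal M * δ + ENNReal.ofReal (c / M) := by
    intro M hM δ hδ
    -- An open superset is needed: if Sx lies in it, so do the Euler paths from some n on.
    -- Afterwards δ is chosen small for fixed M, and finally M tends to infinity.
    obtain ⟨U, hsU, hU, hUδ⟩ := s.exists_isOpen_lt_of_lt δ (hs0.trans_lt hδ)
    have hUr : IsOpen (U ∩ Metric.ball 0 (r : ℝ)) := hU.inter Metric.isOpen_ball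
    refine measure_le_of_eventually_mem μ (E := fun n => eulerIter A hT n n ⁻¹'
      (U ∩ Metric.ball 0 (r : ℝ))) (fun n => ?_) fun x hx => ?_
    · refine (measure_eulerIter_le A hT hμ n hM hUr.measurableSet (r := r) ?_).trans ?_
      · intro x hx
        exact (mem_ball_zero_iff.1 hx.2).le
      · gcongr
        exact (measure_mono Set.inter_subset_left).trans hUδ.le
    · exact (tendsto_eulerIter A hT x).eventually
        (hUr.mem_nhds ⟨hsU hx.1, hx.2⟩)
  have h2 : ∀ M : ℝ, 0 < M →
      μ (solC T A ⁻¹' (s ∩ Metric.ball 0 r)) ≤ ENNReal.ofReal (c / M) := by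
    intro M hM
    refine ENNReal.le_of_forall_pos_le_add fun ε hε _ => ?_
    have hM' : ENNReal.ofReal M ≠ 0 := (ENNReal.ofReal_pos.2 hM).ne'
    refine (h1 M hM (ε / ENNReal.ofReal M) (ENNReal.div_pos (by exact_mod_cast hε.ne')
      ENNReal.ofReal_ne_top)).trans ?_
    rw [ENNReal.mul_div_cancel hM' ENNReal.ofReal_ne_top, add_comm]
  refine le_antisymm (ge_of_tendsto (x := atTop) (f := fun M : ℝ => ENNReal.ofReal (c / M)) ?_ ?_)
    zero_le
  · rw [← ENNReal.ofReal_zero]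
    exact ENNReal.tendsto_ofReal (tendsto_const_nhds.div_atTop tendsto_id)
  · filter_upwards [eventually_gt_atTop 0] with M hM using h2 M hM

end

noncomputable section

/-! ### Hilbert--Schmidt bounds -/

variable {T : ℝ} {d : ℕ} {μ : Measure (PathSpace T d)}

lemma inner_coe_cmTmul (w : CMSpace T d ⊗[ℝ] CMSpace T d) (h k : CMSpace T d) :
    ⟪(w : CMTensor T d), cmTmul h k⟫_ℝ = ⟪w, h ⊗ₜ[ℝ] k⟫_ℝ :=
  UniformSpace.Completion.inner_coe _ _

lemma inner_cmTmul_cmTmul (h k h' k' : CMSpace T d) :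
    ⟪cmTmul h k, cmTmul h' k'⟫_ℝ = ⟪h, h'⟫_ℝ * ⟪k, k'⟫_ℝ := by
  rw [cmTmul, inner_coe_cmTmul, TensorProduct.inner_tmul]

/-- Every algebraic tensor is a finite combination of orthonormal tensors. -/
lemma exists_orthonormal_expansion {E : Type*} [NormedAddCommGroup E] [InnerProductSpace ℝ E]
    (w : E ⊗[ℝ] E) : ∃ (m n : ℕ) (e : Fin m → E) (f : Fin n → E) (c : Fin m → Fin n → ℝ),
      Orthonormal ℝ e ∧ Orthonormal ℝ f ∧ w = ∑ i, ∑ j, c i j • e i ⊗ₜ[ℝ] f j ∧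
      ∑ i, ∑ j, c i j ^ 2 = ‖w‖ ^ 2 := by
  obtain ⟨E', F', iE', iF', hz⟩ :=
    TensorProduct.exists_finite_submodule_of_setFinite {w} (Set.finite_singleton w)
  obtain ⟨y, rfl⟩ := Set.singleton_subset_iff.mp hz
  let e := stdOrthonormalBasis ℝ E'
  let f := stdOrthonormalBasis ℝ F'
  let b := e.tensorProduct f
  refine ⟨_, _, fun i => (e i : E), fun j => (f j : E), fun i j => b.repr y (i, j),
    e.orthonormal.comp_linearIsometry E'.subtypeₗᵢ,
    f.orthonormal.comp_linearIsometry F'.subtypeₗᵢ, ?_, ?_⟩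
  · conv_lhs => rw [← b.sum_repr y]
    rw [map_sum, Fintype.sum_prod_type]
    refine Finset.sum_congr rfl fun i _ => Finset.sum_congr rfl fun j _ => ?_
    rw [map_smul, OrthonormalBasis.tensorProduct_apply]
    rfl
  · have h1 : ‖TensorProduct.mapIncl E' F' y‖ ^ 2 = ‖y‖ ^ 2 := by
      have h2 := TensorProduct.inner_mapIncl_mapIncl E' F' y y
      exact (real_inner_self_eq_norm_sq _).symm.trans (h2.trans (real_inner_self_eq_norm_sq y))
    rw [h1, ← b.repr.norm_map y, EuclideanSpace.norm_sq_eq, Fintype.sum_prod_type]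
    simp

/-- Bessel's inequality for each of the d vectors Q* applied to a basis vector of ℝ^d, which has
norm at most ‖Q‖. -/
lemma sum_norm_sq_apply_le {E : Type*} [NormedAddCommGroup E] [InnerProductSpace ℝ E]
    [CompleteSpace E] {m : ℕ} {e : Fin m → E} (he : Orthonormal ℝ e)
    (Q : E →L[ℝ] EuclideanSpace ℝ (Fin d)) : ∑ i, ‖Q (e i)‖ ^ 2 ≤ d * ‖Q‖ ^ 2 := by
  have h1 : ∀ i, ‖Q (e i)‖ ^ 2 =
      ∑ j, ⟪e i, Q.adjoint (EuclideanSpace.single j (1 : ℝ))⟫_ℝ ^ 2 := by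
    intro i
    rw [EuclideanSpace.norm_sq_eq]
    refine Finset.sum_congr rfl fun j _ => ?_
    rw [ContinuousLinearMap.adjoint_inner_right, EuclideanSpace.inner_single_right]
    simp
  simp_rw [h1]
  rw [Finset.sum_comm]
  have h2 : ∀ j ∈ Finset.univ, ∑ i, ⟪e i, Q.adjoint (EuclideanSpace.single j (1 : ℝ))⟫_ℝ ^ 2 ≤
      ‖Q‖ ^ 2 := by
    intro j _
    have h3 := he.sum_inner_products_le (s := Finset.univ)
      (Q.adjoint (EuclideanSpace.single j (1 : ℝ)))
    simp only [Real.norm_eq_abs, sq_abs] at h3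
    refine h3.trans ?_
    gcongr
    refine (Q.adjoint.le_opNorm _).trans ?_
    simp
  refine (Finset.sum_le_card_nsmul _ _ _ h2).trans ?_
  simp

lemma norm_pathToL2_sq (f : PathSpace T d) :
    ‖pathToL2 T d f‖ ^ 2 = ∫ t, ‖f t‖ ^ 2 ∂timeMeasure T := by
  rw [← real_inner_self_eq_norm_sq, L2.inner_def]
  refine integral_congr_ae ?_
  filter_upwards [ContinuousMap.coeFn_toLp (p := 2) (𝕜 := ℝ) (timeMeasure T) f] with t ht
  rw [← real_inner_self_eq_norm_sq]
  exact congrArg₂ _ ht ht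

/-- The Hilbert--Schmidt constant of the embedding `H_T → L²`. -/
def hsConst (T : ℝ) (d : ℕ) : ℝ := (timeMeasure T).real Set.univ * (d * ‖cmEmbed T d‖ ^ 2)

lemma hsConst_nonneg (T : ℝ) (d : ℕ) : 0 ≤ hsConst T d := by unfold hsConst; positivity

/-- Evaluation at a fixed time is a bounded operator from H_T to ℝ^d, hence Hilbert–Schmidt with a
bound uniform in t; integrating over t shows that the inclusion of H_T in L² is Hilbert–Schmidt. -/
lemma sum_norm_cmToL2_sq_le {m : ℕ} {e : Fin m → CMSpace T d} (he : Orthonormal ℝ e)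
    (R : CMSpace T d →L[ℝ] CMSpace T d) :
    ∑ i, ‖cmToL2 T d (R (e i))‖ ^ 2 ≤ hsConst T d * ‖R‖ ^ 2 := by
  simp_rw [cmToL2_eq, norm_pathToL2_sq]
  rw [← integral_finsetSum _ fun i _ => by
    exact (by fun_prop : Continuous _).integrable_of_hasCompactSupport
      (HasCompactSupport.of_compactSpace _)]
  have h1 : ∀ t : Set.Icc (0 : ℝ) T, ∑ i, ‖cmEmbed T d (R (e i)) t‖ ^ 2 ≤
      d * ‖cmEmbed T d‖ ^ 2 * ‖R‖ ^ 2 := by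
    intro t
    let Q : CMSpace T d →L[ℝ] EuclideanSpace ℝ (Fin d) :=
      ContinuousMap.evalCLM ℝ t ∘L cmEmbed T d ∘L R
    have h2 : ‖Q‖ ≤ ‖cmEmbed T d‖ * ‖R‖ := by
      refine ContinuousLinearMap.opNorm_le_bound _ (by positivity) fun h => ?_
      refine (ContinuousMap.norm_coe_le_norm _ t).trans
        (((cmEmbed T d).le_opNorm _).trans ?_)
      rw [mul_assoc]
      gcongr
      exact R.le_opNorm h
    refine (sum_norm_sq_apply_le he Q).trans ?_
    rw [mul_assoc, ← mul_pow]
    gcongr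
  refine (integral_mono_of_nonneg (Eventually.of_forall fun t => by positivity)
    (integrable_const _) (Eventually.of_forall h1)).trans_eq ?_
  rw [integral_const, smul_eq_mul, hsConst]
  ring

/-- A tensor that is bounded as a form on `L²` is bounded in Hilbert--Schmidt norm. -/
lemma norm_cmTensor_le (G : CMTensor T d) (R : CMSpace T d →L[ℝ] CMSpace T d) {M : ℝ} (hM : 0 ≤ M)
    (hG : ∀ h k, |⟪G, cmTmul h k⟫_ℝ| ≤ M * ‖cmToL2 T d (R h)‖ * ‖cmToL2 T d (R k)‖) :
    ‖G‖ ≤ M * (hsConst T d * ‖R‖ ^ 2) := by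
  set K := hsConst T d * ‖R‖ ^ 2 with hK
  have hK0 : 0 ≤ K := mul_nonneg (hsConst_nonneg T d) (sq_nonneg _)
  -- Expand w in orthonormal tensors and apply Cauchy–Schwarz; the sum over both indices factors
  -- into two Hilbert–Schmidt sums, each at most K.
  have h1 : ∀ w : CMSpace T d ⊗[ℝ] CMSpace T d, |⟪G, (w : CMTensor T d)⟫_ℝ| ≤ M * K * ‖w‖ := by
    intro w
    obtain ⟨m, n, e, f, c, he, hf, hw, hc⟩ := exists_orthonormal_expansion w
    have h2 : ⟪G, (w : CMTensor T d)⟫_ℝ = ∑ p : Fin m × Fin n, c p.1 p.2 *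
        ⟪G, cmTmul (e p.1) (f p.2)⟫_ℝ := by
      have h3 : (w : CMTensor T d) = ∑ i, ∑ j, c i j • cmTmul (e i) (f j) := by
        conv_lhs => rw [hw]
        change UniformSpace.Completion.toComplL (𝕜 := ℝ) _ = _
        simp only [map_sum, map_smul]
        rfl
      rw [h3, inner_sum, Fintype.sum_prod_type]
      simp_rw [inner_sum, real_inner_smul_right]
    have h4 : (⟪G, (w : CMTensor T d)⟫_ℝ) ^ 2 ≤ (‖w‖ ^ 2) * (M * K) ^ 2 := by
      rw [h2]
      refine (Finset.sum_mul_sq_le_sq_mul_sq _ _ _).trans ?_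
      have h5 : ∑ p : Fin m × Fin n, c p.1 p.2 ^ 2 = ‖w‖ ^ 2 := by
        rw [Fintype.sum_prod_type, hc]
      rw [h5]
      refine mul_le_mul_of_nonneg_left ?_ (sq_nonneg _)
      have h6 : ∀ p : Fin m × Fin n, ⟪G, cmTmul (e p.1) (f p.2)⟫_ℝ ^ 2 ≤
          M ^ 2 * (‖cmToL2 T d (R (e p.1))‖ ^ 2 * ‖cmToL2 T d (R (f p.2))‖ ^ 2) := by
        intro p
        rw [← sq_abs, ← mul_pow, ← mul_pow, ← mul_assoc]
        gcongr
        exact hG _ _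
      refine (Finset.sum_le_sum fun p _ => h6 p).trans ?_
      rw [← Finset.mul_sum, Fintype.sum_prod_type]
      dsimp only
      rw [← Finset.sum_mul_sum, mul_pow, sq K]
      gcongr
      · exact sum_norm_cmToL2_sq_le he R
      · exact sum_norm_cmToL2_sq_le hf R
    have h7 := Real.sqrt_le_sqrt h4
    rw [Real.sqrt_sq_eq_abs, ← mul_pow, Real.sqrt_sq (by positivity), mul_comm] at h7
    exact h7
  have h2 : ∀ W : CMTensor T d, |⟪G, W⟫_ℝ| ≤ M * K * ‖W‖ := by
    intro W
    induction W using UniformSpace.Completion.induction_on with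
    | hp => exact isClosed_le (by fun_prop) (by fun_prop)
    | ih w => simpa using h1 w
  -- Testing the functional with G itself turns the dual bound into a norm bound.
  have h3 := h2 G
  rw [real_inner_self_eq_norm_sq, abs_of_nonneg (sq_nonneg _), sq] at h3
  by_contra! hlt
  have : 0 < ‖G‖ := lt_of_le_of_lt (by positivity) hlt
  nlinarith

/-- `R ⊗ R` on the Hilbert tensor product. -/
def tensorMap (R : CMSpace T d →L[ℝ] CMSpace T d) : CMTensor T d →L[ℝ] CMTensor T d :=
  (TensorProduct.mapL R R).completion

lemma tensorMap_cmTmul (R : CMSpace T d →L[ℝ] CMSpace T d) (h k : CMSpace T d) :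
    tensorMap R (cmTmul h k) = cmTmul (R h) (R k) := by
  rw [tensorMap, cmTmul, ContinuousLinearMap.completion_apply_coe]
  rfl

lemma dense_cmTmul {p : CMTensor T d → Prop} (hp : IsClosed {W | p W})
    (hadd : ∀ W W', p W → p W' → p (W + W')) (htmul : ∀ h k, p (cmTmul h k)) (h0 : p 0)
    (W : CMTensor T d) : p W := by
  induction W using UniformSpace.Completion.induction_on with
  | hp => exact hp
  | ih w =>
    induction w using TensorProduct.induction_on with
    | zero => exact (UniformSpace.Completion.coe_zero (α := CMSpace T d ⊗[ℝ] CMSpace T d)).symm ▸ h0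
    | tmul h k => exact htmul h k
    | add w w' hw hw' => exact (UniformSpace.Completion.coe_add w w').symm ▸ hadd _ _ hw hw'

lemma inner_tensorMap (R : CMSpace T d →L[ℝ] CMSpace T d) (G : CMTensor T d) (h k : CMSpace T d) :
    ⟪tensorMap R G, cmTmul h k⟫_ℝ = ⟪G, cmTmul (R.adjoint h) (R.adjoint k)⟫_ℝ := by
  refine dense_cmTmul (p := fun G => ⟪tensorMap R G, cmTmul h k⟫_ℝ =
    ⟪G, cmTmul (R.adjoint h) (R.adjoint k)⟫_ℝ) (isClosed_eq (by fun_prop) (by fun_prop)) ?_ ?_ ?_ G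
  · intro W W' h1 h2
    rw [map_add, inner_add_left, inner_add_left, h1, h2]
  · intro h' k'
    rw [tensorMap_cmTmul, inner_cmTmul_cmTmul, inner_cmTmul_cmTmul,
      ContinuousLinearMap.adjoint_inner_right, ContinuousLinearMap.adjoint_inner_right]
  · simp

lemma norm_tensorMap_le (R : CMSpace T d →L[ℝ] CMSpace T d) (W : CMTensor T d) :
    ‖tensorMap R W‖ ≤ ‖R‖ ^ 2 * ‖W‖ := by
  induction W using UniformSpace.Completion.induction_on with
  | hp => exact isClosed_le (by fun_prop) (by fun_prop)
  | ih w =>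
    rw [tensorMap, ContinuousLinearMap.completion_apply_coe, UniformSpace.Completion.norm_coe,
      UniformSpace.Completion.norm_coe, sq]
    refine ((TensorProduct.mapL R R).le_opNorm w).trans ?_
    gcongr
    exact TensorProduct.norm_mapL_le R R

end

noncomputable section

/-! ### Closure properties of the Sobolev space -/

lemma tendsto_eLpNorm_two_of_dominated {α E : Type*} [MeasurableSpace α] [NormedAddCommGroup E]
    {ν : Measure α} {f : ℕ → α → E} {g : α → E} {r : α → ℝ}
    (hf : ∀ n, AEStronglyMeasurable (f n) ν) (hr : MemLp r 2 ν)
    (hb : ∀ n, ∀ᵐ x ∂ν, ‖f n x‖ ≤ r x)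
    (hlim : ∀ᵐ x ∂ν, Tendsto (fun n => f n x) atTop (𝓝 (g x))) :
    MemLp g 2 ν ∧ Tendsto (fun n => eLpNorm (fun x => f n x - g x) 2 ν) atTop (𝓝 0) := by
  have hg : AEStronglyMeasurable g ν := aestronglyMeasurable_of_tendsto_ae atTop hf hlim
  have hgb : ∀ᵐ x ∂ν, ‖g x‖ ≤ r x := by
    filter_upwards [hlim, ae_all_iff.2 hb] with x h1 h2
    exact le_of_tendsto h1.norm (Eventually.of_forall h2)
  refine ⟨hr.mono' hg hgb, ?_⟩
  have h2r : MemLp (fun x => 2 * r x) 2 ν := hr.const_mul 2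
  have key : Tendsto (fun n => ∫⁻ x, ‖f n x - g x‖ₑ ^ (2 : ℝ) ∂ν) atTop
      (𝓝 (∫⁻ _, 0 ∂ν)) := by
    refine tendsto_lintegral_of_dominated_convergence' (fun x => ‖2 * r x‖ₑ ^ (2 : ℝ)) ?_ ?_ ?_ ?_
    · intro n
      exact ((hf n).sub hg).enorm.pow_const _
    · intro n
      filter_upwards [hb n, hgb] with x h1 h2
      gcongr
      rw [← ofReal_norm, ← ofReal_norm]
      refine ENNReal.ofReal_le_ofReal ((norm_sub_le _ _).trans ?_)
      rw [Real.norm_eq_abs]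
      exact le_trans (by linarith) (le_abs_self _)
    · have := (eLpNorm_lt_top_iff_lintegral_rpow_enorm_lt_top (by norm_num) (by norm_num)).1
        h2r.eLpNorm_lt_top
      simpa using this.ne
    · filter_upwards [hlim] with x hx
      have h3 : Tendsto (fun n => ‖f n x - g x‖ₑ) atTop (𝓝 0) := by
        simpa using (tendsto_sub_nhds_zero_iff.2 hx).enorm
      simpa using h3.ennrpow_const 2
  rw [lintegral_zero] at key
  have h4 := key.ennrpow_const (1 / 2)
  simp only [one_div, ENNReal.zero_rpow_of_pos (by norm_num : (0 : ℝ) < 2⁻¹)] at h4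
  refine h4.congr fun n => ?_
  rw [eLpNorm_eq_lintegral_rpow_enorm_toReal (by norm_num) (by norm_num)]
  simp

variable {T : ℝ} {d : ℕ} {μ : Measure (PathSpace T d)}

/-- `ℓ ↦ ∑ᵢ ℓ(eᵢ) hᵢ`. -/
def gradCLM {k : ℕ} (h : Fin k → CMSpace T d) : ((Fin k → ℝ) →L[ℝ] ℝ) →L[ℝ] CMSpace T d :=
  ∑ i, (ContinuousLinearMap.apply ℝ ℝ (Pi.single i (1 : ℝ))).smulRight (h i)

/-- `b ↦ ∑ᵢⱼ b(eⱼ, eᵢ) hᵢ ⊗ hⱼ`. -/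
def grad₂CLM {k : ℕ} (h : Fin k → CMSpace T d) :
    ((Fin k → ℝ) →L[ℝ] (Fin k → ℝ) →L[ℝ] ℝ) →L[ℝ] CMTensor T d :=
  ∑ i, ∑ j, (ContinuousLinearMap.apply ℝ ℝ (Pi.single i (1 : ℝ)) ∘L
    ContinuousLinearMap.apply ℝ ((Fin k → ℝ) →L[ℝ] ℝ) (Pi.single j (1 : ℝ))).smulRight
      (cmTmul (h i) (h j))

lemma gradCLM_apply {k : ℕ} (h : Fin k → CMSpace T d) (l : (Fin k → ℝ) →L[ℝ] ℝ) :
    gradCLM h l = ∑ i, l (Pi.single i 1) • h i := by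
  simp [gradCLM]

lemma grad₂CLM_apply {k : ℕ} (h : Fin k → CMSpace T d)
    (b : (Fin k → ℝ) →L[ℝ] (Fin k → ℝ) →L[ℝ] ℝ) :
    grad₂CLM h b = ∑ i, ∑ j, b (Pi.single j 1) (Pi.single i 1) • cmTmul (h i) (h j) := by
  simp [grad₂CLM]

lemma exists_norm_grad₂CLM_le {k : ℕ} (h : Fin k → CMSpace T d) :
    ∃ C, 0 ≤ C ∧ ∀ b, ‖grad₂CLM h b‖ ≤ C * ‖b‖ := by
  refine ⟨∑ i, ∑ j, ‖(Pi.single j 1 : Fin k → ℝ)‖ * ‖(Pi.single i 1 : Fin k → ℝ)‖ *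
    ‖cmTmul (h i) (h j)‖, by positivity, fun b => ?_⟩
  rw [grad₂CLM_apply, Finset.sum_mul]
  refine (norm_sum_le _ _).trans (Finset.sum_le_sum fun i _ => ?_)
  rw [Finset.sum_mul]
  refine (norm_sum_le _ _).trans (Finset.sum_le_sum fun j _ => ?_)
  rw [norm_smul]
  calc _ ≤ ‖b‖ * ‖(Pi.single j 1 : Fin k → ℝ)‖ * ‖(Pi.single i 1 : Fin k → ℝ)‖ *
        ‖cmTmul (h i) (h j)‖ := by
        gcongr
        exact b.le_opNorm₂ _ _
    _ = _ := by ring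

lemma Cylindrical.grad_eq (Φ : Cylindrical μ) (y : PathSpace T d) :
    Φ.grad y = gradCLM Φ.h (fderiv ℝ (fun w => Φ.f w) (Φ.vec y)) := by
  rw [gradCLM_apply]; rfl

lemma Cylindrical.grad₂_eq (Φ : Cylindrical μ) (y : PathSpace T d) :
    Φ.grad₂ y = grad₂CLM Φ.h (fderiv ℝ (fderiv ℝ (fun w => Φ.f w)) (Φ.vec y)) := by
  rw [grad₂CLM_apply, Cylindrical.grad₂]
  refine Finset.sum_congr rfl fun i _ => Finset.sum_congr rfl fun j _ => ?_
  congr 1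
  have h1 : DifferentiableAt ℝ (fderiv ℝ (fun w => Φ.f w)) (Φ.vec y) := by
    have := (Φ.f.smooth 2).fderiv_right (m := 1) (by norm_num)
    exact (this.differentiable (by norm_num)) _
  unfold Cylindrical.partialDeriv₂ Cylindrical.partialDeriv
  rw [fderiv_clm_apply h1 (differentiableAt_const _)]
  simp

lemma aestronglyMeasurable_vec {k : ℕ} {δ : Fin k → PathSpace T d → ℝ}
    (hδ : ∀ i, AEStronglyMeasurable (δ i) μ) :
    AEStronglyMeasurable (fun x i => δ i x) μ :=
  (aemeasurable_pi_lambda _ fun i => (hδ i).aemeasurable).aestronglyMeasurable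

namespace Cylindrical

lemma aestronglyMeasurable_vec (Φ : Cylindrical μ) : AEStronglyMeasurable Φ.vec μ :=
  _root_.aestronglyMeasurable_vec fun i => (Φ.isWienerIntegral i).1.1

lemma continuous_fderiv (Φ : Cylindrical μ) : Continuous (fderiv ℝ (fun w => Φ.f w)) :=
  (Φ.f.smooth 1).continuous_fderiv (by norm_num)

lemma continuous_fderiv_fderiv (Φ : Cylindrical μ) :
    Continuous (fderiv ℝ (fderiv ℝ (fun w => Φ.f w))) :=
  ((Φ.f.smooth 2).fderiv_right (m := 1) (by norm_num)).continuous_fderiv (by norm_num)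

lemma aestronglyMeasurable_toFun (Φ : Cylindrical μ) : AEStronglyMeasurable Φ.toFun μ :=
  Φ.f.continuous.comp_aestronglyMeasurable Φ.aestronglyMeasurable_vec

lemma aestronglyMeasurable_grad (Φ : Cylindrical μ) : AEStronglyMeasurable Φ.grad μ := by
  rw [funext Φ.grad_eq]
  exact ((gradCLM Φ.h).continuous.comp Φ.continuous_fderiv).comp_aestronglyMeasurable
    Φ.aestronglyMeasurable_vec

lemma aestronglyMeasurable_grad₂ (Φ : Cylindrical μ) : AEStronglyMeasurable Φ.grad₂ μ := by
  rw [funext Φ.grad₂_eq]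
  exact ((grad₂CLM Φ.h).continuous.comp Φ.continuous_fderiv_fderiv).comp_aestronglyMeasurable
    Φ.aestronglyMeasurable_vec

end Cylindrical

lemma eLpNorm_sub_le_add {α E : Type*} [MeasurableSpace α] [NormedAddCommGroup E]
    {ν : Measure α} {f g h : α → E} (hf : AEStronglyMeasurable f ν)
    (hg : AEStronglyMeasurable g ν) (hh : AEStronglyMeasurable h ν) {ε : ℝ≥0∞}
    (h1 : eLpNorm (fun x => f x - g x) 2 ν ≤ ε / 2)
    (h2 : eLpNorm (fun x => g x - h x) 2 ν ≤ ε / 2) :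
    eLpNorm (fun x => f x - h x) 2 ν ≤ ε := by
  have h3 : (fun x => f x - h x) = (fun x => f x - g x) + fun x => g x - h x := by
    ext x; simp
  rw [h3]
  refine (eLpNorm_add_le (hf.sub hg) (hg.sub hh) (by norm_num)).trans ?_
  exact (add_le_add h1 h2).trans (ENNReal.add_halves ε).le

lemma HasGrossSobolevGradients.of_approx {F : PathSpace T d → ℝ} {G₁ : PathSpace T d → CMSpace T d}
    {G₂ : PathSpace T d → CMTensor T d} (hF : MemLp F 2 μ) (h₁ : MemLp G₁ 2 μ) (h₂ : MemLp G₂ 2 μ)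
    (h : ∀ ε : ℝ≥0∞, 0 < ε → ∃ Φ : Cylindrical μ, eLpNorm (fun x => Φ.toFun x - F x) 2 μ ≤ ε ∧
      eLpNorm (fun x => Φ.grad x - G₁ x) 2 μ ≤ ε ∧ eLpNorm (fun x => Φ.grad₂ x - G₂ x) 2 μ ≤ ε) :
    HasGrossSobolevGradients μ F G₁ G₂ := by
  have hε : ∀ n : ℕ, (0 : ℝ≥0∞) < ((n : ℝ≥0∞) + 1)⁻¹ := fun n => by
    rw [ENNReal.inv_pos]; exact ENNReal.add_ne_top.2 ⟨ENNReal.natCast_ne_top n, ENNReal.one_ne_top⟩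
  choose Φ h1 h2 h3 using fun n : ℕ => h _ (hε n)
  have hlim : Tendsto (fun n : ℕ => ((n : ℝ≥0∞) + 1)⁻¹) atTop (𝓝 0) := by
    have := (tendsto_add_atTop_iff_nat 1).2 ENNReal.tendsto_inv_nat_nhds_zero
    simpa using this
  refine ⟨hF, h₁, h₂, Φ, ?_, ?_, ?_⟩
  · exact tendsto_of_tendsto_of_tendsto_of_le_of_le tendsto_const_nhds hlim (fun _ => zero_le) h1
  · exact tendsto_of_tendsto_of_tendsto_of_le_of_le tendsto_const_nhds hlim (fun _ => zero_le) h2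
  · exact tendsto_of_tendsto_of_tendsto_of_le_of_le tendsto_const_nhds hlim (fun _ => zero_le) h3

lemma HasGrossSobolevGradients.exists_approx {F : PathSpace T d → ℝ}
    {G₁ : PathSpace T d → CMSpace T d} {G₂ : PathSpace T d → CMTensor T d}
    (h : HasGrossSobolevGradients μ F G₁ G₂) {ε : ℝ≥0∞} (hε : 0 < ε) :
    ∃ Φ : Cylindrical μ, eLpNorm (fun x => Φ.toFun x - F x) 2 μ ≤ ε ∧
      eLpNorm (fun x => Φ.grad x - G₁ x) 2 μ ≤ ε ∧ eLpNorm (fun x => Φ.grad₂ x - G₂ x) 2 μ ≤ ε := by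
  obtain ⟨-, -, -, Φ, h1, h2, h3⟩ := h
  obtain ⟨n, h1, h2, h3⟩ := ((h1.eventually (ge_mem_nhds hε)).and
    ((h2.eventually (ge_mem_nhds hε)).and (h3.eventually (ge_mem_nhds hε)))).exists
  exact ⟨Φ n, h1, h2, h3⟩

/-- The graph of the gradients is closed. -/
lemma HasGrossSobolevGradients.of_tendsto {F : PathSpace T d → ℝ}
    {G₁ : PathSpace T d → CMSpace T d} {G₂ : PathSpace T d → CMTensor T d}
    {F' : ℕ → PathSpace T d → ℝ} {G₁' : ℕ → PathSpace T d → CMSpace T d}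
    {G₂' : ℕ → PathSpace T d → CMTensor T d} (h : ∀ n, HasGrossSobolevGradients μ (F' n) (G₁' n) (G₂' n))
    (hF : MemLp F 2 μ) (h₁ : MemLp G₁ 2 μ) (h₂ : MemLp G₂ 2 μ)
    (hF' : Tendsto (fun n => eLpNorm (fun x => F' n x - F x) 2 μ) atTop (𝓝 0))
    (h₁' : Tendsto (fun n => eLpNorm (fun x => G₁' n x - G₁ x) 2 μ) atTop (𝓝 0))
    (h₂' : Tendsto (fun n => eLpNorm (fun x => G₂' n x - G₂ x) 2 μ) atTop (𝓝 0)) :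
    HasGrossSobolevGradients μ F G₁ G₂ := by
  refine .of_approx hF h₁ h₂ fun ε hε => ?_
  have hε2 : 0 < ε / 2 := ENNReal.half_pos hε.ne'
  obtain ⟨n, e1, e2, e3⟩ := ((hF'.eventually (ge_mem_nhds hε2)).and
    ((h₁'.eventually (ge_mem_nhds hε2)).and (h₂'.eventually (ge_mem_nhds hε2)))).exists
  obtain ⟨Φ, c1, c2, c3⟩ := (h n).exists_approx hε2
  exact ⟨Φ, eLpNorm_sub_le_add Φ.aestronglyMeasurable_toFun (h n).1.1 hF.1 c1 e1,
    eLpNorm_sub_le_add Φ.aestronglyMeasurable_grad (h n).2.1.1 h₁.1 c2 e2,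
    eLpNorm_sub_le_add Φ.aestronglyMeasurable_grad₂ (h n).2.2.1.1 h₂.1 c3 e3⟩

open scoped Convolution in
-- Differentiation commutes with mollification, and the derivative of g is uniformly continuous by
-- compact support. Values in a general V allow the lemma to be applied to g and then to its
-- derivative.
lemma exists_forall_convolution_fderiv {N : ℕ} {V : Type*} [NormedAddCommGroup V] [NormedSpace ℝ V]
    [CompleteSpace V] {g : (Fin N → ℝ) → V} (hg : ContDiff ℝ 1 g) (hc : HasCompactSupport g)
    {ε : ℝ} (hε : 0 < ε) :
    ∃ r > 0, ∀ φ : ContDiffBump (0 : Fin N → ℝ), φ.rOut ≤ r → ∀ v, ∃ L : (Fin N → ℝ) →L[ℝ] V,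
      HasFDerivAt (φ.normed volume ⋆[ContinuousLinearMap.lsmul ℝ ℝ, volume] g) L v ∧
      ‖L - fderiv ℝ g v‖ ≤ ε := by
  have hc1 : HasCompactSupport (fderiv ℝ g) := hc.fderiv ℝ
  have hg1 : Continuous (fderiv ℝ g) := hg.continuous_fderiv (by norm_num)
  obtain ⟨r, hr, u⟩ := Metric.uniformContinuous_iff.1
    (hc1.uniformContinuous_of_continuous hg1) ε hε
  refine ⟨r, hr, fun φ hφr v => ⟨_, hc.hasFDerivAt_convolution_right
    (ContinuousLinearMap.lsmul ℝ ℝ) φ.continuous_normed.locallyIntegrable hg v, ?_⟩⟩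
  change ‖(φ.normed volume ⋆[ContinuousLinearMap.lsmul ℝ ℝ, volume] fderiv ℝ g) v - _‖ ≤ ε
  rw [← dist_eq_norm]
  exact φ.dist_normed_convolution_le hg1.aestronglyMeasurable fun x hx =>
    (u (lt_of_lt_of_le (Metric.mem_ball.1 hx) hφr)).le

open scoped Convolution ContDiff in
/-- Compactly supported `C²` functions are uniform limits, with two derivatives, of test
functions. -/
lemma exists_contDiff_approx {N : ℕ} {g : (Fin N → ℝ) → ℝ} (hg : ContDiff ℝ 2 g)
    (hc : HasCompactSupport g) {ε : ℝ} (hε : 0 < ε) :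
    ∃ f : (Fin N → ℝ) → ℝ, ContDiff ℝ ∞ f ∧ HasCompactSupport f ∧ ∀ v, ‖f v - g v‖ ≤ ε ∧
      ‖fderiv ℝ f v - fderiv ℝ g v‖ ≤ ε ∧
      ‖fderiv ℝ (fderiv ℝ f) v - fderiv ℝ (fderiv ℝ g) v‖ ≤ ε := by
  have hg1 : ContDiff ℝ 1 (fderiv ℝ g) := hg.fderiv_right (by norm_num)
  have hc1 : HasCompactSupport (fderiv ℝ g) := hc.fderiv ℝ
  obtain ⟨r0, hr0, u0⟩ := Metric.uniformContinuous_iff.1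
    (hc.uniformContinuous_of_continuous hg.continuous) ε hε
  obtain ⟨r1, hr1, u1⟩ := exists_forall_convolution_fderiv (hg.of_le (by norm_num)) hc hε
  obtain ⟨r2, hr2, u2⟩ := exists_forall_convolution_fderiv hg1 hc1 hε
  set r := min r0 (min r1 r2) with hr
  have hrpos : 0 < r := by positivity
  let φ : ContDiffBump (0 : Fin N → ℝ) := ⟨r / 2, r, by positivity, by linarith⟩
  have conv1 : ∀ v, HasFDerivAt (φ.normed volume ⋆[ContinuousLinearMap.lsmul ℝ ℝ, volume] g)
      ((φ.normed volume ⋆[ContinuousLinearMap.lsmul ℝ ℝ, volume] fderiv ℝ g) v) v := fun v =>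
    hc.hasFDerivAt_convolution_right (ContinuousLinearMap.lsmul ℝ ℝ)
      φ.continuous_normed.locallyIntegrable (hg.of_le (by norm_num)) v
  have e1 : fderiv ℝ (φ.normed volume ⋆[ContinuousLinearMap.lsmul ℝ ℝ, volume] g) =
      φ.normed volume ⋆[ContinuousLinearMap.lsmul ℝ ℝ, volume] fderiv ℝ g :=
    funext fun v => (conv1 v).fderiv
  refine ⟨φ.normed volume ⋆[ContinuousLinearMap.lsmul ℝ ℝ, volume] g, ?_, ?_, fun v => ⟨?_, ?_, ?_⟩⟩
  · exact φ.hasCompactSupport_normed.contDiff_convolution_left _ φ.contDiff_normed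
      hg.continuous.locallyIntegrable
  · exact φ.hasCompactSupport_normed.convolution _ hc
  · rw [← dist_eq_norm]
    exact φ.dist_normed_convolution_le hg.continuous.aestronglyMeasurable fun x hx =>
      (u0 (lt_of_lt_of_le (Metric.mem_ball.1 hx) (min_le_left _ _))).le
  · obtain ⟨L, hL, hL'⟩ := u1 φ ((min_le_right _ _).trans (min_le_left _ _)) v
    rwa [hL.fderiv]
  · obtain ⟨L, hL, hL'⟩ := u2 φ ((min_le_right _ _).trans (min_le_right _ _)) v
    rwa [e1, hL.fderiv]

lemma HasCompactSupport.exists_bound_fderiv {E V : Type*} [NormedAddCommGroup E] [NormedSpace ℝ E]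
    [NormedAddCommGroup V] [NormedSpace ℝ V] {g : E → V} (hg : ContDiff ℝ 1 g)
    (hc : HasCompactSupport g) : ∃ C, ∀ v, ‖fderiv ℝ g v‖ ≤ C :=
  (hc.fderiv ℝ).exists_bound_of_continuous (hg.continuous_fderiv (by norm_num))

/-- Compactly supported `C²` functions of Wiener integrals belong to the Sobolev space. -/
lemma hasGross_of_hasCompactSupport [IsProbabilityMeasure μ] {N : ℕ} {g : (Fin N → ℝ) → ℝ}
    (hg : ContDiff ℝ 2 g) (hc : HasCompactSupport g) {h : Fin N → CMSpace T d}
    {δ : Fin N → PathSpace T d → ℝ} (hδ : ∀ i, IsWienerIntegral μ (h i) (δ i)) :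
    HasGrossSobolevGradients μ (fun x => g fun i => δ i x)
      (fun x => gradCLM h (fderiv ℝ g fun i => δ i x))
      (fun x => grad₂CLM h (fderiv ℝ (fderiv ℝ g) fun i => δ i x)) := by
  have hg1 : ContDiff ℝ 1 (fderiv ℝ g) := hg.fderiv_right (by norm_num)
  have hc1 : HasCompactSupport (fderiv ℝ g) := hc.fderiv ℝ
  have hg2 : Continuous (fderiv ℝ (fderiv ℝ g)) := hg1.continuous_fderiv (by norm_num)
  have hvec : AEStronglyMeasurable (fun x i => δ i x) μ :=
    aestronglyMeasurable_vec fun i => (hδ i).1.1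
  obtain ⟨C0, hC0⟩ := hc.exists_bound_of_continuous hg.continuous
  obtain ⟨C1, hC1⟩ := hc.exists_bound_fderiv (hg.of_le (by norm_num))
  obtain ⟨C2, hC2⟩ := hc1.exists_bound_fderiv hg1
  refine .of_approx ?_ ?_ ?_ ?_
  · exact MemLp.of_bound (hg.continuous.comp_aestronglyMeasurable hvec) C0
      (Eventually.of_forall fun x => hC0 _)
  · exact (gradCLM h).comp_memLp' (MemLp.of_bound (hg1.continuous.comp_aestronglyMeasurable hvec) C1
      (Eventually.of_forall fun x => hC1 _))
  · exact (grad₂CLM h).comp_memLp' (MemLp.of_bound (hg2.comp_aestronglyMeasurable hvec) C2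
      (Eventually.of_forall fun x => hC2 _))
  · intro ε hε
    obtain ⟨C, hC, hCb⟩ := exists_norm_grad₂CLM_le h
    -- The errors in value, gradient and second gradient are the C²-errors of f times 1, ‖gradCLM h‖
    -- and C; a tolerance divided by K serves all three.
    set K := 1 + ‖gradCLM h‖ + C with hK
    have hKpos : 0 < K := by positivity
    obtain ⟨ε', hε', hlt⟩ : ∃ ε' : ℝ, 0 < ε' ∧ ENNReal.ofReal ε' ≤ ε := by
      rcases eq_or_ne ε ⊤ with rfl | hne
      · exact ⟨1, one_pos, le_top⟩
      · exact ⟨ε.toReal, ENNReal.toReal_pos hε.ne' hne, ENNReal.ofReal_toReal_le⟩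
    obtain ⟨f, hf, hfc, happ⟩ := exists_contDiff_approx hg hc (div_pos hε' hKpos)
    let Φ : Cylindrical μ := ⟨N, hfc.toSchwartzMap hf, h, δ, hδ⟩
    have hb : ∀ {V : Type} [NormedAddCommGroup V] (u : PathSpace T d → V), (∀ x, ‖u x‖ ≤ ε') →
        eLpNorm u 2 μ ≤ ε := by
      intro V _ u hu
      refine (eLpNorm_le_of_ae_bound (Eventually.of_forall hu)).trans ?_
      simpa using hlt
    have hle : ∀ c, c ≤ K → c * (ε' / K) ≤ ε' := by
      intro c hcK
      rw [mul_div_assoc', div_le_iff₀ hKpos, mul_comm]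
      gcongr
    refine ⟨Φ, hb _ fun x => ?_, hb _ fun x => ?_, hb _ fun x => ?_⟩
    · refine ((happ fun i => δ i x).1).trans ?_
      have := hle 1 (by rw [hK]; linarith [norm_nonneg (gradCLM h)])
      linarith
    · rw [Φ.grad_eq, ← map_sub]
      refine ((gradCLM h).le_opNorm _).trans (le_trans ?_ (hle ‖gradCLM h‖ ?_))
      · gcongr
        exact (happ fun i => δ i x).2.1
      · rw [hK]; linarith [norm_nonneg (gradCLM h)]
    · rw [Φ.grad₂_eq, ← map_sub]
      refine (hCb _).trans (le_trans ?_ (hle C ?_))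
      · gcongr
        exact (happ fun i => δ i x).2.2
      · rw [hK]; linarith [norm_nonneg (gradCLM h)]

end

noncomputable section

/-! ### Functions of polynomial growth of Wiener integrals -/

variable {T : ℝ} {d : ℕ} {μ : Measure (PathSpace T d)}

/-- The mean value inequality on the ball of radius ‖v‖ costs one power of 1 + ‖v‖. Two applications
take linear growth of the second derivative to cubic growth of the function. -/
lemma norm_le_of_norm_fderiv_le_pow {E V : Type*} [NormedAddCommGroup E] [NormedSpace ℝ E]
    [NormedAddCommGroup V] [NormedSpace ℝ V] {g : E → V} (hg : Differentiable ℝ g) {C : ℝ} {k : ℕ}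
    (hb : ∀ v, ‖fderiv ℝ g v‖ ≤ C * (1 + ‖v‖) ^ k) (v : E) :
    ‖g v‖ ≤ (‖g 0‖ + C) * (1 + ‖v‖) ^ (k + 1) := by
  have hC : 0 ≤ C := by
    have := (norm_nonneg _).trans (hb 0)
    simpa using this
  have h1 : ‖g v - g 0‖ ≤ C * (1 + ‖v‖) ^ k * ‖v - 0‖ := by
    refine (convex_closedBall (0 : E) ‖v‖).norm_image_sub_le_of_norm_fderiv_le (𝕜 := ℝ)
      (fun x _ => hg x) (fun x hx => (hb x).trans ?_) (by simp) (by simp)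
    gcongr
    simpa using hx
  have h2 : ‖g v‖ ≤ ‖g 0‖ + ‖g v - g 0‖ := norm_le_norm_add_norm_sub' _ _
  have h3 : (1 : ℝ) ≤ (1 + ‖v‖) ^ (k + 1) := one_le_pow₀ (by linarith [norm_nonneg v])
  rw [sub_zero] at h1
  calc ‖g v‖ ≤ ‖g 0‖ * 1 + C * ((1 + ‖v‖) ^ k * ‖v‖) := by linarith
    _ ≤ ‖g 0‖ * (1 + ‖v‖) ^ (k + 1) + C * ((1 + ‖v‖) ^ k * (1 + ‖v‖)) := by
        gcongr
        linarith
    _ = _ := by ring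

/-- The cutoff functions `χ(v / (n + 1))`. -/
def cutoff (N : ℕ) (n : ℕ) (v : Fin N → ℝ) : ℝ :=
  (⟨1, 2, one_pos, one_lt_two⟩ : ContDiffBump (0 : Fin N → ℝ)) (((n : ℝ) + 1)⁻¹ • v)

lemma contDiff_cutoff (N n : ℕ) {m : ℕ∞} : ContDiff ℝ m (cutoff N n) :=
  (ContDiffBump.contDiff _).comp (contDiff_const_smul _)

lemma hasCompactSupport_cutoff (N n : ℕ) : HasCompactSupport (cutoff N n) :=
  (ContDiffBump.hasCompactSupport _).comp_smul (inv_ne_zero (by positivity))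

lemma cutoff_eventuallyEq {N : ℕ} (v : Fin N → ℝ) :
    ∀ᶠ n in atTop, cutoff N n =ᶠ[𝓝 v] fun _ => 1 := by
  filter_upwards [eventually_gt_atTop ⌈‖v‖⌉₊] with n hn
  have h1 : ‖v‖ < (n : ℝ) + 1 :=
    lt_of_le_of_lt (Nat.le_ceil _) (lt_trans (Nat.cast_lt.2 hn) (lt_add_one _))
  have h2 : ∀ᶠ w in 𝓝 v, ‖w‖ < (n : ℝ) + 1 := continuous_norm.continuousAt.eventually_lt_const h1
  filter_upwards [h2] with w hw
  refine ContDiffBump.one_of_mem_closedBall _ ?_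
  rw [mem_closedBall_zero_iff, norm_smul, norm_inv, Real.norm_of_nonneg (by positivity),
    inv_mul_le_iff₀ (by positivity)]
  simpa using hw.le

/-- Rescaling multiplies the i-th derivative by (n + 1)^{−i} ≤ 1, so the bounds for the fixed bump
serve for all n. -/
lemma exists_norm_iteratedFDeriv_cutoff_le (N : ℕ) : ∃ B : ℝ, 0 ≤ B ∧ ∀ n, ∀ i ≤ 2, ∀ v,
    ‖iteratedFDeriv ℝ i (cutoff N n) v‖ ≤ B := by
  let χ : ContDiffBump (0 : Fin N → ℝ) := ⟨1, 2, one_pos, one_lt_two⟩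
  have h1 : ∀ i : ℕ, ∃ C > 0, ∀ v, ‖iteratedFDeriv ℝ i χ v‖ ≤ C := by
    intro i
    obtain ⟨C, hC, h⟩ := (χ.hasCompactSupport.toSchwartzMap χ.contDiff).decay 0 i
    refine ⟨C, hC, fun v => ?_⟩
    have := h v
    rwa [pow_zero, one_mul] at this
  choose C hC hCb using h1
  have hC0 := fun i => (hC i).le
  refine ⟨C 0 + C 1 + C 2, by linarith [hC0 0, hC0 1, hC0 2], fun n i hi v => ?_⟩
  have h2 : iteratedFDeriv ℝ i (cutoff N n) v =
      ((n : ℝ) + 1)⁻¹ ^ i • iteratedFDeriv ℝ i χ (((n : ℝ) + 1)⁻¹ • v) := by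
    have := congrFun (iteratedFDeriv_comp_const_smul (i := i) (f := χ) (((n : ℝ) + 1)⁻¹)
      χ.contDiff) v
    exact this
  rw [h2, norm_smul, norm_pow, norm_inv, Real.norm_of_nonneg (by positivity)]
  have h3 : ((n : ℝ) + 1)⁻¹ ^ i ≤ 1 :=
    pow_le_one₀ (by positivity) (inv_le_one_of_one_le₀ (by linarith [n.cast_nonneg (α := ℝ)]))
  have h4 : C i ≤ C 0 + C 1 + C 2 := by
    interval_cases i <;> linarith [hC0 0, hC0 1, hC0 2]
  calc _ ≤ 1 * C i := by
        gcongr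
        exact hCb i _
    _ ≤ _ := by linarith

lemma norm_iteratedFDeriv_two {E V : Type*} [NormedAddCommGroup E] [NormedSpace ℝ E]
    [NormedAddCommGroup V] [NormedSpace ℝ V] (f : E → V) (v : E) :
    ‖iteratedFDeriv ℝ 2 f v‖ = ‖fderiv ℝ (fderiv ℝ f) v‖ := by
  rw [← norm_iteratedFDeriv_fderiv, norm_iteratedFDeriv_one]

/-- The Leibniz rule with bounds independent of n; the cubic weight is the dominating function when
the cutoff is removed. -/
lemma exists_norm_iteratedFDeriv_cutoff_mul_le {N : ℕ} {f : (Fin N → ℝ) → ℝ} (hf : ContDiff ℝ 2 f)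
    {C : ℝ} (hC : ∀ v, ‖fderiv ℝ (fderiv ℝ f) v‖ ≤ C * (1 + ‖v‖)) :
    ∃ C', ∀ n, ∀ m ≤ 2, ∀ v, ‖iteratedFDeriv ℝ m (fun v => cutoff N n v * f v) v‖ ≤
      C' * (1 + ‖v‖) ^ 3 := by
  have hC0 : 0 ≤ C := by
    have := (norm_nonneg (fderiv ℝ (fderiv ℝ f) 0)).trans (hC 0)
    simpa using this
  obtain ⟨B, hB, hBb⟩ := exists_norm_iteratedFDeriv_cutoff_le N
  have hf1 : Differentiable ℝ (fderiv ℝ f) :=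
    (hf.fderiv_right (m := 1) (by norm_num)).differentiable (by norm_num)
  have b1 := norm_le_of_norm_fderiv_le_pow (k := 1) hf1 (by simpa using hC)
  have b0 := norm_le_of_norm_fderiv_le_pow (k := 2) (hf.differentiable (by norm_num)) b1
  set C1 := ‖fderiv ℝ f 0‖ + C with hC1
  have hC1' : 0 ≤ C1 := by positivity
  set C2 := ‖f 0‖ + C1 with hC2
  have hC2' : 0 ≤ C2 := by positivity
  set D := C + C1 + C2 with hD
  have bound : ∀ j ≤ 2, ∀ v, ‖iteratedFDeriv ℝ j f v‖ ≤ D * (1 + ‖v‖) ^ 3 := by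
    intro j hj v
    have hv : (1 : ℝ) ≤ 1 + ‖v‖ := by linarith [norm_nonneg v]
    have key : ∀ c k, 0 ≤ c → c ≤ D → k ≤ 3 → c * (1 + ‖v‖) ^ k ≤ D * (1 + ‖v‖) ^ 3 := by
      intro c k h0 hc hk
      gcongr
    interval_cases j
    · rw [norm_iteratedFDeriv_zero]
      exact (b0 v).trans (key _ _ hC2' (by rw [hD]; linarith) le_rfl)
    · rw [norm_iteratedFDeriv_one]
      exact (b1 v).trans (key _ _ hC1' (by rw [hD]; linarith) (by norm_num))
    · rw [norm_iteratedFDeriv_two]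
      have := hC v
      rw [← pow_one (1 + ‖v‖)] at this
      exact this.trans (key _ _ hC0 (by rw [hD]; linarith) (by norm_num))
  -- The binomial coefficients sum to 2^m ≤ 4 for m ≤ 2.
  refine ⟨4 * (B * D), fun n m hm v => ?_⟩
  refine (norm_iteratedFDeriv_mul_le (contDiff_cutoff N n (m := 2)) hf v
    (by exact_mod_cast hm)).trans ?_
  have hterm : ∀ i ∈ Finset.range (m + 1), (m.choose i : ℝ) * ‖iteratedFDeriv ℝ i (cutoff N n) v‖ *
      ‖iteratedFDeriv ℝ (m - i) f v‖ ≤ (m.choose i : ℝ) * (B * (D * (1 + ‖v‖) ^ 3)) := by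
    intro i hi
    rw [mul_assoc]
    have hi' := Finset.mem_range.1 hi
    gcongr
    · exact hBb n i (by omega) v
    · exact bound _ (by omega) v
  refine (Finset.sum_le_sum hterm).trans ?_
  rw [← Finset.sum_mul, ← Nat.cast_sum, Nat.sum_range_choose]
  have h4 : ((2 ^ m : ℕ) : ℝ) ≤ 4 := by
    interval_cases m <;> norm_num
  calc _ ≤ 4 * (B * (D * (1 + ‖v‖) ^ 3)) := by
        have : 0 ≤ B * (D * (1 + ‖v‖) ^ 3) := by positivity
        gcongr
    _ = _ := by ring

/-- `C²` functions with linearly growing second derivative, evaluated at Wiener integrals with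
enough moments, belong to the Sobolev space. -/
lemma hasGross_of_contDiff [IsProbabilityMeasure μ] {N : ℕ} {f : (Fin N → ℝ) → ℝ}
    (hf : ContDiff ℝ 2 f) {C : ℝ} (hC : ∀ v, ‖fderiv ℝ (fderiv ℝ f) v‖ ≤ C * (1 + ‖v‖))
    {h : Fin N → CMSpace T d} {δ : Fin N → PathSpace T d → ℝ}
    (hδ : ∀ i, IsWienerIntegral μ (h i) (δ i))
    (hmom : MemLp (fun x => (1 + ‖fun i => δ i x‖) ^ 3) 2 μ) :
    HasGrossSobolevGradients μ (fun x => f fun i => δ i x)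
      (fun x => gradCLM h (fderiv ℝ f fun i => δ i x))
      (fun x => grad₂CLM h (fderiv ℝ (fderiv ℝ f) fun i => δ i x)) := by
  obtain ⟨C', hC'⟩ := exists_norm_iteratedFDeriv_cutoff_mul_le hf hC
  have hgn : ∀ n, ContDiff ℝ 2 fun v => cutoff N n v * f v := fun n =>
    (contDiff_cutoff N n (m := 2)).mul hf
  have hG := fun n => hasGross_of_hasCompactSupport (hgn n)
    ((hasCompactSupport_cutoff N n).mul_right (f' := f)) hδ
  -- Near each point the cutoff is eventually identically 1, so the function and both derivatives
  -- are eventually equal to their limits there.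
  have hev : ∀ v, ∀ᶠ n in atTop, (fun v => cutoff N n v * f v) =ᶠ[𝓝 v] f := by
    intro v
    filter_upwards [cutoff_eventuallyEq v] with n hn
    filter_upwards [hn] with w hw
    rw [hw, one_mul]
  obtain ⟨C₂, hC₂, hC₂b⟩ := exists_norm_grad₂CLM_le h
  obtain ⟨m0, t0⟩ := tendsto_eLpNorm_two_of_dominated (g := fun x => f fun i => δ i x)
    (fun n => (hG n).1.1) (hmom.const_mul C') (fun n => Eventually.of_forall fun x => by
      simpa using hC' n 0 (by norm_num) fun i => δ i x)
    (Eventually.of_forall fun x => tendsto_const_nhds.congr' (by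
      filter_upwards [hev fun i => δ i x] with n hn
      exact hn.eq_of_nhds.symm))
  obtain ⟨m1, t1⟩ := tendsto_eLpNorm_two_of_dominated
    (g := fun x => gradCLM h (fderiv ℝ f fun i => δ i x))
    (fun n => (hG n).2.1.1) (hmom.const_mul (‖gradCLM h‖ * C'))
    (fun n => Eventually.of_forall fun x => by
      refine ((gradCLM h).le_opNorm _).trans ?_
      rw [mul_assoc, ← norm_iteratedFDeriv_one]
      gcongr
      exact hC' n 1 (by norm_num) fun i => δ i x)
    (Eventually.of_forall fun x => tendsto_const_nhds.congr' (by
      filter_upwards [hev fun i => δ i x] with n hn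
      rw [hn.fderiv_eq]))
  obtain ⟨m2, t2⟩ := tendsto_eLpNorm_two_of_dominated
    (g := fun x => grad₂CLM h (fderiv ℝ (fderiv ℝ f) fun i => δ i x))
    (fun n => (hG n).2.2.1.1) (hmom.const_mul (C₂ * C'))
    (fun n => Eventually.of_forall fun x => by
      refine (hC₂b _).trans ?_
      rw [mul_assoc, ← norm_iteratedFDeriv_two]
      gcongr
      exact hC' n 2 (by norm_num) fun i => δ i x)
    (Eventually.of_forall fun x => tendsto_const_nhds.congr' (by
      filter_upwards [hev fun i => δ i x] with n hn
      rw [hn.fderiv.fderiv_eq]))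
  exact .of_tendsto hG m0 m1 m2 t0 t1 t2

end

noncomputable section

/-! ### Averages of Mehler type -/

variable {T : ℝ} {d : ℕ} {μ : Measure (PathSpace T d)}

namespace Frame

variable {N : ℕ} (B : Frame T d N) {V : Type*} [NormedAddCommGroup V] [NormedSpace ℝ V]

/-- The bound on the density of the law of `x ↦ mehler a b v x`. -/
def densityBound (_ : Frame T d N) (b : ℝ) (v : Fin N → ℝ) : ℝ :=
  |(b ^ N)⁻¹| * Real.exp ((∑ i, v i ^ 2) / 2)

lemma densityBound_nonneg (b : ℝ) (v : Fin N → ℝ) : 0 ≤ B.densityBound b v := by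
  unfold densityBound; positivity

lemma continuous_densityBound (b : ℝ) : Continuous (B.densityBound b) := by
  unfold densityBound; fun_prop

lemma continuous_mehler_right (a b : ℝ) (v : Fin N → ℝ) : Continuous (B.mehler a b v) :=
  (B.continuous_mehler a b).comp (by fun_prop : Continuous fun x => (v, x))

section

variable (hμ : IsWienerMeasure μ) (hT : 0 < T) {a b : ℝ} (hb : b ≠ 0) (hab : a ^ 2 + b ^ 2 = 1)
include hμ hT hb hab

lemma map_mehler_le (v : Fin N → ℝ) :
    μ.map (B.mehler a b v) ≤ ENNReal.ofReal (B.densityBound b v) • μ := by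
  refine Measure.le_iff.2 fun s hs => ?_
  have hm := (B.continuous_mehler_right a b v).measurable
  have h := B.lintegral_mehler_le hμ hT hb hab v (H := s.indicator 1) (measurable_one.indicator hs)
  rw [lintegral_indicator_one hs] at h
  rw [Measure.map_apply hm hs, Measure.smul_apply, smul_eq_mul]
  refine le_trans (le_of_eq ?_) h
  rw [← lintegral_indicator_one (hm hs)]
  rfl

lemma quasiMeasurePreserving_mehler (v : Fin N → ℝ) :
    Measure.QuasiMeasurePreserving (B.mehler a b v) μ μ :=
  ⟨(B.continuous_mehler_right a b v).measurable,
    Measure.absolutelyContinuous_of_le_smul (B.map_mehler_le hμ hT hb hab v)⟩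

omit [NormedSpace ℝ V] in
lemma eLpNorm_mehler_le {G : PathSpace T d → V} (hG : AEStronglyMeasurable G μ) (v : Fin N → ℝ)
    {p : ℝ≥0∞} (hp : p ≠ ⊤) :
    eLpNorm (fun x => G (B.mehler a b v x)) p μ ≤
      ENNReal.ofReal (B.densityBound b v) ^ (1 / p).toReal * eLpNorm G p μ := by
  have hq := B.quasiMeasurePreserving_mehler hμ hT hb hab v
  have h1 : eLpNorm (G ∘ B.mehler a b v) p μ = eLpNorm G p (μ.map (B.mehler a b v)) :=
    (eLpNorm_map_measure (hG.mono_ac hq.absolutelyContinuous) hq.measurable.aemeasurable).symm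
  refine (h1.le.trans (eLpNorm_mono_measure G (B.map_mehler_le hμ hT hb hab v))).trans_eq ?_
  rw [eLpNorm_smul_measure_of_ne_top hp, smul_eq_mul]

omit [NormedSpace ℝ V] in
lemma memLp_mehler {G : PathSpace T d → V} {p : ℝ≥0∞} (hp : p ≠ ⊤) (hG : MemLp G p μ)
    (v : Fin N → ℝ) : MemLp (fun x => G (B.mehler a b v x)) p μ :=
  ⟨hG.1.comp_quasiMeasurePreserving (B.quasiMeasurePreserving_mehler hμ hT hb hab v),
    (B.eLpNorm_mehler_le hμ hT hb hab hG.1 v hp).trans_lt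
      (ENNReal.mul_lt_top (ENNReal.rpow_lt_top_of_nonneg ENNReal.toReal_nonneg ENNReal.ofReal_ne_top)
        hG.2)⟩

omit [NormedSpace ℝ V] in
lemma integrable_mehler {G : PathSpace T d → V} (hG : MemLp G 2 μ) (v : Fin N → ℝ) :
    Integrable (fun x => G (B.mehler a b v x)) μ := by
  have := hμ.isProbabilityMeasure
  exact (B.memLp_mehler hμ hT hb hab (by norm_num) hG v).integrable (by norm_num)

end

/-- The average of `G` over `x ↦ mehler a b v x`. -/
def avg (μ : Measure (PathSpace T d)) (a b : ℝ) (G : PathSpace T d → V) (v : Fin N → ℝ) : V :=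
  ∫ x, G (B.mehler a b v x) ∂μ

section

variable (hμ : IsWienerMeasure μ) (hT : 0 < T) {a b : ℝ} (hb : b ≠ 0) (hab : a ^ 2 + b ^ 2 = 1)
include hμ hT hb hab

/-- For fixed v the rotated path has a law dominated by `densityBound` times μ. An L²-error thus
becomes a pointwise error, locally uniform in v; this is the smoothing mechanism behind all
regularity of averages. -/
lemma norm_avg_sub_le {G G' : PathSpace T d → V} (hG : MemLp G 2 μ) (hG' : MemLp G' 2 μ)
    (v : Fin N → ℝ) : ‖B.avg μ a b G v - B.avg μ a b G' v‖ ≤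
      B.densityBound b v * (eLpNorm (fun x => G x - G' x) 2 μ).toReal := by
  have := hμ.isProbabilityMeasure
  have hd : MemLp (fun x => G x - G' x) 2 μ := hG.sub hG'
  rw [avg, avg, ← integral_sub (B.integrable_mehler hμ hT hb hab hG v)
    (B.integrable_mehler hμ hT hb hab hG' v)]
  refine (norm_integral_le_lintegral_norm _).trans ?_
  rw [← ENNReal.toReal_ofReal (B.densityBound_nonneg b v), ← ENNReal.toReal_mul]
  refine ENNReal.toReal_mono (ENNReal.mul_ne_top ENNReal.ofReal_ne_top hd.2.ne) ?_
  simp_rw [ofReal_norm]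
  rw [← eLpNorm_one_eq_lintegral_enorm]
  refine (B.eLpNorm_mehler_le (p := 1) hμ hT hb hab hd.1 v (by norm_num)).trans ?_
  simp only [div_one, ENNReal.toReal_one, ENNReal.rpow_one]
  gcongr
  exact eLpNorm_le_eLpNorm_of_exponent_le (by norm_num) hd.1

/-- Averages of bounded continuous functions are continuous by dominated convergence, and these
functions are dense in L²; approximation is uniform wherever the density bound stays below K. -/
lemma continuous_avg {G : PathSpace T d → V} (hG : MemLp G 2 μ) : Continuous (B.avg μ a b G) := by
  have := hμ.isProbabilityMeasure
  rw [continuous_iff_continuousAt]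
  intro v
  refine continuousAt_of_locally_uniform_approx_of_continuousAt fun u hu => ?_
  obtain ⟨ε, hε, hεu⟩ := Metric.mem_uniformity_dist.1 hu
  set K := B.densityBound b v + 1 with hK
  have hKpos : 0 < K := by linarith [B.densityBound_nonneg b v]
  obtain ⟨φ, hφ, hφm⟩ := hG.exists_boundedContinuous_eLpNorm_sub_le (by norm_num)
    (ε := ENNReal.ofReal (ε / K / 2)) (by simp; positivity)
  refine ⟨{w | B.densityBound b w < K}, ?_, B.avg μ a b φ, ?_, ?_⟩
  · exact (B.continuous_densityBound b).continuousAt.eventually_lt_const (by linarith)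
  · refine continuousAt_of_dominated (bound := fun _ => ‖φ‖) ?_ ?_ (integrable_const _) ?_
    · exact Eventually.of_forall fun w =>
        (φ.continuous.comp (B.continuous_mehler_right a b w)).aestronglyMeasurable
    · exact Eventually.of_forall fun w => Eventually.of_forall fun x => φ.norm_coe_le_norm _
    · refine Eventually.of_forall fun x => ?_
      exact (φ.continuous.comp ((B.continuous_mehler a b).comp
        (by fun_prop : Continuous fun w => (w, x)))).continuousAt
  · intro w hw
    refine hεu ?_
    rw [dist_eq_norm]
    refine (B.norm_avg_sub_le hμ hT hb hab hG hφm w).trans_lt ?_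
    have h1 : (eLpNorm (fun x => G x - φ x) 2 μ).toReal ≤ ε / K / 2 := by
      refine ENNReal.toReal_le_of_le_ofReal (by positivity) hφ
    calc _ ≤ K * (ε / K / 2) := by
          gcongr
          exact hw.le
      _ = ε / 2 := by field_simp
      _ < ε := by linarith

/-- The Cameron--Martin shift of a Wiener integral. -/
lemma wienerIntegral_mehler {h : CMSpace T d} {φ : PathSpace T d → ℝ} (hφ : IsWienerIntegral μ h φ)
    (v : Fin N → ℝ) : ∀ᵐ x ∂μ, φ (B.mehler a b v x) = a * ⟪h, B.lift v⟫_ℝ + φ (B.scale b x) := by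
  have := hμ.isProbabilityMeasure
  obtain ⟨hφm, η, hη, hlim⟩ := hφ
  -- Scaling is the Mehler map at v = 0, so it too pulls null sets back to null sets, and φ may be
  -- composed with it.
  have hs : ∀ x, B.scale b x = B.mehler a b 0 x := fun x => by simp [mehler]
  simp_rw [hs]
  have hηm : ∀ n, MemLp (fun x => η n x) 2 μ := fun n => hμ.memLp_dual hT (η n)
  have hd : ∀ n, MemLp (fun x => η n x - φ x) 2 μ := fun n => (hηm n).sub hφm
  have hv : ∀ w : Fin N → ℝ, Tendsto (fun n => eLpNorm (fun x => η n (B.mehler a b w x) -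
      φ (B.mehler a b w x)) 2 μ) atTop (𝓝 0) := by
    intro w
    refine tendsto_of_tendsto_of_tendsto_of_le_of_le tendsto_const_nhds ?_ (fun _ => zero_le)
      fun n => B.eLpNorm_mehler_le hμ hT hb hab (hd n).1 w (by norm_num)
    have := ENNReal.Tendsto.const_mul hlim (a := ENNReal.ofReal (B.densityBound b w) ^
      (1 / (2 : ℝ≥0∞)).toReal) (Or.inr (ENNReal.rpow_ne_top_of_nonneg ENNReal.toReal_nonneg
        ENNReal.ofReal_ne_top))
    simpa using this
  have hc : Tendsto (fun n => a * ⟪cmAdjoint T d (η n), B.lift v⟫_ℝ - a * ⟪h, B.lift v⟫_ℝ) atTop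
      (𝓝 0) := by
    have h1 : Tendsto (fun n => ⟪cmAdjoint T d (η n), B.lift v⟫_ℝ) atTop (𝓝 ⟪h, B.lift v⟫_ℝ) :=
      hη.inner tendsto_const_nhds
    simpa using (h1.const_mul a).sub_const (a * ⟪h, B.lift v⟫_ℝ)
  have hc' : Tendsto (fun n => eLpNorm (fun _ : PathSpace T d =>
      a * ⟪cmAdjoint T d (η n), B.lift v⟫_ℝ - a * ⟪h, B.lift v⟫_ℝ) 2 μ) atTop (𝓝 0) := by
    have := hc.enorm
    simp only [enorm_zero] at this
    refine this.congr fun n => ?_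
    rw [eLpNorm_const _ (by norm_num) (NeZero.ne μ)]
    simp
  -- For continuous functionals the shift identity is exact by linearity; ψ is the error for φ,
  -- bounded in L² by the errors of the approximating functionals at v and at 0 and of their inner
  -- products.
  set ψ : PathSpace T d → ℝ := fun x => φ (B.mehler a b v x) - φ (B.mehler a b 0 x) -
    a * ⟪h, B.lift v⟫_ℝ with hψ
  have hmv : ∀ w, AEStronglyMeasurable (fun x => φ (B.mehler a b w x)) μ := fun w =>
    (B.memLp_mehler hμ hT hb hab (by norm_num) hφm w).1
  have hmd : ∀ n w, AEStronglyMeasurable (fun x => η n (B.mehler a b w x) -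
      φ (B.mehler a b w x)) μ := fun n w =>
    (B.memLp_mehler hμ hT hb hab (by norm_num) (hd n) w).1
  have h0 : eLpNorm ψ 2 μ = 0 := by
    have hle : ∀ n, eLpNorm ψ 2 μ ≤ eLpNorm (fun x => η n (B.mehler a b 0 x) -
        φ (B.mehler a b 0 x)) 2 μ + eLpNorm (fun x => η n (B.mehler a b v x) -
        φ (B.mehler a b v x)) 2 μ + eLpNorm (fun _ : PathSpace T d =>
        a * ⟪cmAdjoint T d (η n), B.lift v⟫_ℝ - a * ⟪h, B.lift v⟫_ℝ) 2 μ := by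
      intro n
      have he : ψ = ((fun x => η n (B.mehler a b 0 x) - φ (B.mehler a b 0 x)) -
          fun x => η n (B.mehler a b v x) - φ (B.mehler a b v x)) +
          fun _ : PathSpace T d => a * ⟪cmAdjoint T d (η n), B.lift v⟫_ℝ - a * ⟪h, B.lift v⟫_ℝ := by
        ext x
        have h1 : η n (B.mehler a b v x) = a * ⟪cmAdjoint T d (η n), B.lift v⟫_ℝ +
            η n (B.mehler a b 0 x) := by
          rw [cmAdjoint_inner, ← path_apply]
          simp [mehler]
        simp only [hψ, Pi.add_apply, Pi.sub_apply, h1]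
        ring
      rw [he]
      refine (eLpNorm_add_le ((hmd n 0).sub (hmd n v)) aestronglyMeasurable_const
        (by norm_num)).trans ?_
      gcongr
      exact eLpNorm_sub_le (hmd n 0) (hmd n v) (by norm_num)
    have hlim0 := ((hv 0).add (hv v)).add hc'
    simp only [add_zero] at hlim0
    exact le_antisymm (ge_of_tendsto' hlim0 hle) zero_le
  have hψm : AEStronglyMeasurable ψ μ := ((hmv v).sub (hmv 0)).sub aestronglyMeasurable_const
  filter_upwards [(eLpNorm_eq_zero_iff hψm (by norm_num)).1 h0] with x hx
  simp only [hψ, Pi.zero_apply] at hx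
  linarith

end

end Frame

end

noncomputable section

/-! ### Derivatives of averages -/

variable {T : ℝ} {d : ℕ} {μ : Measure (PathSpace T d)}

lemma hasFDerivAt_integral_translate {Ω E V : Type*} [MeasurableSpace Ω] {ν : Measure Ω}
    [IsProbabilityMeasure ν] [NormedAddCommGroup E] [NormedSpace ℝ E] [NormedAddCommGroup V]
    [NormedSpace ℝ V] {φ : E → V} (hφ : ContDiff ℝ 1 φ)
    {C₀ C₁ : ℝ} (h₀ : ∀ v, ‖φ v‖ ≤ C₀) (h₁ : ∀ v, ‖fderiv ℝ φ v‖ ≤ C₁) {Y : Ω → E}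
    (hY : AEStronglyMeasurable Y ν) (v : E) :
    HasFDerivAt (fun w => ∫ ω, φ (w + Y ω) ∂ν) (∫ ω, fderiv ℝ φ (v + Y ω) ∂ν) v := by
  refine hasFDerivAt_integral_of_dominated_of_fderiv_le (bound := fun _ => C₁)
    (F' := fun w ω => fderiv ℝ φ (w + Y ω)) (Metric.ball_mem_nhds v one_pos) ?_ ?_ ?_ ?_
    (integrable_const _) ?_
  · exact Eventually.of_forall fun w =>
      hφ.continuous.comp_aestronglyMeasurable (aestronglyMeasurable_const.add hY)
  · exact Integrable.of_bound
      (hφ.continuous.comp_aestronglyMeasurable (aestronglyMeasurable_const.add hY)) C₀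
      (Eventually.of_forall fun ω => h₀ _)
  · exact (hφ.continuous_fderiv (by norm_num)).comp_aestronglyMeasurable
      (aestronglyMeasurable_const.add hY)
  · exact Eventually.of_forall fun ω w _ => h₁ _
  · refine Eventually.of_forall fun ω w _ => ?_
    exact (hasFDerivAt_comp_add_right (Y ω)).2
      ((hφ.differentiable (by norm_num)) (w + Y ω)).hasFDerivAt

/-- Because C is continuous, errors of the form C(v)ε_n are locally uniform, which is what termwise
differentiation needs. -/
lemma hasFDerivAt_of_locally_uniform {E V : Type*} [NormedAddCommGroup E] [NormedSpace ℝ E]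
    [NormedAddCommGroup V] [NormedSpace ℝ V] {f : ℕ → E → V} {f' : ℕ → E → E →L[ℝ] V} {g : E → V}
    {g' : E → E →L[ℝ] V} {C : E → ℝ} (hC : Continuous C) {ε ε' : ℕ → ℝ}
    (hε : Tendsto ε atTop (𝓝 0)) (hε' : Tendsto ε' atTop (𝓝 0))
    (hf : ∀ n v, HasFDerivAt (f n) (f' n v) v)
    (h₀ : ∀ n v, ‖f n v - g v‖ ≤ C v * ε n) (h₁ : ∀ n v, ‖f' n v - g' v‖ ≤ C v * ε' n) (v : E) :
    HasFDerivAt g (g' v) v := by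
  refine hasFDerivAt_of_tendstoUniformlyOnFilter (l := atTop) (f := f) (f' := f') ?_
    (Eventually.of_forall fun p => hf _ _) (Eventually.of_forall fun w => ?_)
  · rw [Metric.tendstoUniformlyOnFilter_iff]
    intro δ hδ
    have h2 : Tendsto (fun p : ℕ × E => C p.2 * ε' p.1) (atTop ×ˢ 𝓝 v) (𝓝 (C v * 0)) :=
      ((hC.tendsto v).comp tendsto_snd).mul (hε'.comp tendsto_fst)
    rw [mul_zero] at h2
    filter_upwards [h2.eventually_lt_const hδ] with p hp
    rw [dist_comm, dist_eq_norm]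
    exact (h₁ _ _).trans_lt hp
  · rw [tendsto_iff_norm_sub_tendsto_zero]
    refine squeeze_zero (fun n => norm_nonneg _) (fun n => h₀ n w) ?_
    simpa using hε.const_mul (C w)

lemma norm_cmTmul (h k : CMSpace T d) : ‖cmTmul h k‖ = ‖h‖ * ‖k‖ := by
  rw [cmTmul, UniformSpace.Completion.norm_coe, TensorProduct.norm_tmul]

lemma cmTmul_add (h k k' : CMSpace T d) : cmTmul h (k + k') = cmTmul h k + cmTmul h k' := by
  rw [cmTmul, TensorProduct.tmul_add, UniformSpace.Completion.coe_add]; rfl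

lemma add_cmTmul (h h' k : CMSpace T d) : cmTmul (h + h') k = cmTmul h k + cmTmul h' k := by
  rw [cmTmul, TensorProduct.add_tmul, UniformSpace.Completion.coe_add]; rfl

lemma cmTmul_smul (c : ℝ) (h k : CMSpace T d) : cmTmul h (c • k) = c • cmTmul h k := by
  rw [cmTmul, TensorProduct.tmul_smul, UniformSpace.Completion.coe_smul]; rfl

lemma smul_cmTmul (c : ℝ) (h k : CMSpace T d) : cmTmul (c • h) k = c • cmTmul h k := by
  rw [cmTmul, ← TensorProduct.smul_tmul', UniformSpace.Completion.coe_smul]; rfl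

namespace Frame

variable {N : ℕ} (B : Frame T d N)

/-- `u ↦ a ⟨g, u⟩`, in coordinates. -/
def slope (a : ℝ) (g : CMSpace T d) : (Fin N → ℝ) →L[ℝ] ℝ := a • (innerSL ℝ g ∘L B.lift)

lemma slope_apply (a : ℝ) (g : CMSpace T d) (u : Fin N → ℝ) :
    B.slope a g u = a * ⟪g, B.lift u⟫_ℝ := rfl

lemma norm_slope_sub_le (a : ℝ) (g g' : CMSpace T d) :
    ‖B.slope a g - B.slope a g'‖ ≤ |a| * ‖B.lift‖ * ‖g - g'‖ := by
  refine ContinuousLinearMap.opNorm_le_bound _ (by positivity) fun u => ?_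
  rw [sub_apply, slope_apply, slope_apply, ← mul_sub, ← inner_sub_left, norm_mul, Real.norm_eq_abs]
  calc |a| * ‖⟪g - g', B.lift u⟫_ℝ‖ ≤ |a| * (‖g - g'‖ * (‖B.lift‖ * ‖u‖)) := by
        gcongr
        exact (norm_inner_le_norm _ _).trans (by gcongr; exact B.lift.le_opNorm u)
    _ = _ := by ring

/-- `(u, u') ↦ a² ⟨W, u' ⊗ u⟩`, in coordinates. -/
def hess (a : ℝ) (W : CMTensor T d) : (Fin N → ℝ) →L[ℝ] (Fin N → ℝ) →L[ℝ] ℝ :=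
  LinearMap.mkContinuous₂
    (LinearMap.mk₂ ℝ (fun u u' => a ^ 2 * ⟪W, cmTmul (B.lift u') (B.lift u)⟫_ℝ)
      (fun u v u' => by rw [map_add, cmTmul_add, inner_add_right, mul_add])
      (fun c u u' => by rw [map_smul, cmTmul_smul, real_inner_smul_right, smul_eq_mul]; ring)
      (fun u u' v' => by rw [map_add, add_cmTmul, inner_add_right, mul_add])
      (fun c u u' => by rw [map_smul, smul_cmTmul, real_inner_smul_right, smul_eq_mul]; ring))
    (a ^ 2 * ‖W‖ * (‖B.lift‖ * ‖B.lift‖)) fun u u' => by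
      rw [LinearMap.mk₂_apply, norm_mul, Real.norm_of_nonneg (sq_nonneg a)]
      calc a ^ 2 * ‖⟪W, cmTmul (B.lift u') (B.lift u)⟫_ℝ‖
          ≤ a ^ 2 * (‖W‖ * ((‖B.lift‖ * ‖u'‖) * (‖B.lift‖ * ‖u‖))) := by
            gcongr
            refine (norm_inner_le_norm _ _).trans ?_
            rw [norm_cmTmul]
            gcongr
            · exact B.lift.le_opNorm u'
            · exact B.lift.le_opNorm u
        _ = _ := by ring

lemma hess_apply (a : ℝ) (W : CMTensor T d) (u u' : Fin N → ℝ) :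
    B.hess a W u u' = a ^ 2 * ⟪W, cmTmul (B.lift u') (B.lift u)⟫_ℝ := rfl

lemma norm_hess_sub_le (a : ℝ) (W W' : CMTensor T d) :
    ‖B.hess a W - B.hess a W'‖ ≤ a ^ 2 * (‖B.lift‖ * ‖B.lift‖) * ‖W - W'‖ := by
  have h : B.hess a W - B.hess a W' = B.hess a (W - W') := by
    ext u u'
    rw [sub_apply, sub_apply, hess_apply, hess_apply, hess_apply, inner_sub_left, mul_sub]
  rw [h]
  refine (LinearMap.mkContinuous₂_norm_le _ (by positivity) _).trans_eq ?_
  ring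

/-- The coordinates `(⟨hᵢ, u⟩)ᵢ`. -/
def gram {k : ℕ} (h : Fin k → CMSpace T d) : (Fin N → ℝ) →L[ℝ] (Fin k → ℝ) :=
  ContinuousLinearMap.pi fun i => innerSL ℝ (h i) ∘L B.lift

lemma gram_eq_sum {k : ℕ} (h : Fin k → CMSpace T d) (u : Fin N → ℝ) :
    B.gram h u = ∑ i, ⟪h i, B.lift u⟫_ℝ • (Pi.single i 1 : Fin k → ℝ) :=
  pi_eq_sum_univ' _

lemma inner_gradCLM {k : ℕ} (h : Fin k → CMSpace T d) (l : (Fin k → ℝ) →L[ℝ] ℝ) (u : Fin N → ℝ) :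
    ⟪gradCLM h l, B.lift u⟫_ℝ = l (B.gram h u) := by
  rw [gradCLM_apply, gram_eq_sum, sum_inner, map_sum]
  refine Finset.sum_congr rfl fun i _ => ?_
  rw [real_inner_smul_left, map_smul, smul_eq_mul, mul_comm]

lemma inner_grad₂CLM {k : ℕ} (h : Fin k → CMSpace T d) (q : (Fin k → ℝ) →L[ℝ] (Fin k → ℝ) →L[ℝ] ℝ)
    (u u' : Fin N → ℝ) :
    ⟪grad₂CLM h q, cmTmul (B.lift u') (B.lift u)⟫_ℝ = q (B.gram h u) (B.gram h u') := by
  rw [grad₂CLM_apply, B.gram_eq_sum h u', map_sum, sum_inner]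
  refine Finset.sum_congr rfl fun i _ => ?_
  rw [map_smul, B.gram_eq_sum h u, map_sum, sum_apply, sum_inner, Finset.smul_sum]
  refine Finset.sum_congr rfl fun j _ => ?_
  rw [real_inner_smul_left, inner_cmTmul_cmTmul, map_smul, smul_apply, smul_eq_mul, smul_eq_mul]
  ring

lemma _root_.Cylindrical.exists_bounds (Φ : Cylindrical μ) : ∃ C, ∀ v, ‖Φ.f v‖ ≤ C ∧
    ‖fderiv ℝ (fun w => Φ.f w) v‖ ≤ C ∧ ‖fderiv ℝ (fderiv ℝ fun w => Φ.f w) v‖ ≤ C := by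
  obtain ⟨C0, -, h0⟩ := Φ.f.decay 0 0
  obtain ⟨C1, -, h1⟩ := Φ.f.decay 0 1
  obtain ⟨C2, -, h2⟩ := Φ.f.decay 0 2
  refine ⟨max C0 (max C1 C2), fun v => ⟨?_, ?_, ?_⟩⟩
  · have := h0 v
    rw [pow_zero, one_mul, norm_iteratedFDeriv_zero] at this
    exact this.trans (le_max_left _ _)
  · have := h1 v
    rw [pow_zero, one_mul, norm_iteratedFDeriv_one] at this
    exact this.trans ((le_max_left _ _).trans (le_max_right _ _))
  · have := h2 v
    rw [pow_zero, one_mul, norm_iteratedFDeriv_two] at this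
    exact this.trans ((le_max_right _ _).trans (le_max_right _ _))

lemma _root_.Cylindrical.memLp_toFun [IsProbabilityMeasure μ] (Φ : Cylindrical μ) :
    MemLp Φ.toFun 2 μ := by
  obtain ⟨C, hC⟩ := Φ.exists_bounds
  exact MemLp.of_bound Φ.aestronglyMeasurable_toFun C (Eventually.of_forall fun x => (hC _).1)

lemma _root_.Cylindrical.memLp_grad [IsProbabilityMeasure μ] (Φ : Cylindrical μ) :
    MemLp Φ.grad 2 μ := by
  obtain ⟨C, hC⟩ := Φ.exists_bounds
  refine MemLp.of_bound Φ.aestronglyMeasurable_grad (‖gradCLM Φ.h‖ * C)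
    (Eventually.of_forall fun x => ?_)
  rw [Φ.grad_eq]
  refine ((gradCLM Φ.h).le_opNorm _).trans ?_
  gcongr
  exact (hC _).2.1

lemma _root_.Cylindrical.memLp_grad₂ [IsProbabilityMeasure μ] (Φ : Cylindrical μ) :
    MemLp Φ.grad₂ 2 μ := by
  obtain ⟨C, hC⟩ := Φ.exists_bounds
  obtain ⟨C', hC', h'⟩ := exists_norm_grad₂CLM_le Φ.h
  refine MemLp.of_bound Φ.aestronglyMeasurable_grad₂ (C' * C) (Eventually.of_forall fun x => ?_)
  rw [Φ.grad₂_eq]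
  refine (h' _).trans ?_
  gcongr
  exact (hC _).2.2

section

variable (hμ : IsWienerMeasure μ) (hT : 0 < T) {a b : ℝ} (hb : b ≠ 0) (hab : a ^ 2 + b ^ 2 = 1)
include hμ hT hb hab

lemma vec_mehler (Φ : Cylindrical μ) (v : Fin N → ℝ) :
    ∀ᵐ x ∂μ, Φ.vec (B.mehler a b v x) = (a • B.gram Φ.h) v + Φ.vec (B.scale b x) := by
  filter_upwards [ae_all_iff.2 fun i =>
    B.wienerIntegral_mehler hμ hT hb hab (Φ.isWienerIntegral i) v] with x hx
  ext i
  exact hx i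

lemma aestronglyMeasurable_vec_scale (Φ : Cylindrical μ) :
    AEStronglyMeasurable (fun x => Φ.vec (B.scale b x)) μ := by
  have hs : ∀ x, B.scale b x = B.mehler a b 0 x := fun x => by simp [mehler]
  simp_rw [hs]
  exact Φ.aestronglyMeasurable_vec.comp_quasiMeasurePreserving
    (B.quasiMeasurePreserving_mehler hμ hT hb hab 0)

/-- By the Cameron–Martin shift, v enters the average only as a translation by a · gram(v) inside
the Schwartz function, so one may differentiate under the integral. -/
lemma hasFDerivAt_avg_toFun (Φ : Cylindrical μ) (v : Fin N → ℝ) :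
    HasFDerivAt (B.avg μ a b Φ.toFun) (B.slope a (B.avg μ a b Φ.grad v)) v := by
  have := hμ.isProbabilityMeasure
  obtain ⟨C, hC⟩ := Φ.exists_bounds
  have hY := B.aestronglyMeasurable_vec_scale hμ hT hb hab Φ
  have h1 := (hasFDerivAt_integral_translate (Φ.f.smooth 1) (fun v => (hC v).1)
    (fun v => (hC v).2.1) hY ((a • B.gram Φ.h) v)).comp v (a • B.gram Φ.h).hasFDerivAt
  have e0 : B.avg μ a b Φ.toFun = (fun w => ∫ x, Φ.f (w + Φ.vec (B.scale b x)) ∂μ) ∘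
      (a • B.gram Φ.h) := by
    ext w
    refine integral_congr_ae ?_
    filter_upwards [B.vec_mehler hμ hT hb hab Φ w] with x hx
    rw [Cylindrical.toFun, hx]
  rw [e0]
  refine h1.congr_fderiv ?_
  ext u : 1
  symm
  rw [slope_apply, ContinuousLinearMap.comp_apply]
  have hi : Integrable (fun x => fderiv ℝ (fun w => Φ.f w)
      ((a • B.gram Φ.h) v + Φ.vec (B.scale b x))) μ :=
    Integrable.of_bound (Φ.continuous_fderiv.comp_aestronglyMeasurable
      (aestronglyMeasurable_const.add hY)) C (Eventually.of_forall fun x => (hC _).2.1)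
  rw [ContinuousLinearMap.integral_apply hi, avg, real_inner_comm,
    ← integral_inner (B.integrable_mehler hμ hT hb hab Φ.memLp_grad v), ← integral_const_mul]
  refine integral_congr_ae ?_
  filter_upwards [B.vec_mehler hμ hT hb hab Φ v] with x hx
  rw [real_inner_comm, Φ.grad_eq, inner_gradCLM, hx]
  simp only [smul_apply, map_smul, smul_eq_mul]

set_option maxSynthPendingDepth 3 in
lemma hasFDerivAt_avg_grad (Φ : Cylindrical μ) (v : Fin N → ℝ) :
    HasFDerivAt (fun v => B.slope a (B.avg μ a b Φ.grad v))
      (B.hess a (B.avg μ a b Φ.grad₂ v)) v := by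
  have := hμ.isProbabilityMeasure
  obtain ⟨C, hC⟩ := Φ.exists_bounds
  have hY := B.aestronglyMeasurable_vec_scale hμ hT hb hab Φ
  have hcd : ContDiff ℝ 1 (fderiv ℝ fun w => Φ.f w) :=
    (Φ.f.smooth 2).fderiv_right (m := 1) (by norm_num)
  have hi : ∀ v, Integrable (fun x => fderiv ℝ (fun w => Φ.f w)
      ((a • B.gram Φ.h) v + Φ.vec (B.scale b x))) μ := fun v =>
    Integrable.of_bound (Φ.continuous_fderiv.comp_aestronglyMeasurable
      (aestronglyMeasurable_const.add hY)) C (Eventually.of_forall fun x => (hC _).2.1)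
  have hi2 : ∀ v, Integrable (fun x => fderiv ℝ (fderiv ℝ fun w => Φ.f w)
      ((a • B.gram Φ.h) v + Φ.vec (B.scale b x))) μ := fun v =>
    Integrable.of_bound (Φ.continuous_fderiv_fderiv.comp_aestronglyMeasurable
      (aestronglyMeasurable_const.add hY)) C (Eventually.of_forall fun x => (hC _).2.2)
  have h1 := (hasFDerivAt_integral_translate hcd (fun v => (hC v).2.1)
    (fun v => (hC v).2.2) hY ((a • B.gram Φ.h) v)).comp v (a • B.gram Φ.h).hasFDerivAt
  let R : ((Fin Φ.k → ℝ) →L[ℝ] ℝ) →L[ℝ] ((Fin N → ℝ) →L[ℝ] ℝ) :=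
    ContinuousLinearMap.precomp ℝ (a • B.gram Φ.h)
  have h2 := R.hasFDerivAt.comp v h1
  have e0 : (fun v => B.slope a (B.avg μ a b Φ.grad v)) = R ∘ ((fun w => ∫ x, fderiv ℝ
      (fun w => Φ.f w) (w + Φ.vec (B.scale b x)) ∂μ) ∘ (a • B.gram Φ.h)) := by
    ext w u
    change _ = (∫ x, fderiv ℝ (fun w => Φ.f w) ((a • B.gram Φ.h) w + Φ.vec (B.scale b x)) ∂μ)
      ((a • B.gram Φ.h) u)
    rw [ContinuousLinearMap.integral_apply (hi w), slope_apply, avg, real_inner_comm,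
      ← integral_inner (B.integrable_mehler hμ hT hb hab Φ.memLp_grad w), ← integral_const_mul]
    refine integral_congr_ae ?_
    filter_upwards [B.vec_mehler hμ hT hb hab Φ w] with x hx
    rw [real_inner_comm, Φ.grad_eq, inner_gradCLM, hx]
    simp only [smul_apply, map_smul, smul_eq_mul]
  rw [e0]
  refine h2.congr_fderiv ?_
  ext u u' : 2
  symm
  change _ = (∫ x, fderiv ℝ (fderiv ℝ fun w => Φ.f w)
    ((a • B.gram Φ.h) v + Φ.vec (B.scale b x)) ∂μ) ((a • B.gram Φ.h) u) ((a • B.gram Φ.h) u')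
  rw [ContinuousLinearMap.integral_apply (hi2 v),
    ContinuousLinearMap.integral_apply ((hi2 v).apply_continuousLinearMap _), hess_apply, avg,
    real_inner_comm, ← integral_inner (B.integrable_mehler hμ hT hb hab Φ.memLp_grad₂ v),
    ← integral_const_mul]
  refine integral_congr_ae ?_
  filter_upwards [B.vec_mehler hμ hT hb hab Φ v] with x hx
  rw [real_inner_comm, Φ.grad₂_eq, inner_grad₂CLM, hx]
  simp only [smul_apply, map_smul, smul_eq_mul]
  ring

variable {F : PathSpace T d → ℝ} {G₁ : PathSpace T d → CMSpace T d}
  {G₂ : PathSpace T d → CMTensor T d} (hF : HasGrossSobolevGradients μ F G₁ G₂)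
include hF

/-- Averages of the cylindrical approximations and their derivatives converge locally uniformly in
v. So the weak gradient of F becomes a classical derivative after averaging. -/
lemma hasFDerivAt_avg (v : Fin N → ℝ) :
    HasFDerivAt (B.avg μ a b F) (B.slope a (B.avg μ a b G₁ v)) v := by
  have := hμ.isProbabilityMeasure
  obtain ⟨hFm, h₁m, h₂m, Φ, t0, t1, t2⟩ := hF
  refine hasFDerivAt_of_locally_uniform (B.continuous_densityBound b)
    (ENNReal.toReal_zero ▸ (ENNReal.tendsto_toReal ENNReal.zero_ne_top).comp t0)
    (mul_zero (|a| * ‖B.lift‖) ▸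
      ((ENNReal.toReal_zero ▸ (ENNReal.tendsto_toReal ENNReal.zero_ne_top).comp t1).const_mul
      (|a| * ‖B.lift‖)))
    (fun n v => B.hasFDerivAt_avg_toFun hμ hT hb hab (Φ n) v)
    (fun n v => B.norm_avg_sub_le hμ hT hb hab (Φ n).memLp_toFun hFm v)
    (fun n v => (B.norm_slope_sub_le a _ _).trans ?_) v
  rw [mul_left_comm]
  gcongr
  exact B.norm_avg_sub_le hμ hT hb hab (Φ n).memLp_grad h₁m v

set_option maxSynthPendingDepth 3 in
lemma hasFDerivAt_slope_avg (v : Fin N → ℝ) :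
    HasFDerivAt (fun v => B.slope a (B.avg μ a b G₁ v)) (B.hess a (B.avg μ a b G₂ v)) v := by
  have := hμ.isProbabilityMeasure
  obtain ⟨hFm, h₁m, h₂m, Φ, t0, t1, t2⟩ := hF
  refine hasFDerivAt_of_locally_uniform (B.continuous_densityBound b)
    (mul_zero (|a| * ‖B.lift‖) ▸
      ((ENNReal.toReal_zero ▸ (ENNReal.tendsto_toReal ENNReal.zero_ne_top).comp t1).const_mul
      (|a| * ‖B.lift‖)))
    (mul_zero (a ^ 2 * (‖B.lift‖ * ‖B.lift‖)) ▸
      ((ENNReal.toReal_zero ▸ (ENNReal.tendsto_toReal ENNReal.zero_ne_top).comp t2).const_mul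
      (a ^ 2 * (‖B.lift‖ * ‖B.lift‖))))
    (fun n v => B.hasFDerivAt_avg_grad hμ hT hb hab (Φ n) v)
    (fun n v => (B.norm_slope_sub_le a _ _).trans ?_)
    (fun n v => (B.norm_hess_sub_le a _ _).trans ?_) v
  · rw [mul_left_comm]
    gcongr
    exact B.norm_avg_sub_le hμ hT hb hab (Φ n).memLp_grad h₁m v
  · exact (mul_le_mul_of_nonneg_left (B.norm_avg_sub_le hμ hT hb hab (Φ n).memLp_grad₂ h₂m v)
      (by positivity)).trans_eq (mul_left_comm _ _ _)

lemma fderiv_avg : fderiv ℝ (B.avg μ a b F) = fun v => B.slope a (B.avg μ a b G₁ v) :=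
  funext fun v => (B.hasFDerivAt_avg hμ hT hb hab hF v).fderiv

lemma fderiv_fderiv_avg :
    fderiv ℝ (fderiv ℝ (B.avg μ a b F)) = fun v => B.hess a (B.avg μ a b G₂ v) := by
  rw [B.fderiv_avg hμ hT hb hab hF]
  exact funext fun v => (B.hasFDerivAt_slope_avg hμ hT hb hab hF v).fderiv

set_option maxSynthPendingDepth 3 in
lemma contDiff_avg : ContDiff ℝ 2 (B.avg μ a b F) := by
  have h1 : Continuous fun v => B.hess a (B.avg μ a b G₂ v) := by
    have h2 := B.continuous_avg hμ hT hb hab hF.2.2.1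
    rw [continuous_iff_continuousAt] at h2 ⊢
    intro v
    rw [ContinuousAt, tendsto_iff_norm_sub_tendsto_zero]
    refine squeeze_zero (fun w => norm_nonneg _) (fun w => B.norm_hess_sub_le a _ _) ?_
    have h3 := tendsto_iff_norm_sub_tendsto_zero.1 (h2 v)
    simpa using h3.const_mul (a ^ 2 * (‖B.lift‖ * ‖B.lift‖))
  rw [show (2 : WithTop ℕ∞) = 1 + 1 by norm_num, contDiff_succ_iff_fderiv]
  refine ⟨fun v => (B.hasFDerivAt_avg hμ hT hb hab hF v).differentiableAt, by simp, ?_⟩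
  rw [contDiff_one_iff_fderiv]
  refine ⟨?_, ?_⟩
  · rw [B.fderiv_avg hμ hT hb hab hF]
    exact fun v => (B.hasFDerivAt_slope_avg hμ hT hb hab hF v).differentiableAt
  · rw [B.fderiv_fderiv_avg hμ hT hb hab hF]
    exact h1

end

end Frame

end

noncomputable section

/-! ### Convergence of averages along the grid frames -/

variable {T : ℝ} {d : ℕ} {μ : Measure (PathSpace T d)}

section

variable {V : Type*} [NormedAddCommGroup V] [NormedSpace ℝ V]

lemma enorm_integral_sq_le {Ω : Type*} [MeasurableSpace Ω] {ν : Measure Ω} [IsProbabilityMeasure ν]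
    {g : Ω → V} (hg : AEStronglyMeasurable g ν) :
    ‖∫ ω, g ω ∂ν‖ₑ ^ (2 : ℝ) ≤ ∫⁻ ω, ‖g ω‖ₑ ^ (2 : ℝ) ∂ν := by
  have h1 : ‖∫ ω, g ω ∂ν‖ₑ ≤ eLpNorm g 2 ν := by
    refine (enorm_integral_le_lintegral_enorm _).trans ?_
    rw [← eLpNorm_one_eq_lintegral_enorm]
    exact eLpNorm_le_eLpNorm_of_exponent_le (by norm_num) hg
  rw [eLpNorm_eq_lintegral_rpow_enorm_toReal (by norm_num) (by norm_num)] at h1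
  simp only [ENNReal.toReal_ofNat, one_div] at h1
  calc _ ≤ ((∫⁻ ω, ‖g ω‖ₑ ^ (2 : ℝ) ∂ν) ^ (2 : ℝ)⁻¹) ^ (2 : ℝ) := by gcongr
    _ = _ := by rw [← ENNReal.rpow_mul]; norm_num

namespace Frame

variable {N : ℕ} (B : Frame T d N) (hμ : IsWienerMeasure μ) (hT : 0 < T) {a b : ℝ} (hb : b ≠ 0)
  (hab : a ^ 2 + b ^ 2 = 1)
include hμ hT hb hab

/-- Jensen's inequality for the inner integral, followed by the invariance of μ under the rotation:
averaging is a contraction of L². -/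
lemma eLpNorm_avg_coord_le {G : PathSpace T d → V} (hG : MemLp G 2 μ) :
    eLpNorm (fun y => B.avg μ a b G (B.coord y)) 2 μ ≤ eLpNorm G 2 μ := by
  have := hμ.isProbabilityMeasure
  have hp := B.measurePreserving_mehler hμ hT hab
  have hGm : AEMeasurable (fun x => ‖G x‖ₑ ^ (2 : ℝ)) μ := hG.1.enorm.pow_const _
  rw [eLpNorm_eq_lintegral_rpow_enorm_toReal (by norm_num) (by norm_num),
    eLpNorm_eq_lintegral_rpow_enorm_toReal (by norm_num) (by norm_num)]
  simp only [ENNReal.toReal_ofNat, one_div]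
  gcongr ?_ ^ (2 : ℝ)⁻¹
  have hGm' : AEMeasurable (fun x => ‖G x‖ₑ ^ (2 : ℝ)) ((μ.prod μ).map
      fun p : PathSpace T d × PathSpace T d => B.mehler a b (B.coord p.1) p.2) := by
    rw [hp.map_eq]; exact hGm
  have h1 : ∫⁻ x, ‖G x‖ₑ ^ (2 : ℝ) ∂μ =
      ∫⁻ y, ∫⁻ x, ‖G (B.mehler a b (B.coord y) x)‖ₑ ^ (2 : ℝ) ∂μ ∂μ := by
    conv_lhs => rw [← hp.map_eq]
    rw [lintegral_map' hGm' hp.measurable.aemeasurable]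
    exact lintegral_prod _ (hGm'.comp_measurable hp.measurable)
  rw [h1]
  exact lintegral_mono fun y => enorm_integral_sq_le
    (B.memLp_mehler hμ hT hb hab (by norm_num) hG (B.coord y)).1

lemma aestronglyMeasurable_avg_coord {G : PathSpace T d → V} (hG : MemLp G 2 μ) :
    AEStronglyMeasurable (fun y => B.avg μ a b G (B.coord y)) μ := by
  have h1 := (B.continuous_avg hμ hT hb hab hG).comp B.coord.continuous
  exact h1.aestronglyMeasurable

lemma memLp_avg_coord {G : PathSpace T d → V} (hG : MemLp G 2 μ) :
    MemLp (fun y => B.avg μ a b G (B.coord y)) 2 μ :=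
  ⟨B.aestronglyMeasurable_avg_coord hμ hT hb hab hG,
    (B.eLpNorm_avg_coord_le hμ hT hb hab hG).trans_lt hG.2⟩

omit hb in
-- Rotation invariance again. The mean is the same for all frames and angles, which makes it the
-- reference value for the growth estimates.
lemma integral_avg_coord {G : PathSpace T d → V} (hG : MemLp G 2 μ) :
    ∫ y, B.avg μ a b G (B.coord y) ∂μ = ∫ x, G x ∂μ := by
  have := hμ.isProbabilityMeasure
  have hp := B.measurePreserving_mehler hμ hT hab
  have hGi : Integrable G μ := hG.integrable (by norm_num)
  have hGi' : Integrable (fun p : PathSpace T d × PathSpace T d =>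
      G (B.mehler a b (B.coord p.1) p.2)) (μ.prod μ) := hp.integrable_comp_of_integrable hGi
  rw [show (fun y => B.avg μ a b G (B.coord y)) =
    fun y => ∫ x, G (B.mehler a b (B.coord y) x) ∂μ from rfl, ← integral_prod _ hGi']
  have h1 : AEStronglyMeasurable G ((μ.prod μ).map
      fun p : PathSpace T d × PathSpace T d => B.mehler a b (B.coord p.1) p.2) := by
    rw [hp.map_eq]; exact hG.1
  conv_rhs => rw [← hp.map_eq]
  rw [integral_map hp.measurable.aemeasurable h1]

lemma avg_sub {G G' : PathSpace T d → V} (hG : MemLp G 2 μ) (hG' : MemLp G' 2 μ)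
    (v : Fin N → ℝ) :
    B.avg μ a b (fun x => G x - G' x) v = B.avg μ a b G v - B.avg μ a b G' v :=
  integral_sub (B.integrable_mehler hμ hT hb hab hG v) (B.integrable_mehler hμ hT hb hab hG' v)

end Frame

end

/-- `cos (1 / (n + 1))`. -/
def mixCos (n : ℕ) : ℝ := Real.cos (1 / ((n : ℝ) + 1))

/-- `sin (1 / (n + 1))`. -/
def mixSin (n : ℕ) : ℝ := Real.sin (1 / ((n : ℝ) + 1))

lemma mixCos_sq_add (n : ℕ) : mixCos n ^ 2 + mixSin n ^ 2 = 1 := Real.cos_sq_add_sin_sq _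

lemma mixSin_ne_zero (n : ℕ) : mixSin n ≠ 0 := by
  refine (Real.sin_pos_of_pos_of_lt_pi (by positivity) ?_).ne'
  have h1 : 1 / ((n : ℝ) + 1) ≤ 1 := by
    rw [div_le_one (by positivity)]; linarith [n.cast_nonneg (α := ℝ)]
  linarith [Real.pi_gt_three]

lemma abs_mixCos_le (n : ℕ) : |mixCos n| ≤ 1 := Real.abs_cos_le_one _

lemma tendsto_mixCos : Tendsto mixCos atTop (𝓝 1) := by
  have h := (Real.continuous_cos.tendsto 0).comp (tendsto_one_div_add_atTop_nhds_zero_nat (𝕜 := ℝ))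
  rwa [Real.cos_zero] at h

lemma tendsto_mixSin : Tendsto mixSin atTop (𝓝 0) := by
  have h := (Real.continuous_sin.tendsto 0).comp (tendsto_one_div_add_atTop_nhds_zero_nat (𝕜 := ℝ))
  rwa [Real.sin_zero] at h

/-- The average over the grid frame of `n + 1` intervals. -/
def gridAvg {V : Type*} [NormedAddCommGroup V] [NormedSpace ℝ V] (hT : 0 < T)
    (μ : Measure (PathSpace T d)) (n : ℕ) (G : PathSpace T d → V) (y : PathSpace T d) : V :=
  (gridFrame d hT (n + 1)).avg μ (mixCos n) (mixSin n) G ((gridFrame d hT (n + 1)).coord y)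

/-- In the limit a = 1, b = 0 and the projections become the identity: the part from y tends to y,
and x minus its projection tends to 0. -/
lemma tendsto_grid_mehler (hT : 0 < T) {x y : PathSpace T d} (hx : x (gridPt T hT 0 0) = 0)
    (hy : y (gridPt T hT 0 0) = 0) :
    Tendsto (fun n => (gridFrame d hT (n + 1)).mehler (mixCos n) (mixSin n)
      ((gridFrame d hT (n + 1)).coord y) x) atTop (𝓝 y) := by
  have hx' := (tendsto_add_atTop_iff_nat 1).2 (tendsto_gridFrame_proj hT x hx)
  have hy' := (tendsto_add_atTop_iff_nat 1).2 (tendsto_gridFrame_proj hT y hy)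
  have h1 := (tendsto_mixCos.smul hy').add ((tendsto_const_nhds (x := x)).sub
    (((tendsto_const_nhds (x := (1 : ℝ))).sub tendsto_mixSin).smul hx'))
  have h2 : (1 : ℝ) • y + (x - ((1 : ℝ) - 0) • x) = y := by module
  rw [h2] at h1
  refine h1.congr fun n => ?_
  rw [Frame.mehler, Frame.scale_apply, map_smul, Frame.proj_apply, Frame.proj_apply]

namespace IsWienerMeasure

variable {V : Type*} [NormedAddCommGroup V] [NormedSpace ℝ V]

lemma ae_start_zero (hμ : IsWienerMeasure μ) (hT : 0 < T) :
    ∀ᵐ x ∂μ, x (gridPt T hT 0 0) = 0 := by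
  filter_upwards [hμ.start_zero] with x hx
  exact hx _ (gridPt_zero hT 0)

lemma memLp_gridAvg (hμ : IsWienerMeasure μ) (hT : 0 < T) {G : PathSpace T d → V}
    (hG : MemLp G 2 μ) (n : ℕ) : MemLp (gridAvg hT μ n G) 2 μ :=
  (gridFrame d hT (n + 1)).memLp_avg_coord hμ hT (mixSin_ne_zero n) (mixCos_sq_add n) hG

variable [CompleteSpace V]

lemma tendsto_gridAvg_boundedContinuous (hμ : IsWienerMeasure μ) (hT : 0 < T)
    (φ : BoundedContinuousFunction (PathSpace T d) V) :
    Tendsto (fun n => eLpNorm (fun y => gridAvg hT μ n φ y - φ y) 2 μ) atTop (𝓝 0) := by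
  have := hμ.isProbabilityMeasure
  have hφm : MemLp φ 2 μ := MemLp.of_bound φ.continuous.aestronglyMeasurable ‖φ‖
    (Eventually.of_forall fun x => φ.norm_coe_le_norm x)
  refine (tendsto_eLpNorm_two_of_dominated (r := fun _ => ‖φ‖)
    (fun n => (hμ.memLp_gridAvg hT hφm n).1) (memLp_const _)
    (fun n => Eventually.of_forall fun y => ?_) ?_).2
  · refine (norm_integral_le_of_norm_le_const (Eventually.of_forall fun x =>
      φ.norm_coe_le_norm _)).trans_eq ?_
    simp
  · filter_upwards [hμ.ae_start_zero hT] with y hy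
    have h1 : φ y = ∫ _, φ y ∂μ := by simp
    rw [h1]
    refine tendsto_integral_of_dominated_convergence (fun _ => ‖φ‖) (fun n => ?_)
      (integrable_const _) (fun n => Eventually.of_forall fun x => φ.norm_coe_le_norm _) ?_
    · exact (φ.continuous.comp (Frame.continuous_mehler_right _ _ _ _)).aestronglyMeasurable
    · filter_upwards [hμ.ae_start_zero hT] with x hx
      exact (φ.continuous.tendsto y).comp (tendsto_grid_mehler hT hx hy)

/-- The averages converge to the function in `L²`. -/
lemma tendsto_gridAvg (hμ : IsWienerMeasure μ) (hT : 0 < T) {G : PathSpace T d → V}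
    (hG : MemLp G 2 μ) :
    Tendsto (fun n => eLpNorm (fun y => gridAvg hT μ n G y - G y) 2 μ) atTop (𝓝 0) := by
  have := hμ.isProbabilityMeasure
  rw [ENNReal.tendsto_nhds_zero]
  intro ε hε
  have hε2 : ε / 2 ≠ 0 := (ENNReal.half_pos hε.ne').ne'
  -- Averaging being a contraction of L², it suffices to treat the dense class of bounded continuous
  -- functions.
  obtain ⟨φ, hφ, hφm⟩ := hG.exists_boundedContinuous_eLpNorm_sub_le (by norm_num)
    (ε := ε / 2 / 2) (ENNReal.half_pos hε2).ne'
  filter_upwards [ENNReal.tendsto_nhds_zero.1 (hμ.tendsto_gridAvg_boundedContinuous hT φ)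
    (ε / 2) (ENNReal.half_pos hε.ne')] with n hn
  have hd : MemLp (fun x => G x - φ x) 2 μ := hG.sub hφm
  have h1 : eLpNorm (gridAvg hT μ n fun x => G x - φ x) 2 μ ≤ ε / 2 / 2 :=
    ((gridFrame d hT (n + 1)).eLpNorm_avg_coord_le hμ hT (mixSin_ne_zero n) (mixCos_sq_add n)
      hd).trans hφ
  have h2 : (gridAvg hT μ n fun x => G x - φ x) = fun y => gridAvg hT μ n G y - gridAvg hT μ n φ y :=
    funext fun y => (gridFrame d hT (n + 1)).avg_sub hμ hT (mixSin_ne_zero n) (mixCos_sq_add n)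
      hG hφm _
  have he : (fun y => gridAvg hT μ n G y - G y) = ((gridAvg hT μ n fun x => G x - φ x) -
      fun x => G x - φ x) + fun y => gridAvg hT μ n φ y - φ y := by
    ext y
    simp only [h2, Pi.add_apply, Pi.sub_apply]
    abel
  rw [he]
  refine (eLpNorm_add_le ((hμ.memLp_gridAvg hT hd n).1.sub hd.1)
    ((hμ.memLp_gridAvg hT hφm n).1.sub hφm.1) (by norm_num)).trans ?_
  calc _ ≤ (ε / 2 / 2 + ε / 2 / 2) + ε / 2 := by
        refine add_le_add ?_ hn
        exact (eLpNorm_sub_le (hμ.memLp_gridAvg hT hd n).1 hd.1 (by norm_num)).trans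
          (add_le_add h1 hφ)
    _ = ε := by rw [ENNReal.add_halves, ENNReal.add_halves]

end IsWienerMeasure

end

noncomputable section

/-! ### Growth of the averages -/

variable {T : ℝ} {d : ℕ} {μ : Measure (PathSpace T d)}

/-- The bound `|⟨G₂(x), h ⊗ k⟩ - ⟨G₂(x + g), h ⊗ k⟩| ≤ c ‖g‖ ‖h‖ ‖k‖` for a version `D` of `G₂`. -/
structure LipschitzForm (μ : Measure (PathSpace T d)) (c : ℝ) (G₂ : PathSpace T d → CMTensor T d)
    (D : PathSpace T d → L2Path T d →L[ℝ] L2Path T d →L[ℝ] ℝ) : Prop where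
  nonneg : 0 ≤ c
  version : ∀ᵐ x ∂μ, ∀ h k : CMSpace T d, D x (cmToL2 T d h) (cmToL2 T d k) = ⟪G₂ x, cmTmul h k⟫_ℝ
  lipschitz : ∀ (x : PathSpace T d) (g : CMSpace T d) (h k : L2Path T d),
    |D x h k - D (x + cmEmbed T d g) h k| ≤ c * ‖cmEmbed T d g‖ * ‖h‖ * ‖k‖

lemma abs_le_one_of_sq_add {a b : ℝ} (hab : a ^ 2 + b ^ 2 = 1) : |a| ≤ 1 := by
  rw [← sq_le_one_iff_abs_le_one]
  nlinarith [sq_nonneg b]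

/-- Only the derivative in the direction v − w is used, so bounds in terms of the sup norm of the
path of v − w survive without a loss depending on the frame dimension. -/
lemma norm_image_sub_le_of_segment {E V : Type*} [NormedAddCommGroup E] [NormedSpace ℝ E]
    [NormedAddCommGroup V] [NormedSpace ℝ V] {g : E → V} {g' : E → E →L[ℝ] V}
    (hg : ∀ v, HasFDerivAt g (g' v) v) {v w : E} {C : ℝ}
    (h : ∀ t ∈ Set.Icc (0 : ℝ) 1, ‖g' (w + t • (v - w)) (v - w)‖ ≤ C) : ‖g v - g w‖ ≤ C := by
  have h1 : ∀ t : ℝ, HasDerivAt (fun t : ℝ => g (w + t • (v - w)))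
      (g' (w + t • (v - w)) (v - w)) t := by
    intro t
    have h2 : HasDerivAt (fun t : ℝ => w + t • (v - w)) (v - w) t := by
      simpa using ((hasDerivAt_id t).smul_const (v - w)).const_add w
    exact (hg _).comp_hasDerivAt t h2
  have h3 := norm_image_sub_le_of_norm_deriv_le_segment_01' (C := C)
    (fun t _ => (h1 t).hasDerivWithinAt) (fun t ht => h t ⟨ht.1, ht.2.le⟩)
  simpa using h3

/-- `∫ (4 (1 + ‖x‖))ᵏ dμ`. -/
def momentConst (μ : Measure (PathSpace T d)) (k : ℕ) : ℝ := ∫ x, (4 * (1 + ‖x‖)) ^ k ∂μ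

lemma momentConst_nonneg (μ : Measure (PathSpace T d)) (k : ℕ) : 0 ≤ momentConst μ k :=
  integral_nonneg fun x => by positivity

namespace Frame

variable {N : ℕ} (B : Frame T d N)

/-- Integrate the difference bound over w = coord y, using 1 + ‖p‖ + 4‖y‖ ≤ (1 + ‖p‖) · 4(1 + ‖y‖)
with p the path of v. The dependence on y integrates to `momentConst`, which does not see the frame.
-/
lemma abs_sub_integral_coord_le (hμ : IsWienerMeasure μ) (hT : 0 < T)
    (hB : ∀ x, ‖B.proj x‖ ≤ 4 * ‖x‖) {f : (Fin N → ℝ) → ℝ}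
    (hf : Integrable (fun y => f (B.coord y)) μ) {L : ℝ} (hL : 0 ≤ L) {k : ℕ} {v : Fin N → ℝ}
    (h : ∀ w, |f v - f w| ≤ L * (1 + ‖B.path v‖ + ‖B.path w‖) ^ k) :
    |f v - ∫ y, f (B.coord y) ∂μ| ≤ L * momentConst μ k * (1 + ‖B.path v‖) ^ k := by
  have := hμ.isProbabilityMeasure
  have h1 : f v - ∫ y, f (B.coord y) ∂μ = ∫ y, (f v - f (B.coord y)) ∂μ := by
    rw [integral_sub (integrable_const _) hf]
    simp
  rw [h1, ← Real.norm_eq_abs]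
  have hi : Integrable (fun y : PathSpace T d => (4 * (1 + ‖y‖)) ^ k) μ := by
    simp_rw [mul_pow]
    exact (hμ.integrable_one_add_norm_pow hT k).const_mul _
  refine (norm_integral_le_of_norm_le (g := fun y => L * (1 + ‖B.path v‖) ^ k *
    (4 * (1 + ‖y‖)) ^ k) (hi.const_mul _) (Eventually.of_forall fun y => ?_)).trans_eq ?_
  · refine (h (B.coord y)).trans ?_
    rw [mul_assoc, ← mul_pow]
    gcongr
    rw [← proj_apply]
    have h2 := hB y
    nlinarith [norm_nonneg (B.path v), norm_nonneg y,
      mul_nonneg (norm_nonneg (B.path v)) (norm_nonneg y)]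
  · rw [integral_const_mul, momentConst]
    ring

lemma norm_cmToL2_lift_le (u : Fin N → ℝ) :
    ‖cmToL2 T d (B.lift u)‖ ≤ ‖pathToL2 T d‖ * ‖B.path u‖ := by
  rw [cmToL2_eq, ← path_apply]
  exact (pathToL2 T d).le_opNorm _

lemma norm_path_segment_le (v w : Fin N → ℝ) {t : ℝ} (ht : t ∈ Set.Icc (0 : ℝ) 1) :
    ‖B.path (w + t • (v - w))‖ ≤ ‖B.path v‖ + ‖B.path w‖ := by
  have h1 : w + t • (v - w) = t • v + (1 - t) • w := by module
  rw [h1, map_add, map_smul, map_smul]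
  refine (norm_add_le _ _).trans ?_
  rw [norm_smul, norm_smul, Real.norm_of_nonneg ht.1, Real.norm_of_nonneg (by linarith [ht.2])]
  have h2 := norm_nonneg (B.path v)
  have h3 := norm_nonneg (B.path w)
  nlinarith [ht.1, ht.2]

variable (hμ : IsWienerMeasure μ) (hT : 0 < T) {a b : ℝ} (hb : b ≠ 0) (hab : a ^ 2 + b ^ 2 = 1)
include hμ hT hb hab

variable {c : ℝ} {G₂ : PathSpace T d → CMTensor T d}
  {D : PathSpace T d → L2Path T d →L[ℝ] L2Path T d →L[ℝ] ℝ}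

/-- For the same x, the rotated paths for v and w differ by the Cameron–Martin path of a(v − w), so
the Lipschitz condition applies under the integral. G₂ may be replaced by D at both paths because
the Mehler maps are quasi-measure-preserving. -/
lemma abs_inner_avg_sub_le (h₂ : MemLp G₂ 2 μ) (hD : LipschitzForm μ c G₂ D) (v w : Fin N → ℝ)
    (h k : CMSpace T d) :
    |⟪B.avg μ a b G₂ v, cmTmul h k⟫_ℝ - ⟪B.avg μ a b G₂ w, cmTmul h k⟫_ℝ| ≤
      c * ‖B.path (v - w)‖ * ‖cmToL2 T d h‖ * ‖cmToL2 T d k‖ := by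
  have := hμ.isProbabilityMeasure
  have e : ∀ v, ⟪B.avg μ a b G₂ v, cmTmul h k⟫_ℝ =
      ∫ x, ⟪cmTmul h k, G₂ (B.mehler a b v x)⟫_ℝ ∂μ := by
    intro v
    rw [real_inner_comm, avg, ← integral_inner (B.integrable_mehler hμ hT hb hab h₂ v)]
  have hi : ∀ v, Integrable (fun x => ⟪cmTmul h k, G₂ (B.mehler a b v x)⟫_ℝ) μ := fun v =>
    (B.integrable_mehler hμ hT hb hab h₂ v).const_inner _
  rw [e, e, ← integral_sub (hi v) (hi w), ← Real.norm_eq_abs]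
  refine (norm_integral_le_of_norm_le_const (C := c * ‖B.path (v - w)‖ * ‖cmToL2 T d h‖ *
    ‖cmToL2 T d k‖) ?_).trans_eq (by simp)
  filter_upwards [(B.quasiMeasurePreserving_mehler hμ hT hb hab v).ae hD.version,
    (B.quasiMeasurePreserving_mehler hμ hT hb hab w).ae hD.version] with x hv hw
  rw [real_inner_comm, ← hv h k, real_inner_comm, ← hw h k, Real.norm_eq_abs, abs_sub_comm]
  have h1 : B.mehler a b v x = B.mehler a b w x + cmEmbed T d (B.lift (a • (v - w))) := by
    rw [← path_apply, mehler, mehler, smul_sub, map_sub]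
    abel
  rw [h1]
  refine (hD.lipschitz _ _ _ _).trans ?_
  have h2 : ‖cmEmbed T d (B.lift (a • (v - w)))‖ ≤ ‖B.path (v - w)‖ := by
    rw [← path_apply, map_smul, norm_smul, Real.norm_eq_abs]
    exact mul_le_of_le_one_left (norm_nonneg _) (abs_le_one_of_sq_add hab)
  have := hD.nonneg
  gcongr

lemma abs_inner_avg_le (h₂ : MemLp G₂ 2 μ) (hD : LipschitzForm μ c G₂ D)
    (hB : ∀ x, ‖B.proj x‖ ≤ 4 * ‖x‖) {C : ℝ} (hC : ∀ h k : CMSpace T d,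
      |⟪∫ x, G₂ x ∂μ, cmTmul h k⟫_ℝ| ≤ C * ‖cmToL2 T d h‖ * ‖cmToL2 T d k‖) (hC0 : 0 ≤ C)
    (v : Fin N → ℝ) (h k : CMSpace T d) :
    |⟪B.avg μ a b G₂ v, cmTmul h k⟫_ℝ| ≤
      (C + c * momentConst μ 1) * (1 + ‖B.path v‖) * ‖cmToL2 T d h‖ * ‖cmToL2 T d k‖ := by
  have := hμ.isProbabilityMeasure
  have hc := hD.nonneg
  have hi : Integrable (fun y => B.avg μ a b G₂ (B.coord y)) μ :=
    (B.memLp_avg_coord hμ hT hb hab h₂).integrable (by norm_num)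
  have h1 := B.abs_sub_integral_coord_le hμ hT hB (k := 1) (v := v)
    (f := fun v => ⟪B.avg μ a b G₂ v, cmTmul h k⟫_ℝ) (hi.inner_const _)
    (L := c * ‖cmToL2 T d h‖ * ‖cmToL2 T d k‖) (by positivity) (fun w => by
      refine (B.abs_inner_avg_sub_le hμ hT hb hab h₂ hD v w h k).trans ?_
      have h2 : ‖B.path (v - w)‖ ≤ 1 + ‖B.path v‖ + ‖B.path w‖ := by
        rw [map_sub]; linarith [norm_sub_le (B.path v) (B.path w)]
      calc _ ≤ c * (1 + ‖B.path v‖ + ‖B.path w‖) * ‖cmToL2 T d h‖ * ‖cmToL2 T d k‖ := by gcongr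
        _ = _ := by ring)
  have h3 : ∫ y, ⟪B.avg μ a b G₂ (B.coord y), cmTmul h k⟫_ℝ ∂μ =
      ⟪∫ x, G₂ x ∂μ, cmTmul h k⟫_ℝ := by
    rw [← B.integral_avg_coord hμ hT hab h₂, real_inner_comm, ← integral_inner hi]
    simp_rw [real_inner_comm]
  rw [h3] at h1
  have h4 := hC h k
  have h5 := abs_sub_abs_le_abs_sub ⟪B.avg μ a b G₂ v, cmTmul h k⟫_ℝ
    ⟪∫ x, G₂ x ∂μ, cmTmul h k⟫_ℝ
  have h6 : C * ‖cmToL2 T d h‖ * ‖cmToL2 T d k‖ ≤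
      C * (1 + ‖B.path v‖) * ‖cmToL2 T d h‖ * ‖cmToL2 T d k‖ := by
    gcongr
    exact le_mul_of_one_le_right hC0 (by linarith [norm_nonneg (B.path v)])
  rw [pow_one] at h1
  nlinarith [h1, h4, h5, h6]

variable {F : PathSpace T d → ℝ} {G₁ : PathSpace T d → CMSpace T d}
  (hF : HasGrossSobolevGradients μ F G₁ G₂)
include hF

/-- The averaged gradient differs from its mean by a quadratic bound. -/
lemma abs_slope_sub_le (hB : ∀ x, ‖B.proj x‖ ≤ 4 * ‖x‖) {K : ℝ} (hK0 : 0 ≤ K)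
    (hK : ∀ (v : Fin N → ℝ) (h k : CMSpace T d), |⟪B.avg μ a b G₂ v, cmTmul h k⟫_ℝ| ≤
      K * (1 + ‖B.path v‖) * ‖cmToL2 T d h‖ * ‖cmToL2 T d k‖) (v u : Fin N → ℝ) :
    |B.slope a (B.avg μ a b G₁ v) u - B.slope a (∫ x, G₁ x ∂μ) u| ≤
      K * ‖pathToL2 T d‖ ^ 2 * momentConst μ 2 * (1 + ‖B.path v‖) ^ 2 * ‖B.path u‖ := by
  have := hμ.isProbabilityMeasure
  have hi : Integrable (fun y => B.avg μ a b G₁ (B.coord y)) μ :=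
    (B.memLp_avg_coord hμ hT hb hab hF.2.1).integrable (by norm_num)
  have hder : ∀ v, HasFDerivAt (fun v => B.slope a (B.avg μ a b G₁ v) u)
      ((B.hess a (B.avg μ a b G₂ v)).flip u) v := fun v =>
    ((ContinuousLinearMap.apply ℝ ℝ u).hasFDerivAt.comp v
      (B.hasFDerivAt_slope_avg hμ hT hb hab hF v)).congr_fderiv (by ext; rfl)
  -- Linear growth of the averaged second gradient along the segment, times the sup norm of the path
  -- of v − w, gives the exponent 2.
  have h1 := B.abs_sub_integral_coord_le hμ hT hB (k := 2) (v := v)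
    (f := fun v => B.slope a (B.avg μ a b G₁ v) u) ((hi.inner_const _).const_mul a)
    (L := K * ‖pathToL2 T d‖ ^ 2 * ‖B.path u‖) (by positivity) (fun w => by
      rw [← Real.norm_eq_abs]
      refine norm_image_sub_le_of_segment hder fun t ht => ?_
      rw [ContinuousLinearMap.flip_apply, hess_apply, norm_mul, Real.norm_of_nonneg (sq_nonneg a),
        Real.norm_eq_abs]
      have ha : a ^ 2 ≤ 1 := by nlinarith [sq_nonneg b]
      have hp : ‖B.path (v - w)‖ ≤ 1 + ‖B.path v‖ + ‖B.path w‖ := by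
        rw [map_sub]; linarith [norm_sub_le (B.path v) (B.path w)]
      calc _ ≤ 1 * (K * (1 + (‖B.path v‖ + ‖B.path w‖)) * (‖pathToL2 T d‖ * ‖B.path u‖) *
            (‖pathToL2 T d‖ * (1 + ‖B.path v‖ + ‖B.path w‖))) := by
            gcongr
            refine (hK _ _ _).trans ?_
            gcongr
            · exact B.norm_path_segment_le v w ht
            · exact B.norm_cmToL2_lift_le u
            · exact (B.norm_cmToL2_lift_le _).trans (by gcongr)
        _ = _ := by ring)
  have h3 : ∫ y, B.slope a (B.avg μ a b G₁ (B.coord y)) u ∂μ = B.slope a (∫ x, G₁ x ∂μ) u := by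
    simp_rw [slope_apply]
    rw [integral_const_mul, ← B.integral_avg_coord hμ hT hab hF.2.1, real_inner_comm,
      ← integral_inner hi]
    simp_rw [real_inner_comm]
  rw [h3] at h1
  refine h1.trans_eq ?_
  ring

/-- Up to its linear part, the averaged function has cubic growth. -/
lemma abs_avg_sub_slope_le (hB : ∀ x, ‖B.proj x‖ ≤ 4 * ‖x‖) {K : ℝ} (hK0 : 0 ≤ K)
    (hK : ∀ v u : Fin N → ℝ, |B.slope a (B.avg μ a b G₁ v) u - B.slope a (∫ x, G₁ x ∂μ) u| ≤
      K * (1 + ‖B.path v‖) ^ 2 * ‖B.path u‖) (v : Fin N → ℝ) :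
    |B.avg μ a b F v - B.slope a (∫ x, G₁ x ∂μ) v| ≤
      (|∫ x, F x ∂μ| + K * momentConst μ 3) * (1 + ‖B.path v‖) ^ 3 := by
  have := hμ.isProbabilityMeasure
  have hi : Integrable (fun y => B.avg μ a b F (B.coord y)) μ :=
    (B.memLp_avg_coord hμ hT hb hab hF.1).integrable (by norm_num)
  have hi' : Integrable (fun y => B.slope a (∫ x, G₁ x ∂μ) (B.coord y)) μ :=
    ((hμ.memLp_dual hT (B.slope a (∫ x, G₁ x ∂μ) ∘L B.coord)).integrable (by norm_num))
  have hder : ∀ v, HasFDerivAt (fun v => B.avg μ a b F v - B.slope a (∫ x, G₁ x ∂μ) v)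
      (B.slope a (B.avg μ a b G₁ v) - B.slope a (∫ x, G₁ x ∂μ)) v := fun v =>
    (B.hasFDerivAt_avg hμ hT hb hab hF v).sub (B.slope a (∫ x, G₁ x ∂μ)).hasFDerivAt
  have h1 := B.abs_sub_integral_coord_le hμ hT hB (k := 3) (v := v)
    (f := fun v => B.avg μ a b F v - B.slope a (∫ x, G₁ x ∂μ) v) (hi.sub hi')
    (L := K) hK0 (fun w => by
      rw [← Real.norm_eq_abs]
      refine norm_image_sub_le_of_segment hder fun t ht => ?_
      rw [sub_apply, Real.norm_eq_abs]
      have hp : ‖B.path (v - w)‖ ≤ 1 + ‖B.path v‖ + ‖B.path w‖ := by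
        rw [map_sub]; linarith [norm_sub_le (B.path v) (B.path w)]
      calc _ ≤ K * (1 + (‖B.path v‖ + ‖B.path w‖)) ^ 2 * (1 + ‖B.path v‖ + ‖B.path w‖) := by
            refine (hK _ _).trans ?_
            gcongr
            exact B.norm_path_segment_le v w ht
        _ = _ := by ring)
  -- The subtracted linear part is a continuous functional, hence centred under μ, so the reference
  -- mean is still that of F.
  have h3 : ∫ y, (B.avg μ a b F (B.coord y) - B.slope a (∫ x, G₁ x ∂μ) (B.coord y)) ∂μ =
      ∫ x, F x ∂μ := by
    rw [integral_sub hi hi', B.integral_avg_coord hμ hT hab hF.1]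
    have := hμ.integral_dual hT (B.slope a (∫ x, G₁ x ∂μ) ∘L B.coord)
    simp only [ContinuousLinearMap.comp_apply] at this
    rw [this, sub_zero]
  rw [h3] at h1
  have h4 := abs_sub_abs_le_abs_sub (B.avg μ a b F v - B.slope a (∫ x, G₁ x ∂μ) v) (∫ x, F x ∂μ)
  have h5 : |∫ x, F x ∂μ| ≤ |∫ x, F x ∂μ| * (1 + ‖B.path v‖) ^ 3 :=
    le_mul_of_one_le_right (abs_nonneg _) (one_le_pow₀ (by linarith [norm_nonneg (B.path v)]))
  linarith

end Frame

end

noncomputable section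

/-! ### Uniform bounds along the grid frames -/

variable {T : ℝ} {d : ℕ} {μ : Measure (PathSpace T d)}
  {c : ℝ} {F : PathSpace T d → ℝ} {G₁ : PathSpace T d → CMSpace T d}
  {G₂ : PathSpace T d → CMTensor T d} {D : PathSpace T d → L2Path T d →L[ℝ] L2Path T d →L[ℝ] ℝ}

lemma exists_seq_tendsto_ae_of_eLpNorm {α V : Type*} [MeasurableSpace α] [NormedAddCommGroup V]
    {ν : Measure α} {X : ℕ → α → V} {Y : α → V} (hX : ∀ n, AEStronglyMeasurable (X n) ν)
    (hY : AEStronglyMeasurable Y ν)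
    (h : Tendsto (fun n => eLpNorm (fun x => X n x - Y x) 2 ν) atTop (𝓝 0)) :
    ∃ ns : ℕ → ℕ, StrictMono ns ∧
      ∀ᵐ x ∂ν, Tendsto (fun i => X (ns i) x) atTop (𝓝 (Y x)) :=
  (tendstoInMeasure_of_tendsto_eLpNorm (p := 2) (by norm_num) hX hY h).exists_seq_tendsto_ae

namespace IsWienerMeasure

/-- A Lipschitz second gradient is almost everywhere Lipschitz for the sup norm. -/
lemma ae_bound_of_lipschitzForm (hμ : IsWienerMeasure μ) (hT : 0 < T) (h₂ : MemLp G₂ 2 μ)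
    (hD : LipschitzForm μ c G₂ D) : ∃ C, 0 ≤ C ∧ ∀ᵐ x ∂μ, ∀ h k : CMSpace T d,
      |⟪G₂ x, cmTmul h k⟫_ℝ| ≤ C * (1 + ‖x‖) * ‖cmToL2 T d h‖ * ‖cmToL2 T d k‖ := by
  have := hμ.isProbabilityMeasure
  have hc := hD.nonneg
  obtain ⟨ns, hns, hlim⟩ := exists_seq_tendsto_ae_of_eLpNorm
    (fun n => (hμ.memLp_gridAvg hT h₂ n).1) h₂.1 (hμ.tendsto_gridAvg hT h₂)
  have hns' : Tendsto (fun i => ns i + 1) atTop atTop :=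
    tendsto_atTop_mono (fun i => Nat.le_succ _) hns.tendsto_atTop
  -- One typical base point: there the averages converge, the path starts at 0, and D represents G₂.
  -- The given Lipschitz condition concerns shifts in H_T only; the comparison of two typical paths
  -- comes from the averages, whose increments are controlled by sup norms of projected paths.
  obtain ⟨x₀, hx₀, hz₀, hv₀⟩ := (hlim.and ((hμ.ae_start_zero hT).and hD.version)).exists
  refine ⟨‖D x₀‖ + c * (1 + ‖x₀‖), by positivity, ?_⟩
  filter_upwards [hlim, hμ.ae_start_zero hT] with x hx hz h k
  have h1 : |⟪G₂ x, cmTmul h k⟫_ℝ - ⟪G₂ x₀, cmTmul h k⟫_ℝ| ≤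
      c * ‖x - x₀‖ * ‖cmToL2 T d h‖ * ‖cmToL2 T d k‖ := by
    have hp := ((tendsto_gridFrame_proj hT x hz).sub (tendsto_gridFrame_proj hT x₀ hz₀)).comp hns'
    refine le_of_tendsto_of_tendsto
      ((hx.inner tendsto_const_nhds).sub (hx₀.inner tendsto_const_nhds)).abs
      (((hp.norm.const_mul c).mul_const _).mul_const _) (Eventually.of_forall fun i => ?_)
    refine (Frame.abs_inner_avg_sub_le _ hμ hT (mixSin_ne_zero (ns i)) (mixCos_sq_add (ns i)) h₂ hD
      _ _ h k).trans_eq ?_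
    rw [map_sub]
    rfl
  have h2 : |⟪G₂ x₀, cmTmul h k⟫_ℝ| ≤ ‖D x₀‖ * ‖cmToL2 T d h‖ * ‖cmToL2 T d k‖ := by
    rw [← hv₀ h k, ← Real.norm_eq_abs]
    exact (D x₀).le_opNorm₂ _ _
  have h3 := abs_sub_abs_le_abs_sub ⟪G₂ x, cmTmul h k⟫_ℝ ⟪G₂ x₀, cmTmul h k⟫_ℝ
  set P := ‖cmToL2 T d h‖ * ‖cmToL2 T d k‖ with hP
  have hP0 : 0 ≤ P := by positivity
  have h4 : ‖D x₀‖ + c * ‖x - x₀‖ ≤ (‖D x₀‖ + c * (1 + ‖x₀‖)) * (1 + ‖x‖) := by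
    have h5 : ‖x - x₀‖ ≤ (1 + ‖x₀‖) * (1 + ‖x‖) := by
      nlinarith [norm_sub_le x x₀, norm_nonneg x, norm_nonneg x₀,
        mul_nonneg (norm_nonneg x) (norm_nonneg x₀)]
    have h6 : ‖D x₀‖ ≤ ‖D x₀‖ * (1 + ‖x‖) :=
      le_mul_of_one_le_right (norm_nonneg (D x₀)) (by linarith [norm_nonneg x])
    nlinarith [mul_le_mul_of_nonneg_left h5 hc]
  calc |⟪G₂ x, cmTmul h k⟫_ℝ| ≤ (‖D x₀‖ + c * ‖x - x₀‖) * P := by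
        rw [mul_assoc] at h1 h2
        rw [add_mul]
        linarith
    _ ≤ (‖D x₀‖ + c * (1 + ‖x₀‖)) * (1 + ‖x‖) * P := by gcongr
    _ = _ := by rw [hP]; ring

/-- Integrating the almost-everywhere linear bound shows that the mean of G₂ is a bounded form on
L²; its constant is the starting value for the growth estimates. -/
lemma exists_bound_integral (hμ : IsWienerMeasure μ) (hT : 0 < T) (h₂ : MemLp G₂ 2 μ)
    (hD : LipschitzForm μ c G₂ D) : ∃ C, 0 ≤ C ∧ ∀ h k : CMSpace T d,
      |⟪∫ x, G₂ x ∂μ, cmTmul h k⟫_ℝ| ≤ C * ‖cmToL2 T d h‖ * ‖cmToL2 T d k‖ := by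
  have := hμ.isProbabilityMeasure
  obtain ⟨C, hC, hb⟩ := hμ.ae_bound_of_lipschitzForm hT h₂ hD
  refine ⟨C * ∫ x : PathSpace T d, (1 + ‖x‖) ^ 1 ∂μ,
    mul_nonneg hC (integral_nonneg fun x => by positivity), fun h k => ?_⟩
  rw [real_inner_comm, ← integral_inner (h₂.integrable (by norm_num)), ← Real.norm_eq_abs]
  refine (norm_integral_le_of_norm_le (g := fun x => C * ‖cmToL2 T d h‖ * ‖cmToL2 T d k‖ *
    (1 + ‖x‖) ^ 1) ((hμ.integrable_one_add_norm_pow hT 1).const_mul _) ?_).trans_eq ?_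
  · filter_upwards [hb] with x hx
    rw [real_inner_comm, Real.norm_eq_abs]
    refine (hx h k).trans_eq ?_
    ring
  · rw [integral_const_mul]
    ring

lemma norm_gridFrame_proj_succ_le (hT : 0 < T) (n : ℕ) (x : PathSpace T d) :
    ‖(gridFrame d hT (n + 1)).proj x‖ ≤ 4 * ‖x‖ :=
  norm_gridFrame_proj_le hT n.succ_pos x

/-- The bounds on the averages, uniform along the grid frames. -/
lemma exists_uniform_bounds (hμ : IsWienerMeasure μ) (hT : 0 < T)
    (hF : HasGrossSobolevGradients μ F G₁ G₂) (hD : LipschitzForm μ c G₂ D) :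
    ∃ K, 0 ≤ K ∧ ∀ n, ∀ B : Frame T d ((n + 1) * d), B = gridFrame d hT (n + 1) →
      ∀ v : Fin ((n + 1) * d) → ℝ,
      (∀ h k : CMSpace T d, |⟪B.avg μ (mixCos n) (mixSin n) G₂ v, cmTmul h k⟫_ℝ| ≤
        K * (1 + ‖B.path v‖) * ‖cmToL2 T d h‖ * ‖cmToL2 T d k‖) ∧
      (∀ u, |B.slope (mixCos n) (B.avg μ (mixCos n) (mixSin n) G₁ v) u -
        B.slope (mixCos n) (∫ x, G₁ x ∂μ) u| ≤ K * (1 + ‖B.path v‖) ^ 2 * ‖B.path u‖) ∧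
      |B.avg μ (mixCos n) (mixSin n) F v - B.slope (mixCos n) (∫ x, G₁ x ∂μ) v| ≤
        K * (1 + ‖B.path v‖) ^ 3 := by
  obtain ⟨C, hC0, hC⟩ := hμ.exists_bound_integral hT hF.2.2.1 hD
  have hc := hD.nonneg
  have m1 := momentConst_nonneg μ 1
  have m2 := momentConst_nonneg μ 2
  have m3 := momentConst_nonneg μ 3
  -- The constants are chained: K2 bounds the second gradient, feeds K1 for the gradient, which
  -- feeds K0 for the function. None involves n.
  set K2 := C + c * momentConst μ 1 with hK2
  have hK20 : 0 ≤ K2 := by positivity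
  set K1 := K2 * ‖pathToL2 T d‖ ^ 2 * momentConst μ 2 with hK1
  have hK10 : 0 ≤ K1 := by positivity
  set K0 := |∫ x, F x ∂μ| + K1 * momentConst μ 3 with hK0
  have hK00 : 0 ≤ K0 := by positivity
  obtain ⟨K, le2, le1, le0⟩ : ∃ K, K2 ≤ K ∧ K1 ≤ K ∧ K0 ≤ K :=
    ⟨K2 + K1 + K0, by linarith, by linarith, by linarith⟩
  refine ⟨K, hK20.trans le2, ?_⟩
  rintro n B hBeq v
  have hB : ∀ x, ‖B.proj x‖ ≤ 4 * ‖x‖ := fun x => hBeq ▸ norm_gridFrame_proj_succ_le hT n x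
  have hb := mixSin_ne_zero n
  have hab := mixCos_sq_add n
  have b2 := fun v h k => B.abs_inner_avg_le hμ hT hb hab hF.2.2.1 hD hB hC hC0 v h k
  have b1 := fun v u => B.abs_slope_sub_le hμ hT hb hab hF hB hK20 b2 v u
  have b0 := B.abs_avg_sub_slope_le hμ hT hb hab hF hB hK10 b1 v
  refine ⟨fun h k => (b2 v h k).trans ?_, fun u => (b1 v u).trans ?_, b0.trans ?_⟩
  · gcongr
  · gcongr
  · gcongr

end IsWienerMeasure

end

noncomputable section

/-! ### Composition with the solution operator: convergence -/

variable {T : ℝ} {d : ℕ} {μ : Measure (PathSpace T d)}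

section

variable {α V : Type*} [MeasurableSpace α] [NormedAddCommGroup V] {ν : Measure α}

/-- Almost-everywhere convergence along a subsequence can be composed with S, since null sets pull
back to null sets. L² convergence is then recovered by dominating X ∘ S − L; the part L, which has
no dominating function, converges in L² by assumption. -/
lemma exists_seq_tendsto_eLpNorm_comp {S : α → α} (hS : Measure.QuasiMeasurePreserving S ν ν)
    {X : ℕ → α → V} {Y : α → V} (hX : ∀ n, AEStronglyMeasurable (X n) ν)
    (hY : AEStronglyMeasurable Y ν)
    (h : Tendsto (fun n => eLpNorm (fun x => X n x - Y x) 2 ν) atTop (𝓝 0))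
    {L : ℕ → α → V} {M : α → V} (hL : ∀ n, AEStronglyMeasurable (L n) ν) (hM : MemLp M 2 ν)
    (hLM : Tendsto (fun n => eLpNorm (fun x => L n x - M x) 2 ν) atTop (𝓝 0))
    {r : α → ℝ} (hr : MemLp r 2 ν) (hb : ∀ n, ∀ᵐ x ∂ν, ‖X n (S x) - L n x‖ ≤ r x) :
    MemLp (fun x => Y (S x)) 2 ν ∧ ∃ ns : ℕ → ℕ,
      Tendsto (fun i => eLpNorm (fun x => X (ns i) (S x) - Y (S x)) 2 ν) atTop (𝓝 0) := by
  obtain ⟨ns, hns, hlim⟩ := exists_seq_tendsto_ae_of_eLpNorm hX hY h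
  obtain ⟨ms, hms, hlim'⟩ := exists_seq_tendsto_ae_of_eLpNorm (fun i => hL (ns i)) hM.1
    (hLM.comp hns.tendsto_atTop)
  have hXS : ∀ n, AEStronglyMeasurable (fun x => X n (S x)) ν := fun n =>
    (hX n).comp_quasiMeasurePreserving hS
  have hYS : AEStronglyMeasurable (fun x => Y (S x)) ν := hY.comp_quasiMeasurePreserving hS
  obtain ⟨m, t⟩ := tendsto_eLpNorm_two_of_dominated
    (f := fun i x => X (ns (ms i)) (S x) - L (ns (ms i)) x) (g := fun x => Y (S x) - M x)
    (fun i => (hXS _).sub (hL _)) hr (fun i => hb _) (by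
      filter_upwards [hS.ae hlim, hlim'] with x h1 h2
      exact (h1.comp hms.tendsto_atTop).sub h2)
  refine ⟨by simpa only [Pi.add_def, sub_add_cancel] using m.add hM, fun i => ns (ms i), ?_⟩
  have t2 := t.add (hLM.comp (hns.comp hms).tendsto_atTop)
  rw [add_zero] at t2
  refine tendsto_of_tendsto_of_tendsto_of_le_of_le tendsto_const_nhds t2 (fun _ => zero_le)
    fun i => ?_
  have he : (fun x => X (ns (ms i)) (S x) - Y (S x)) =
      (fun x => X (ns (ms i)) (S x) - L (ns (ms i)) x - (Y (S x) - M x)) +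
      fun x => L (ns (ms i)) x - M x := by
    ext x
    simp only [Pi.add_apply]
    abel
  simp only [he]
  exact eLpNorm_add_le (((hXS _).sub (hL _)).sub (hYS.sub hM.1)) ((hL _).sub hM.1) (by norm_num)

/-- Convergence in `L²` is preserved by a quasi-measure-preserving change of variable, if the
sequence is dominated up to a convergent sequence. -/
lemma tendsto_eLpNorm_comp {S : α → α} (hS : Measure.QuasiMeasurePreserving S ν ν)
    {X : ℕ → α → V} {Y : α → V} (hX : ∀ n, AEStronglyMeasurable (X n) ν)
    (hY : AEStronglyMeasurable Y ν)
    (h : Tendsto (fun n => eLpNorm (fun x => X n x - Y x) 2 ν) atTop (𝓝 0))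
    {L : ℕ → α → V} {M : α → V} (hL : ∀ n, AEStronglyMeasurable (L n) ν) (hM : MemLp M 2 ν)
    (hLM : Tendsto (fun n => eLpNorm (fun x => L n x - M x) 2 ν) atTop (𝓝 0))
    {r : α → ℝ} (hr : MemLp r 2 ν) (hb : ∀ n, ∀ᵐ x ∂ν, ‖X n (S x) - L n x‖ ≤ r x) :
    MemLp (fun x => Y (S x)) 2 ν ∧
      Tendsto (fun n => eLpNorm (fun x => X n (S x) - Y (S x)) 2 ν) atTop (𝓝 0) := by
  refine ⟨(exists_seq_tendsto_eLpNorm_comp hS hX hY h hL hM hLM hr hb).1, ?_⟩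
  -- The limit does not depend on the subsequence, so convergence along a further subsequence of
  -- each subsequence is enough.
  refine tendsto_of_subseq_tendsto fun ns hns => ?_
  exact (exists_seq_tendsto_eLpNorm_comp hS (fun n => hX (ns n)) hY (h.comp hns)
    (fun n => hL (ns n)) hM (hLM.comp hns) hr fun n => hb _).2

lemma tendsto_eLpNorm_clm [NormedSpace ℝ V] {P : ℕ → V →L[ℝ] V} (hP : ∀ n w, ‖P n w‖ ≤ ‖w‖)
    (hlim : ∀ w, Tendsto (fun n => P n w) atTop (𝓝 w)) {X : ℕ → α → V} {Y : α → V}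
    (hX : ∀ n, AEStronglyMeasurable (X n) ν) (hY : MemLp Y 2 ν)
    (h : Tendsto (fun n => eLpNorm (fun x => X n x - Y x) 2 ν) atTop (𝓝 0)) :
    Tendsto (fun n => eLpNorm (fun x => P n (X n x) - Y x) 2 ν) atTop (𝓝 0) := by
  have hPm : ∀ n {Z : α → V}, AEStronglyMeasurable Z ν →
      AEStronglyMeasurable (fun x => P n (Z x)) ν := fun n Z hZ =>
    (P n).continuous.comp_aestronglyMeasurable hZ
  have h1 := (tendsto_eLpNorm_two_of_dominated (f := fun n x => P n (Y x)) (g := Y)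
    (fun n => hPm n hY.1) hY.norm (fun n => Eventually.of_forall fun x => hP n _)
    (Eventually.of_forall fun x => hlim _)).2
  have h2 := h.add h1
  rw [add_zero] at h2
  refine tendsto_of_tendsto_of_tendsto_of_le_of_le tendsto_const_nhds h2 (fun _ => zero_le)
    fun n => ?_
  have he : (fun x => P n (X n x) - Y x) = (fun x => P n (X n x - Y x)) +
      fun x => P n (Y x) - Y x := by
    ext x
    simp only [Pi.add_apply, map_sub]
    abel
  simp only [he]
  refine (eLpNorm_add_le (hPm n ((hX n).sub hY.1)) ((hPm n hY.1).sub hY.1) (by norm_num)).trans ?_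
  exact add_le_add (eLpNorm_mono fun x => hP n _) le_rfl

end

lemma isClosed_setOf_tendsto_self {V : Type*} [NormedAddCommGroup V] [NormedSpace ℝ V]
    {P : ℕ → V →L[ℝ] V} (hP : ∀ n w, ‖P n w‖ ≤ ‖w‖) :
    IsClosed {w | Tendsto (fun n => P n w) atTop (𝓝 w)} := by
  refine isClosed_of_closure_subset fun w hw => ?_
  rw [Set.mem_ofPred_eq, Metric.tendsto_atTop]
  intro ε hε
  obtain ⟨z, hz, hzw⟩ := Metric.mem_closure_iff.1 hw (ε / 3) (by positivity)
  obtain ⟨n₀, hn₀⟩ := Metric.tendsto_atTop.1 hz (ε / 3) (by positivity)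
  refine ⟨n₀, fun n hn => ?_⟩
  have h1 : dist (P n w) (P n z) < ε / 3 := by
    rw [dist_eq_norm, ← map_sub]
    exact (hP n _).trans_lt (by rwa [← dist_eq_norm])
  have h2 := hn₀ n hn
  rw [dist_comm] at hzw
  linarith [dist_triangle4 (P n w) (P n z) z w]

lemma norm_tensorMap_projH_le {N : ℕ} (B : Frame T d N) (W : CMTensor T d) :
    ‖tensorMap B.projH W‖ ≤ ‖W‖ := by
  have h1 : ‖B.projH‖ ≤ 1 := ContinuousLinearMap.opNorm_le_bound _ zero_le_one fun h => by
    rw [one_mul]; exact B.norm_projH_le h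
  refine (norm_tensorMap_le _ _).trans (mul_le_of_le_one_left (norm_nonneg _) ?_)
  exact pow_le_one₀ (norm_nonneg _) h1

lemma tendsto_tensorMap_projH (hT : 0 < T) (W : CMTensor T d) :
    Tendsto (fun n => tensorMap (gridFrame d hT n).projH W) atTop (𝓝 W) := by
  refine dense_cmTmul (p := fun W => Tendsto (fun n => tensorMap (gridFrame d hT n).projH W) atTop
    (𝓝 W)) (isClosed_setOf_tendsto_self fun n => norm_tensorMap_projH_le _) ?_ ?_ ?_ W
  · intro W W' h h'
    simpa only [map_add] using h.add h'
  · intro h k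
    simp only [tensorMap_cmTmul]
    have hh := tendsto_gridFrame_projH hT h
    have hk := tendsto_gridFrame_projH hT k
    rw [tendsto_iff_norm_sub_tendsto_zero] at hh hk ⊢
    have h1 := (hh.mul_const ‖k‖).add (hk.const_mul ‖h‖)
    simp only [zero_mul, mul_zero, add_zero] at h1
    refine squeeze_zero (fun n => norm_nonneg _) (fun n => ?_) h1
    have he : cmTmul ((gridFrame d hT n).projH h) ((gridFrame d hT n).projH k) - cmTmul h k =
        cmTmul ((gridFrame d hT n).projH h - h) ((gridFrame d hT n).projH k) +
        cmTmul h ((gridFrame d hT n).projH k - k) := by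
      have e1 := add_cmTmul ((gridFrame d hT n).projH h - h) h ((gridFrame d hT n).projH k)
      have e2 := cmTmul_add h ((gridFrame d hT n).projH k - k) k
      rw [sub_add_cancel] at e1 e2
      rw [e1, e2]
      abel
    rw [he]
    refine (norm_add_le _ _).trans ?_
    rw [norm_cmTmul, norm_cmTmul]
    gcongr
    exact Frame.norm_projH_le _ _
  · simp

/-- Functionals whose adjoints converge in the Cameron--Martin space converge in `L²`. -/
lemma IsWienerMeasure.exists_limit_dual (hμ : IsWienerMeasure μ) (hT : 0 < T)
    {η : ℕ → PathSpace T d →L[ℝ] ℝ} {h : CMSpace T d}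
    (hη : Tendsto (fun n => cmAdjoint T d (η n)) atTop (𝓝 h)) :
    ∃ φ : PathSpace T d → ℝ, MemLp φ 2 μ ∧
      Tendsto (fun n => eLpNorm (fun x => η n x - φ x) 2 μ) atTop (𝓝 0) := by
  let u : ℕ → Lp ℝ 2 μ := fun n => (hμ.memLp_dual hT (η n)).toLp _
  -- The Wiener isometry: distances in L²(μ) equal distances of the adjoints in H_T, so a convergent
  -- sequence of adjoints yields a Cauchy sequence.
  have hdist : ∀ m n, dist (u m) (u n) = dist (cmAdjoint T d (η m)) (cmAdjoint T d (η n)) := by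
    intro m n
    rw [Lp.dist_def, dist_eq_norm, ← cmAdjoint_sub]
    have h1 : eLpNorm (⇑(u m) - ⇑(u n)) 2 μ = eLpNorm (η m - η n) 2 μ := by
      refine eLpNorm_congr_ae ?_
      filter_upwards [(hμ.memLp_dual hT (η m)).coeFn_toLp, (hμ.memLp_dual hT (η n)).coeFn_toLp]
        with x h1 h2
      rw [Pi.sub_apply, h1, h2]
      rfl
    rw [h1, hμ.eLpNorm_dual hT (η m - η n), ENNReal.toReal_ofReal (norm_nonneg _)]
  have hc : CauchySeq u := by
    have := hη.cauchySeq
    rw [Metric.cauchySeq_iff] at this ⊢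
    simpa only [hdist] using this
  obtain ⟨φ, hφ⟩ := cauchySeq_tendsto_of_complete hc
  refine ⟨φ, Lp.memLp φ, ?_⟩
  rw [Lp.tendsto_Lp_iff_tendsto_eLpNorm'] at hφ
  refine hφ.congr fun n => eLpNorm_congr_ae ?_
  filter_upwards [(hμ.memLp_dual hT (η n)).coeFn_toLp] with x h1
  rw [Pi.sub_apply, h1]

end

noncomputable section

/-! ### The chain rule for the solution operator -/

variable {T : ℝ} {d : ℕ} {μ : Measure (PathSpace T d)}
  {c : ℝ} {F : PathSpace T d → ℝ} {G₁ : PathSpace T d → CMSpace T d}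
  {G₂ : PathSpace T d → CMTensor T d} {D : PathSpace T d → L2Path T d →L[ℝ] L2Path T d →L[ℝ] ℝ}

namespace Frame

variable {N : ℕ} (B : Frame T d N)

lemma lift_single (l : Fin N) : B.lift (Pi.single l 1) = B.e l := by
  rw [lift_apply]
  simp [Pi.single_apply]

lemma tensorMap_projH_eq (W : CMTensor T d) : tensorMap B.projH W =
    ∑ i, ∑ j, ⟪W, cmTmul (B.e i) (B.e j)⟫_ℝ • cmTmul (B.e i) (B.e j) := by
  refine dense_cmTmul (p := fun W => tensorMap B.projH W =
    ∑ i, ∑ j, ⟪W, cmTmul (B.e i) (B.e j)⟫_ℝ • cmTmul (B.e i) (B.e j))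
    (isClosed_eq (by fun_prop) (by fun_prop)) ?_ ?_ ?_ W
  · intro W W' h h'
    simp only [map_add, h, h', inner_add_left, add_smul, Finset.sum_add_distrib]
  · intro h k
    have hl : ∀ (x : CMSpace T d) (s : Finset (Fin N)) (f : Fin N → CMSpace T d),
        cmTmul (∑ i ∈ s, f i) x = ∑ i ∈ s, cmTmul (f i) x := fun x s f =>
      map_sum (⟨⟨fun h => cmTmul h x, by simpa using smul_cmTmul (0 : ℝ) 0 x⟩,
        fun h h' => add_cmTmul h h' x⟩ : CMSpace T d →+ CMTensor T d) f s
    have hr : ∀ (x : CMSpace T d) (s : Finset (Fin N)) (f : Fin N → CMSpace T d),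
        cmTmul x (∑ i ∈ s, f i) = ∑ i ∈ s, cmTmul x (f i) := fun x s f =>
      map_sum (⟨⟨fun h => cmTmul x h, by simpa using cmTmul_smul (0 : ℝ) x 0⟩,
        fun h h' => cmTmul_add x h h'⟩ : CMSpace T d →+ CMTensor T d) f s
    rw [tensorMap_cmTmul, projH_apply, projH_apply, hl]
    refine Finset.sum_congr rfl fun i _ => ?_
    rw [hr]
    refine Finset.sum_congr rfl fun j _ => ?_
    rw [smul_cmTmul, cmTmul_smul, smul_smul, inner_cmTmul_cmTmul, real_inner_comm h,
      real_inner_comm k]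
  · simp

/-- Identifies the coordinate gradient of an average: once frame vectors are replaced by their
images under R, the sum over the frame reassembles to R of the projected gradient. With R the
adjoint of `solH` this is the chain rule. -/
lemma gradCLM_slope (R : CMSpace T d →L[ℝ] CMSpace T d) (a : ℝ) (g : CMSpace T d) :
    gradCLM (fun l => R (B.e l)) (B.slope a g) = R ((a • B.projH) g) := by
  rw [gradCLM_apply, smul_apply, map_smul, projH_apply, map_sum, Finset.smul_sum]
  refine Finset.sum_congr rfl fun l _ => ?_
  rw [slope_apply, lift_single, map_smul, smul_smul, real_inner_comm]

lemma grad₂CLM_hess (R : CMSpace T d →L[ℝ] CMSpace T d) (a : ℝ) (W : CMTensor T d) :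
    grad₂CLM (fun l => R (B.e l)) (B.hess a W) = tensorMap R ((a ^ 2 • tensorMap B.projH) W) := by
  rw [grad₂CLM_apply, smul_apply, map_smul, tensorMap_projH_eq, map_sum, Finset.smul_sum]
  refine Finset.sum_congr rfl fun i _ => ?_
  rw [map_sum, Finset.smul_sum]
  refine Finset.sum_congr rfl fun j _ => ?_
  rw [hess_apply, lift_single, lift_single, map_smul, smul_smul, tensorMap_cmTmul]

lemma slope_comp_coord (a : ℝ) (g : CMSpace T d) : B.slope a g ∘L B.coord = a • B.pairing g := rfl

/-- The gradient bound in the norm of the Cameron--Martin space. -/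
lemma norm_smul_projH_le {a K : ℝ} {g g₀ : CMSpace T d} (ha : |a| ≤ 1)
    (h : ∀ u, |B.slope a g u - B.slope a g₀ u| ≤ K * ‖B.path u‖) (hK : 0 ≤ K) :
    ‖(a • B.projH) g‖ ≤ K * ‖cmEmbed T d‖ + ‖g₀‖ := by
  set q := B.projH (g - g₀) with hq
  -- Testing with the coordinates of g − g₀ makes the left side |a|‖q‖², while the right side is at
  -- most K‖𝔢‖‖q‖; divide by ‖q‖.
  have h1 := h (B.coord (cmEmbed T d (g - g₀)))
  have h2 : B.lift (B.coord (cmEmbed T d (g - g₀))) = q := rfl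
  rw [slope_apply, slope_apply, ← mul_sub, ← inner_sub_left, path_apply, h2, hq,
    real_inner_comm, inner_projH_self, ← hq, abs_mul, abs_of_nonneg (sq_nonneg ‖q‖)] at h1
  have h3 : |a| * ‖q‖ ≤ K * ‖cmEmbed T d‖ := by
    rcases eq_or_lt_of_le (norm_nonneg q) with h0 | h0
    · rw [← h0, mul_zero]; positivity
    · have h4 : K * ‖cmEmbed T d q‖ ≤ K * (‖cmEmbed T d‖ * ‖q‖) := by
        gcongr
        exact (cmEmbed T d).le_opNorm q
      nlinarith
  have h5 : (a • B.projH) g = a • q + a • B.projH g₀ := by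
    rw [hq, smul_apply, map_sub, smul_sub]
    abel
  rw [h5]
  refine (norm_add_le _ _).trans (add_le_add ?_ ?_)
  · rwa [norm_smul, Real.norm_eq_abs]
  · rw [norm_smul, Real.norm_eq_abs]
    exact (mul_le_of_le_one_left (norm_nonneg _) ha).trans (B.norm_projH_le g₀)

/-- The projected tensor is still a form bounded on L², composed with a projection of norm at most
1, so the Hilbert–Schmidt bound does not depend on the frame. -/
lemma norm_smul_tensorMap_projH_le {a K : ℝ} {W : CMTensor T d} (ha : a ^ 2 ≤ 1) (hK : 0 ≤ K)
    (h : ∀ h k : CMSpace T d, |⟪W, cmTmul h k⟫_ℝ| ≤ K * ‖cmToL2 T d h‖ * ‖cmToL2 T d k‖) :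
    ‖(a ^ 2 • tensorMap B.projH) W‖ ≤ K * hsConst T d := by
  have hadj : B.projH.adjoint = B.projH := by
    rw [eq_comm, ContinuousLinearMap.eq_adjoint_iff]
    exact B.inner_projH
  have h1 : ‖B.projH‖ ≤ 1 := ContinuousLinearMap.opNorm_le_bound _ zero_le_one fun h => by
    rw [one_mul]; exact B.norm_projH_le h
  have h2 := norm_cmTensor_le (tensorMap B.projH W) B.projH hK fun h' k' => by
    rw [inner_tensorMap, hadj]
    exact h _ _
  rw [smul_apply, norm_smul, Real.norm_of_nonneg (sq_nonneg a)]
  refine (mul_le_of_le_one_left (norm_nonneg _) ha).trans (h2.trans ?_)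
  refine mul_le_mul_of_nonneg_left ?_ hK
  exact mul_le_of_le_one_right (hsConst_nonneg T d) (pow_le_one₀ (norm_nonneg _) h1)

/-- Here the constant depends on the frame through ‖B.path‖; it serves only to verify the growth
condition for a single average, not for limits. -/
lemma norm_hess_le {a K : ℝ} {W : CMTensor T d} (ha : a ^ 2 ≤ 1) (hK : 0 ≤ K)
    (h : ∀ h k : CMSpace T d, |⟪W, cmTmul h k⟫_ℝ| ≤ K * ‖cmToL2 T d h‖ * ‖cmToL2 T d k‖) :
    ‖B.hess a W‖ ≤ K * (‖pathToL2 T d‖ * ‖B.path‖) ^ 2 := by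
  have hu : ∀ u, ‖cmToL2 T d (B.lift u)‖ ≤ ‖pathToL2 T d‖ * (‖B.path‖ * ‖u‖) := fun u =>
    (B.norm_cmToL2_lift_le u).trans (by gcongr; exact B.path.le_opNorm u)
  refine ContinuousLinearMap.opNorm_le_bound₂ _ (by positivity) fun u u' => ?_
  rw [hess_apply, norm_mul, Real.norm_of_nonneg (sq_nonneg a), Real.norm_eq_abs]
  refine (mul_le_of_le_one_left (abs_nonneg _) ha).trans ((h _ _).trans ?_)
  calc _ ≤ K * (‖pathToL2 T d‖ * (‖B.path‖ * ‖u'‖)) * (‖pathToL2 T d‖ * (‖B.path‖ * ‖u‖)) := by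
        gcongr
        · exact hu u'
        · exact hu u
    _ = _ := by ring

end Frame

lemma isWienerIntegral_dual (hμ : IsWienerMeasure μ) (hT : 0 < T) (η : PathSpace T d →L[ℝ] ℝ) :
    IsWienerIntegral μ (cmAdjoint T d η) η :=
  ⟨hμ.memLp_dual hT η, fun _ => η, tendsto_const_nhds, by simp⟩

/-- The averaged functions, composed with the solution operator, belong to the Sobolev space. -/
lemma hasGross_avg_comp_solC (A : Matrix (Fin d) (Fin d) ℝ) (hT : 0 < T) (hμ : IsWienerMeasure μ)
    (hF : HasGrossSobolevGradients μ F G₁ G₂) {N : ℕ} (B : Frame T d N) {a b : ℝ} (hb : b ≠ 0)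
    (hab : a ^ 2 + b ^ 2 = 1) {K : ℝ} (hK : 0 ≤ K)
    (h : ∀ v, ∀ h k : CMSpace T d, |⟪B.avg μ a b G₂ v, cmTmul h k⟫_ℝ| ≤
        K * (1 + ‖B.path v‖) * ‖cmToL2 T d h‖ * ‖cmToL2 T d k‖) :
    HasGrossSobolevGradients μ (fun x => B.avg μ a b F (B.coord (solC T A x)))
      (fun x => (solH T A).adjoint ((a • B.projH) (B.avg μ a b G₁ (B.coord (solC T A x)))))
      (fun x => tensorMap (solH T A).adjoint
        ((a ^ 2 • tensorMap B.projH) (B.avg μ a b G₂ (B.coord (solC T A x))))) := by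
  have := hμ.isProbabilityMeasure
  have ha : a ^ 2 ≤ 1 := by nlinarith [sq_nonneg b]
  have hC : ∀ v, ‖fderiv ℝ (fderiv ℝ (B.avg μ a b F)) v‖ ≤
      K * (1 + ‖B.path‖) * (‖pathToL2 T d‖ * ‖B.path‖) ^ 2 * (1 + ‖v‖) := by
    intro v
    rw [B.fderiv_fderiv_avg hμ hT hb hab hF]
    refine (B.norm_hess_le ha (by positivity) (h v)).trans ?_
    have h1 : 1 + ‖B.path v‖ ≤ (1 + ‖B.path‖) * (1 + ‖v‖) := by
      nlinarith [B.path.le_opNorm v, norm_nonneg B.path, norm_nonneg v]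
    calc _ ≤ K * ((1 + ‖B.path‖) * (1 + ‖v‖)) * (‖pathToL2 T d‖ * ‖B.path‖) ^ 2 := by gcongr
      _ = _ := by ring
  -- The coordinates of Sx are again continuous functionals of x, hence Wiener integrals of the
  -- frame vectors transformed by the adjoint of `solH`.
  have hδ : ∀ l, IsWienerIntegral μ ((solH T A).adjoint (B.e l)) (B.η l ∘L solC T A) := by
    intro l
    rw [← B.adjoint, ← cmAdjoint_comp_solC]
    exact isWienerIntegral_dual hμ hT _
  have hmom : MemLp (fun x => (1 + ‖fun i => (B.η i ∘L solC T A) x‖) ^ 3) 2 μ := by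
    refine ((hμ.memLp_one_add_norm_pow hT 3 2 (by norm_num)).const_mul
      ((1 + ‖B.coord ∘L solC T A‖) ^ 3)).mono'
      (by fun_prop : Continuous _).aestronglyMeasurable (Eventually.of_forall fun x => ?_)
    rw [Real.norm_of_nonneg (by positivity), ← mul_pow]
    gcongr
    have h1 := (B.coord ∘L solC T A).le_opNorm x
    change 1 + ‖(B.coord ∘L solC T A) x‖ ≤ _
    nlinarith [norm_nonneg (B.coord ∘L solC T A), norm_nonneg x]
  have key := hasGross_of_contDiff (B.contDiff_avg hμ hT hb hab hF) hC hδ hmom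
  rw [B.fderiv_fderiv_avg hμ hT hb hab hF, B.fderiv_avg hμ hT hb hab hF] at key
  simp only [B.gradCLM_slope, B.grad₂CLM_hess] at key
  exact key

end

/-! ### The chain rule in the limit, and stability of the Lipschitz classes under the solution
operator. -/

noncomputable section

variable {T : ℝ} {d : ℕ} {μ : Measure (PathSpace T d)}
  {c : ℝ} {F : PathSpace T d → ℝ} {G₁ : PathSpace T d → CMSpace T d}
  {G₂ : PathSpace T d → CMTensor T d} {D : PathSpace T d → L2Path T d →L[ℝ] L2Path T d →L[ℝ] ℝ}

lemma one_add_norm_proj_solC_le (A : Matrix (Fin d) (Fin d) ℝ) (hT : 0 < T) (n : ℕ)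
    (x : PathSpace T d) :
    1 + ‖(gridFrame d hT (n + 1)).path ((gridFrame d hT (n + 1)).coord (solC T A x))‖ ≤
      (1 + 4 * ‖solC T A‖) * (1 + ‖x‖) := by
  rw [← Frame.proj_apply]
  have h1 := norm_gridFrame_proj_le (d := d) hT n.succ_pos (solC T A x)
  have h2 := (solC T A).le_opNorm x
  nlinarith [norm_nonneg (solC T A), norm_nonneg x]

/-- The chain rule: the Sobolev gradients of `F ∘ S`, `S` the solution operator. -/
lemma HasGrossSobolevGradients.comp_solC (A : Matrix (Fin d) (Fin d) ℝ) (hT : 0 < T)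
    (hμ : IsWienerMeasure μ) (hF : HasGrossSobolevGradients μ F G₁ G₂)
    (hD : LipschitzForm μ c G₂ D) :
    HasGrossSobolevGradients μ (fun x => F (solC T A x))
      (fun x => (solH T A).adjoint (G₁ (solC T A x)))
      (fun x => tensorMap (solH T A).adjoint (G₂ (solC T A x))) := by
  have := hμ.isProbabilityMeasure
  obtain ⟨K, hK, hbound⟩ := hμ.exists_uniform_bounds hT hF hD
  have bd := fun n v => hbound n _ rfl v
  have hS := quasiMeasurePreserving_solC A hT hμ
  have hsq : ∀ n, mixCos n ^ 2 ≤ 1 := fun n => by nlinarith [mixCos_sq_add n, sq_nonneg (mixSin n)]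
  set s := 1 + 4 * ‖solC T A‖ with hs
  have hs0 : 0 ≤ s := by positivity
  have hmem : ∀ k : ℕ, MemLp (fun x : PathSpace T d => (s * (1 + ‖x‖)) ^ k) 2 μ := by
    intro k
    simp_rw [mul_pow]
    exact (hμ.memLp_one_add_norm_pow hT k 2 (by norm_num)).const_mul _
  have hgross := fun n => hasGross_avg_comp_solC A hT hμ hF (gridFrame d hT (n + 1))
    (mixSin_ne_zero n) (mixCos_sq_add n) hK fun v => (bd n v).1
  -- the function itself
  obtain ⟨φ, hφm, hφ⟩ := hμ.exists_limit_dual hT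
    (η := fun n => (gridFrame d hT (n + 1)).slope (mixCos n) (∫ x, G₁ x ∂μ) ∘L
      (gridFrame d hT (n + 1)).coord ∘L solC T A) (h := (solH T A).adjoint (∫ x, G₁ x ∂μ)) (by
      have h1 := ((tendsto_add_atTop_iff_nat 1).2 (tendsto_gridFrame_projH hT (∫ x, G₁ x ∂μ)))
      have h2 := ((solH T A).adjoint.continuous.tendsto _).comp (tendsto_mixCos.smul h1)
      rw [one_smul] at h2
      refine h2.congr fun n => ?_
      rw [← ContinuousLinearMap.comp_assoc, Frame.slope_comp_coord, cmAdjoint_comp_solC,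
        cmAdjoint_smul, Frame.cmAdjoint_pairing]
      rfl)
  -- The linear part plays the role of the sequence L, with limit φ; what remains of the average is
  -- dominated by a cubic in ‖x‖, uniformly in n.
  obtain ⟨m0, t0⟩ := tendsto_eLpNorm_comp hS (fun n => (hμ.memLp_gridAvg hT hF.1 n).1) hF.1.1
    (hμ.tendsto_gridAvg hT hF.1) (fun n => (hμ.memLp_dual hT _).1) hφm hφ
    ((hmem 3).const_mul K) (fun n => Eventually.of_forall fun x => by
      refine ((bd n _).2.2).trans ?_
      gcongr
      exact one_add_norm_proj_solC_le A hT n x)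
  -- the gradient
  have hzero : ∀ {V : Type} [NormedAddCommGroup V], Tendsto (fun _ : ℕ => eLpNorm
      (fun _ : PathSpace T d => (0 : V) - 0) 2 μ) atTop (𝓝 0) := by
    intro V _; simp
  obtain ⟨m1, t1⟩ := tendsto_eLpNorm_comp hS
    (X := fun n x => (mixCos n • (gridFrame d hT (n + 1)).projH) (gridAvg hT μ n G₁ x))
    (L := fun _ _ => 0) (M := fun _ => 0)
    (fun n => (ContinuousLinearMap.continuous _).comp_aestronglyMeasurable
      (hμ.memLp_gridAvg hT hF.2.1 n).1) hF.2.1.1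
    (tendsto_eLpNorm_clm (fun n w => by
        rw [smul_apply, norm_smul, Real.norm_eq_abs]
        exact (mul_le_of_le_one_left (norm_nonneg _) (abs_mixCos_le n)).trans
          (Frame.norm_projH_le _ w))
      (fun w => by
        have := tendsto_mixCos.smul
          ((tendsto_add_atTop_iff_nat 1).2 (tendsto_gridFrame_projH hT w))
        rwa [one_smul] at this)
      (fun n => (hμ.memLp_gridAvg hT hF.2.1 n).1) hF.2.1 (hμ.tendsto_gridAvg hT hF.2.1))
    (fun _ => aestronglyMeasurable_const) (memLp_const 0) hzero
    ((hmem 2).const_mul (K * ‖cmEmbed T d‖ + ‖∫ x, G₁ x ∂μ‖))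
    (fun n => Eventually.of_forall fun x => by
      rw [sub_zero]
      refine (Frame.norm_smul_projH_le _ (abs_mixCos_le n) (bd n _).2.1 (by positivity)).trans ?_
      have h1 := pow_le_pow_left₀ (by positivity) (one_add_norm_proj_solC_le A hT n x) 2
      have h2 : 1 ≤ (s * (1 + ‖x‖)) ^ 2 :=
        one_le_pow₀ (one_le_mul_of_one_le_of_one_le (by rw [hs]; linarith [norm_nonneg (solC T A)])
          (by linarith [norm_nonneg x]))
      calc _ ≤ K * (s * (1 + ‖x‖)) ^ 2 * ‖cmEmbed T d‖ +
            ‖∫ x, G₁ x ∂μ‖ * (s * (1 + ‖x‖)) ^ 2 := by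
            refine add_le_add ?_ (le_mul_of_one_le_right (norm_nonneg _) h2)
            gcongr
        _ = _ := by ring)
  -- the second gradient
  obtain ⟨m2, t2⟩ := tendsto_eLpNorm_comp hS
    (X := fun n x => (mixCos n ^ 2 • tensorMap (gridFrame d hT (n + 1)).projH)
      (gridAvg hT μ n G₂ x))
    (L := fun _ _ => 0) (M := fun _ => 0)
    (fun n => (ContinuousLinearMap.continuous _).comp_aestronglyMeasurable
      (hμ.memLp_gridAvg hT hF.2.2.1 n).1) hF.2.2.1.1
    (tendsto_eLpNorm_clm (fun n w => by
        rw [smul_apply, norm_smul, Real.norm_of_nonneg (sq_nonneg _)]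
        exact (mul_le_of_le_one_left (norm_nonneg _) (hsq n)).trans
          (norm_tensorMap_projH_le _ w))
      (fun w => by
        have := (tendsto_mixCos.pow 2).smul
          ((tendsto_add_atTop_iff_nat 1).2 (tendsto_tensorMap_projH hT w))
        rwa [one_pow, one_smul] at this)
      (fun n => (hμ.memLp_gridAvg hT hF.2.2.1 n).1) hF.2.2.1 (hμ.tendsto_gridAvg hT hF.2.2.1))
    (fun _ => aestronglyMeasurable_const) (memLp_const 0) hzero
    ((hmem 1).const_mul (K * hsConst T d))
    (fun n => Eventually.of_forall fun x => by
      rw [sub_zero]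
      refine (Frame.norm_smul_tensorMap_projH_le _ (hsq n) (by positivity) (bd n _).1).trans ?_
      have h1 := one_add_norm_proj_solC_le A hT n x
      have h2 := hsConst_nonneg T d
      rw [pow_one]
      calc _ ≤ K * (s * (1 + ‖x‖)) * hsConst T d := by gcongr
        _ = _ := by ring)
  have hclm : ∀ {V : Type} [NormedAddCommGroup V] [NormedSpace ℝ V] (R : V →L[ℝ] V)
      {X : ℕ → PathSpace T d → V} {Y : PathSpace T d → V},
      Tendsto (fun n => eLpNorm (fun x => X n x - Y x) 2 μ) atTop (𝓝 0) →
      Tendsto (fun n => eLpNorm (fun x => R (X n x) - R (Y x)) 2 μ) atTop (𝓝 0) := by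
    intro V _ _ R X Y h
    have h1 := ENNReal.Tendsto.const_mul h (a := ENNReal.ofReal ‖R‖) (Or.inr ENNReal.ofReal_ne_top)
    rw [mul_zero] at h1
    refine tendsto_of_tendsto_of_tendsto_of_le_of_le tendsto_const_nhds h1 (fun _ => zero_le)
      fun n => eLpNorm_le_mul_eLpNorm_of_ae_le_mul (Eventually.of_forall fun x => ?_) 2
    rw [← map_sub]
    exact R.le_opNorm _
  exact .of_tendsto hgross m0 ((solH T A).adjoint.comp_memLp' m1)
    ((tensorMap (solH T A).adjoint).comp_memLp' m2) t0 (hclm _ t1) (hclm _ t2)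

/-- Composition with the solution operator preserves the Lipschitz classes. -/
lemma UpsilonWith.comp_solC (A : Matrix (Fin d) (Fin d) ℝ) (hT : 0 < T) (hμ : IsWienerMeasure μ)
    (hF : UpsilonWith μ c F) :
    UpsilonWith μ (‖solC T A‖ * ‖solL2 T A‖ ^ 2 * c) (fun x => F (solC T A x)) := by
  obtain ⟨G₁, G₂, D, hG, hv, hlip⟩ := hF
  -- The class allows any real c, while the growth estimates need a nonnegative one. The final
  -- constant is still obtained from c itself.
  have hD : LipschitzForm μ (max c 0) G₂ D := by
    refine ⟨le_max_right _ _, hv, fun x g h k => (hlip x g h k).trans ?_⟩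
    gcongr
    exact le_max_left _ _
  refine ⟨_, _, fun x => (D (solC T A x)).bilinearComp (solL2 T A) (solL2 T A),
    hG.comp_solC A hT hμ hD, ?_, ?_⟩
  · filter_upwards [(quasiMeasurePreserving_solC A hT hμ).ae hv] with x hx h k
    -- Moving the adjoints to the other side turns h ⊗ k into S_H h ⊗ S_H k, and the intertwining
    -- with L² shows that D(Sx) composed with `solL2` represents the new second gradient.
    rw [inner_tensorMap, ContinuousLinearMap.adjoint_adjoint, ← hx, cmToL2_solH, cmToL2_solH]
    rfl
  · intro x g h k
    have h1 := hlip (solC T A x) (solH T A g) (solL2 T A h) (solL2 T A k)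
    -- Shifting x by 𝔢g shifts Sx by 𝔢(S_H g), again a Cameron–Martin shift, so the hypothesis
    -- applies at Sx.
    rw [cmEmbed_solH, ← map_add] at h1
    refine h1.trans ?_
    rcases le_or_gt 0 c with hc | hc
    · have e1 := (solC T A).le_opNorm (cmEmbed T d g)
      have e2 := (solL2 T A).le_opNorm h
      have e3 := (solL2 T A).le_opNorm k
      calc _ ≤ c * (‖solC T A‖ * ‖cmEmbed T d g‖) * (‖solL2 T A‖ * ‖h‖) *
            (‖solL2 T A‖ * ‖k‖) := by gcongr
        _ = _ := by ring
    · -- for negative `c` the hypothesis forces all the products to vanish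
      have hprod : ‖cmEmbed T d g‖ * ‖h‖ * ‖k‖ = 0 := by
        have h2 := (abs_nonneg _).trans (hlip x g h k)
        have h3 : 0 ≤ ‖cmEmbed T d g‖ * ‖h‖ * ‖k‖ := by positivity
        nlinarith
      have e4 : ‖solC T A‖ * ‖solL2 T A‖ ^ 2 * c * ‖cmEmbed T d g‖ * ‖h‖ * ‖k‖ =
          ‖solC T A‖ * ‖solL2 T A‖ ^ 2 * c * (‖cmEmbed T d g‖ * ‖h‖ * ‖k‖) := by ring
      rw [e4, hprod, mul_zero]
      have h5 : 0 ≤ ‖solC T A (cmEmbed T d g)‖ * ‖solL2 T A h‖ * ‖solL2 T A k‖ := by positivity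
      nlinarith

end

/-! ### Assembly of the theorem. -/

theorem mainTheorem8 (T : ℝ) (hT : 0 < T) (d : ℕ) (A : Matrix (Fin d) (Fin d) ℝ) :
    ∃ S : EuclideanSpace ℝ (Fin d) → PathSpace T d → PathSpace T d,
      (∀ y₀ f y, IsSolution A y₀ f y ↔ y = S y₀ f) ∧
      (∃ K : ℝ≥0, ∀ y₀, LipschitzWith K (S y₀)) ∧
      (∃ K : ℝ≥0, ∀ μ : Measure (PathSpace T d), IsWienerMeasure μ →
        ∀ (F : PathSpace T d → ℝ) (c : ℝ), UpsilonWith μ c F →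
          UpsilonWith μ (K * c) (F ∘ S 0)) ∧
      (∀ μ : Measure (PathSpace T d), IsWienerMeasure μ →
        ∀ F ∈ Upsilon μ, F ∘ S 0 ∈ Upsilon μ) := by
  have h0 : ∀ F : PathSpace T d → ℝ, (F ∘ fun f => solC T A
      (ContinuousMap.const _ (0 : EuclideanSpace ℝ (Fin d)) + f)) = fun x => F (solC T A x) := by
    intro F
    ext x
    have : ContinuousMap.const _ (0 : EuclideanSpace ℝ (Fin d)) + x = x := by ext; simp
    simp only [Function.comp_apply, this]
  refine ⟨fun y₀ f => solC T A (ContinuousMap.const _ y₀ + f), isSolution_iff A,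
    ⟨‖solC T A‖₊, fun y₀ => ?_⟩,
    -- One factor for the shift measured in the sup norm and one for each L²-argument of the form;
    -- all are determined by A, d and T, before μ and F are chosen.
    ⟨‖solC T A‖₊ * ‖solL2 T A‖₊ ^ 2, fun μ hμ F c hF => ?_⟩, fun μ hμ F hF => ?_⟩
  · refine LipschitzWith.of_dist_le_mul fun f g => ?_
    rw [dist_eq_norm, dist_eq_norm, ← map_sub, add_sub_add_left_eq_sub]
    exact (solC T A).le_opNorm _
  · rw [h0]
    simpa using hF.comp_solC A hT hμ
  · obtain ⟨c, hF⟩ := hF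
    rw [h0]
    exact ⟨_, hF.comp_solC A hT hμ⟩
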